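/- Consider single-parameter auctions with $n\ge 1$ agents, $m\ge 0$ indivisible goods, and a publicly known additive function $w(S)=\sum_{g\in S}w(g)$, $w(g)\in\mathbb{R}_{\ge 0}$, on sets $S\subseteq[m]$. Agent $i$ has a private parameter $v_i\in\mathbb{R}_{\ge 0}$, values a set $S$ at $v_i\,w(S)$, and submits a bid $b_i\in\mathbb{R}_{\ge 0}$. Let $\Pi_n([m])$ be the set of ordered partitions of $[m]$ into $n$ (possibly empty) bundles, let $$\mu=\max_{(P_1,\dots,P_n)\in\Pi_n([m])}\ \min_{j\in[n]} w(P_j)$$ be the maximin share, and let $\mathrm{OPT}(v)$, the optimal value of FA-MMS, be the maximum of the social welfare $\sum_i v_i\,w(S_i)$ over all $(S_1,\dots,S_n)\in\Pi_n([m])$ with $w(S_i)\ge\mu$ for all $i\in[n]$. A mechanism consists of an allocation rule $\mathcal A$ and a payment rule $p$, which map every $n$, $m$, $w$ and bid profile $b$ to an allocation $(A_1(b),\dots,A_n(b))\in\Pi_n([m])$ and payments $p_i(b)\ge 0$. It is DSIC if, for every agent $i$, all bids $b_{-i}$ of the other agents, every true parameter $v_i$ and every bid $b_i$, the utility $v_i\,w(A_i)-p_i$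 of agent $i$ when she bids $v_i$ is nonnegative and at least her utility when she bids $b_i$. **Theorem.** For every fixed $\varepsilon\in(0,1)$ there is a DSIC mechanism $(\mathcal A,p)$ such that for all $n$, $m$, $w$ and every profile $v=(v_1,\dots,v_n)$ of truthful bids: 1. the allocation $\mathcal A(v)=(A_1,\dots,A_n)$ is $(1/2-\varepsilon)$-approximate MMS, i.e. $w(A_i)\ge(1/2-\varepsilon)\,\mu$ for all $i\in[n]$; 2. its social welfare satisfies $\sum_i v_i\,w(A_i)\ge \mathrm{OPT}(v)$; and such that, on instances in which the weights and bids are rational (encoded as fractions in binary), the payments are rational and the allocation and the payments are computed in time polynomial in the bit length of the instance, where the polynomial may depend on $\varepsilon$. -/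

import Mathlib

open scoped NNReal

/-! ## A random access machine with logarithmic cost -/

namespace RAM

/-- The memory of the machine: arrays of registers, each register holding a natural number.
`σ a i` is the content of register `i` of array `a`.  (A given program only mentions finitely many
arrays.) -/
abbrev State : Type := ℕ → ℕ → ℕ

/-- The arithmetic instructions of the machine. -/
inductive Op where
  | plus
  | minus
  | times
  | quot

/-- Arithmetic on natural numbers: truncated subtraction and integer division
(division by zero returns zero). -/
def Op.apply : Op → ℕ → ℕ → ℕ
  | .plus, x, y => x + y
  | .minus, x, y => x - y
  | .times, x, y => x * y
  | .quot, x, y => x / y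

/-- Expressions: constants, reading a register whose index is computed (indirect addressing), and
arithmetic. -/
inductive Expr where
  | const (c : ℕ)
  | read (a : ℕ) (i : Expr)
  | op (o : Op) (e₁ e₂ : Expr)

/-- The value of an expression in a state. -/
def Expr.eval (σ : State) : Expr → ℕ
  | .const c => c
  | .read a i => σ a (i.eval σ)
  | .op o e₁ e₂ => o.apply (e₁.eval σ) (e₂.eval σ)

/-- The cost of evaluating an expression: each elementary operation costs one plus the bit length
of the number that it produces.  In particular the bit lengths of all operands and of all register
indices that are used are charged. -/
def Expr.cost (σ : State) : Expr → ℕ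
  | .const c => 1 + Nat.size c
  | .read a i => i.cost σ + (1 + Nat.size (σ a (i.eval σ)))
  | .op o e₁ e₂ => e₁.cost σ + e₂.cost σ + (1 + Nat.size (o.apply (e₁.eval σ) (e₂.eval σ)))

/-- Programs of the machine: writing the value of `e` into register `i` of array `a`, sequencing,
branching and looping; a condition holds if its value is nonzero. -/
inductive Prog where
  | skip
  | write (a : ℕ) (i e : Expr)
  | seq (p q : Prog)
  | branch (c : Expr) (p q : Prog)
  | loop (c : Expr) (p : Prog)

/-- `σ` with the content of register `i` of array `a` replaced by `x`. -/
def State.update (σ : State) (a i x : ℕ) : State :=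
  Function.update σ a (Function.update (σ a) i x)

/-- `Exec p σ t τ`: the program `p`, started in state `σ`, halts in state `τ` after a computation of
total cost `t`. -/
inductive Exec : Prog → State → ℕ → State → Prop where
  | skip (σ : State) : Exec .skip σ 1 σ
  | write (a : ℕ) (i e : Expr) (σ : State) :
      Exec (.write a i e) σ (i.cost σ + e.cost σ + 1) (σ.update a (i.eval σ) (e.eval σ))
  | seq {p q : Prog} {σ τ υ : State} {s t : ℕ} (hp : Exec p σ s τ) (hq : Exec q τ t υ) :
      Exec (.seq p q) σ (s + t + 1) υ
  | branch_true {c : Expr} {p q : Prog} {σ τ : State} {t : ℕ} (hc : c.eval σ ≠ 0)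
      (hp : Exec p σ t τ) : Exec (.branch c p q) σ (c.cost σ + t + 1) τ
  | branch_false {c : Expr} {p q : Prog} {σ τ : State} {t : ℕ} (hc : c.eval σ = 0)
      (hq : Exec q σ t τ) : Exec (.branch c p q) σ (c.cost σ + t + 1) τ
  | loop_false {c : Expr} {p : Prog} {σ : State} (hc : c.eval σ = 0) :
      Exec (.loop c p) σ (c.cost σ + 1) σ
  | loop_true {c : Expr} {p : Prog} {σ τ υ : State} {s t : ℕ} (hc : c.eval σ ≠ 0)
      (hp : Exec p σ s τ) (hl : Exec (.loop c p) τ t υ) :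
      Exec (.loop c p) σ (c.cost σ + s + t + 1) υ

/-- The initial state: the input is in the first registers of array `0`, all other registers
hold `0`. -/
def init (x : List ℕ) : State := fun a i => if a = 0 then x.getD i 0 else 0

/-- The bit length of an input. -/
def inputSize (x : List ℕ) : ℕ := (x.map fun k => 1 + Nat.size k).sum

/-- Polynomial-time computability: one program and one polynomial such that, for each `a`, the
program started on the input `enc a` halts, its logarithmic cost is at most the polynomial in the
bit length of the input, and at the end the first registers of array `1` hold the list `out a`. -/
def PolyTimeComputable {α : Type} (enc out : α → List ℕ) : Prop :=
  ∃ (p : Prog) (q : Polynomial ℕ), ∀ a : α, ∃ (t : ℕ) (τ : State),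
    Exec p (init (enc a)) t τ ∧ t ≤ q.eval (inputSize (enc a)) ∧
      ∀ (i : ℕ) (hi : i < (out a).length), τ 1 i = (out a)[i]

end RAM

/-! ## Fair auctions in a single-parameter environment -/

namespace FairAuction

/-- An ordered partition of the goods `Fin m` into `n` (possibly empty) bundles, given by the map
that sends each good to the agent who receives it. -/
abbrev Allocation (n m : ℕ) : Type := Fin m → Fin n

/-- The bundle of agent `i`. -/
def Allocation.bundle {n m : ℕ} (A : Allocation n m) (i : Fin n) : Finset (Fin m) :=
  Finset.univ.filter fun g => A g = i

/-- The additive summarization function: the weight of a set of goods. -/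
noncomputable def weight {m : ℕ} (w : Fin m → ℝ≥0) (S : Finset (Fin m)) : ℝ≥0 := ∑ g ∈ S, w g

/-- The maximin share: the maximum over all `n`-partitions of the minimum weight of a bundle. -/
noncomputable def maximinShare (n : ℕ) [NeZero n] {m : ℕ} (w : Fin m → ℝ≥0) : ℝ≥0 :=
  (Finset.univ : Finset (Allocation n m)).sup' Finset.univ_nonempty fun P =>
    (Finset.univ : Finset (Fin n)).inf' Finset.univ_nonempty fun j => weight w (P.bundle j)

/-- The allocation is MMS. -/
def IsMMS {n m : ℕ} [NeZero n] (w : Fin m → ℝ≥0) (A : Allocation n m) : Prop :=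
  ∀ i, maximinShare n w ≤ weight w (A.bundle i)

/-- The allocation is `α`-approximate MMS. -/
def IsApproxMMS {n m : ℕ} [NeZero n] (α : ℝ) (w : Fin m → ℝ≥0) (A : Allocation n m) : Prop :=
  ∀ i, α * (maximinShare n w : ℝ) ≤ (weight w (A.bundle i) : ℝ)

/-- Social welfare under the valuation parameters `v`. -/
noncomputable def socialWelfare {n m : ℕ} (w : Fin m → ℝ≥0) (v : Fin n → ℝ≥0)
    (A : Allocation n m) : ℝ≥0 :=
  ∑ i, v i * weight w (A.bundle i)

open Classical in
/-- The feasible solutions of the welfare maximization problem under MMS constraints. -/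
noncomputable def feasible (n : ℕ) [NeZero n] {m : ℕ} (w : Fin m → ℝ≥0) :
    Finset (Allocation n m) :=
  Finset.univ.filter fun A => IsMMS w A

theorem feasible_nonempty (n : ℕ) [NeZero n] {m : ℕ} (w : Fin m → ℝ≥0) :
    (feasible n w).Nonempty := by
  classical
  obtain ⟨P, -, hP⟩ := Finset.exists_mem_eq_sup' (Finset.univ_nonempty (α := Allocation n m))
    fun P => (Finset.univ : Finset (Fin n)).inf' Finset.univ_nonempty fun j =>
      weight w (P.bundle j)
  refine ⟨P, Finset.mem_filter.2 ⟨Finset.mem_univ _, fun i => ?_⟩⟩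
  have h : maximinShare n w = _ := hP
  rw [h]
  exact Finset.inf'_le _ (Finset.mem_univ i)

/-- The optimal value of FA-MMS: the maximum social welfare of an MMS allocation. -/
noncomputable def optFAMMS {n m : ℕ} [NeZero n] (w : Fin m → ℝ≥0) (v : Fin n → ℝ≥0) : ℝ≥0 :=
  (feasible n w).sup' (feasible_nonempty n w) fun A => socialWelfare w v A

/-- A (deterministic, direct) mechanism: an allocation rule and a payment rule, for every number
`n ≥ 1` of agents, every number `m` of goods, every public weight function and every bid profile. -/
structure Mechanism where
  /-- The allocation rule. -/
  alloc : ∀ {n m : ℕ} [NeZero n], (Fin m → ℝ≥0) → (Fin n → ℝ≥0) → Allocation n m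
  /-- The payment charged to each agent. -/
  pay : ∀ {n m : ℕ} [NeZero n], (Fin m → ℝ≥0) → (Fin n → ℝ≥0) → Fin n → ℝ≥0

/-- The quasilinear utility of agent `i` with valuation parameter `x` under the bid profile `b`. -/
noncomputable def Mechanism.utility (M : Mechanism) {n m : ℕ} [NeZero n] (w : Fin m → ℝ≥0)
    (b : Fin n → ℝ≥0) (i : Fin n) (x : ℝ≥0) : ℝ :=
  (x : ℝ) * (weight w ((M.alloc w b).bundle i) : ℝ) - (M.pay w b i : ℝ)

/-- Dominant strategy incentive compatibility: whatever the bids of the other agents are, reporting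
the true parameter `x` is at least as good for agent `i` as any other bid `b i`, and it never leads
to negative utility. -/
def Mechanism.IsDSIC (M : Mechanism) : Prop :=
  ∀ {n m : ℕ} [NeZero n] (w : Fin m → ℝ≥0) (b : Fin n → ℝ≥0) (i : Fin n) (x : ℝ≥0),
    M.utility w b i x ≤ M.utility w (Function.update b i x) i x ∧
      0 ≤ M.utility w (Function.update b i x) i x

/-- An instance with rational data, as it is given to an algorithm. -/
structure RatInstance where
  /-- The number of agents. -/
  n : ℕ
  /-- The number of goods. -/
  m : ℕ
  /-- There is at least one agent. -/
  neZero : NeZero n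
  /-- The weights of the goods. -/
  w : Fin m → ℚ≥0
  /-- The bids of the agents. -/
  b : Fin n → ℚ≥0

attribute [instance] RatInstance.neZero

/-- The weights as real numbers. -/
noncomputable def RatInstance.realW (I : RatInstance) : Fin I.m → ℝ≥0 := fun g => (I.w g : ℝ≥0)

/-- The bids as real numbers. -/
noncomputable def RatInstance.realB (I : RatInstance) : Fin I.n → ℝ≥0 := fun i => (I.b i : ℝ≥0)

/-- The input of an algorithm: the two sizes, followed by the numerators and denominators of the
weights and of the bids. -/
def RatInstance.encode (I : RatInstance) : List ℕ :=
  [I.n, I.m] ++ (List.ofFn I.w).flatMap (fun q => [q.num, q.den]) ++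
    (List.ofFn I.b).flatMap (fun q => [q.num, q.den])

/-- The mechanism runs in polynomial time: on instances with rational data the payments are rational
and some polynomial-time program outputs the owner of each good and the payments, each of them as a
numerator and a denominator. -/
def Mechanism.IsPolyTime (M : Mechanism) : Prop :=
  ∃ num den : (I : RatInstance) → Fin I.n → ℕ,
    (∀ (I : RatInstance) (i : Fin I.n),
      den I i ≠ 0 ∧ M.pay I.realW I.realB i = (num I i : ℝ≥0) / (den I i : ℝ≥0)) ∧
    RAM.PolyTimeComputable RatInstance.encode fun I =>
      List.ofFn (fun g => (M.alloc I.realW I.realB g : ℕ)) ++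
        (List.ofFn fun i => (num I i, den I i)).flatMap fun x => [x.1, x.2]

end FairAuction

/-! The rule partitions the goods into bundles that depend on the weights but not on the bids, and
hands the bundles out in increasing order of bids. By rearrangement this maximizes welfare over all
ways to hand out these fixed bundles (`sum_mul_slotWeight_le`), so Clarke payments make it truthful
(`fairMechanism_isDSIC`). What remains is to find bundles that are fair, beat every MMS allocation
once sorted, and can be computed.

Fix a large `K`. Computing the maximin share `μ` exactly is avoided by a level `T`, roughly `K * μ`:
`T ≥ (K - 1) * μ` by `le_shareLevel`, while `(K - 2) * T / K ^ 2 ≤ μ` because a positive `T` is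
attainable and `exists_bundles_of_attainable` turns this into an actual partition. For `θ = (K - 2)
* T / (2 * K ^ 2)` this gives `2 * θ ≤ μ` and `θ ≥ (1 / 2 - 3 / (2 * K)) * μ`. If `θ > 0`, goods of
weight at least `θ` stand alone, and the others fill bags that are closed on reaching `θ`, hence
below `2 * θ`. The `n - 1` lightest bundles of weight at least `θ` go to the lower positions and
everything else goes to the highest bidder. If `T = 0`, the highest bidder gets everything.

For the welfare, take `p + 1` agents of an MMS allocation whose bundles are lighter than `x`. Those
who own a good of weight at least `θ` own distinct such goods, all lighter than `x`. The others use
up at least `2 * θ` each of the remaining goods, so they are at most as many as the closed bags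
(`card_le_of_bundles`). Hence at least `p + 1` of the bundles made by the rule are lighter than `x`.
So below the top position the sorted bundles of the rule are dominated by the sorted MMS bundles
(`slot_spec`). Both have the same total weight, so passing to the rule only moves weight towards the
highest bidder (`socialWelfare_le_sortedWelfare`).

For the running time, attainability is decided by a dynamic program over the numbers of agents at
each of boundedly many levels (`reachable_succ`, `Dec.exists_deficit`). The rule uses only sums,
natural multiples and comparisons, so it commutes with strictly monotone additive maps (`slot_map`):
it is analysed in `ℝ` and executed in `ℕ` after clearing denominators. Programs are never written
out for the rule; they come from closure properties of `Comp` and `Dec`. -/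

namespace RAM

/-! ### Polynomially bounded functions -/

/-- `f` is bounded by a polynomial in `S`. -/
def PolyBdd {γ : Type} (S f : γ → ℕ) : Prop := ∃ q : Polynomial ℕ, ∀ c, f c ≤ q.eval (S c)

theorem polynomial_eval_mono (q : Polynomial ℕ) : Monotone fun x : ℕ => q.eval x := by
  intro x y h
  simp only [Polynomial.eval_eq_sum, Polynomial.sum]
  gcongr

namespace PolyBdd

variable {γ δ : Type} {S f g : γ → ℕ}

theorem const (a : ℕ) : PolyBdd S fun _ => a := ⟨Polynomial.C a, fun c => by simp⟩

theorem self : PolyBdd S S := ⟨Polynomial.X, fun c => by simp⟩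

theorem mono (hg : PolyBdd S g) (h : ∀ c, f c ≤ g c) : PolyBdd S f :=
  let ⟨q, hq⟩ := hg
  ⟨q, fun c => (h c).trans (hq c)⟩

theorem add (hf : PolyBdd S f) (hg : PolyBdd S g) : PolyBdd S fun c => f c + g c := by
  obtain ⟨p, hp⟩ := hf
  obtain ⟨q, hq⟩ := hg
  exact ⟨p + q, fun c => by simpa using add_le_add (hp c) (hq c)⟩

theorem mul (hf : PolyBdd S f) (hg : PolyBdd S g) : PolyBdd S fun c => f c * g c := by
  obtain ⟨p, hp⟩ := hf
  obtain ⟨q, hq⟩ := hg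
  exact ⟨p * q, fun c => by simpa using Nat.mul_le_mul (hp c) (hq c)⟩

theorem pow (hf : PolyBdd S f) (k : ℕ) : PolyBdd S fun c => f c ^ k := by
  obtain ⟨p, hp⟩ := hf
  exact ⟨p ^ k, fun c => by simpa using Nat.pow_le_pow_left (hp c) k⟩

theorem comp {S' : δ → ℕ} {π : γ → δ} {f : δ → ℕ} (hf : PolyBdd S' f)
    (hS : PolyBdd S fun c => S' (π c)) : PolyBdd S fun c => f (π c) := by
  obtain ⟨p, hp⟩ := hf
  obtain ⟨q, hq⟩ := hS
  exact ⟨p.comp q, fun c => by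
    rw [Polynomial.eval_comp]
    exact (hp _).trans (polynomial_eval_mono p (hq c))⟩

/-- A polynomially bounded function of an extended context is bounded by a function of the
base context, as long as the size of the extension is. -/
theorem exists_unif {S' : δ → ℕ} {f : δ → ℕ} (hf : PolyBdd S' f) (hg : PolyBdd S g) :
    ∃ F : γ → ℕ, PolyBdd S F ∧ ∀ c d, S' d ≤ g c → f d ≤ F c := by
  obtain ⟨p, hp⟩ := hf
  refine ⟨fun c => p.eval (g c), ?_, fun c d h => (hp d).trans (polynomial_eval_mono p h)⟩
  exact comp (S' := id) ⟨p, fun _ => le_rfl⟩ hg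

theorem size (hf : PolyBdd S f) : PolyBdd S fun c => Nat.size (f c) :=
  hf.mono fun _ => Nat.size_le.2 Nat.lt_two_pow_self

end PolyBdd

/-! ### Bit lengths -/

theorem size_le_self (x : ℕ) : Nat.size x ≤ x := Nat.size_le.2 Nat.lt_two_pow_self

theorem size_add_le (x y : ℕ) : Nat.size (x + y) ≤ Nat.size x + Nat.size y + 1 := by
  rw [Nat.size_le]
  have hx := Nat.lt_size_self x
  have hy := Nat.lt_size_self y
  calc x + y < 2 ^ Nat.size x + 2 ^ Nat.size y := by omega
    _ ≤ 2 ^ (Nat.size x + Nat.size y) + 2 ^ (Nat.size x + Nat.size y) := by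
        gcongr <;> omega
    _ = _ := by ring

theorem size_mul_le (x y : ℕ) : Nat.size (x * y) ≤ Nat.size x + Nat.size y := by
  rw [Nat.size_le, pow_add]
  exact Nat.mul_lt_mul'' (Nat.lt_size_self x) (Nat.lt_size_self y)

theorem Op.size_apply_le (o : Op) (x y : ℕ) :
    Nat.size (o.apply x y) ≤ Nat.size x + Nat.size y + 1 := by
  cases o
  · exact size_add_le x y
  · exact (Nat.size_le_size (Nat.sub_le x y)).trans (by omega)
  · exact (size_mul_le x y).trans (by omega)
  · exact (Nat.size_le_size (Nat.div_le_self x y)).trans (by omega)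

/-! ### Bounded execution -/

/-- `p` started in `σ` halts in `τ` with cost at most `T`. -/
def ExecLE (p : Prog) (σ : State) (T : ℕ) (τ : State) : Prop := ∃ t ≤ T, Exec p σ t τ

theorem ExecLE.mono {p : Prog} {σ τ : State} {T T' : ℕ} (h : ExecLE p σ T τ) (hT : T ≤ T') :
    ExecLE p σ T' τ :=
  let ⟨t, ht, he⟩ := h
  ⟨t, ht.trans hT, he⟩

theorem ExecLE.seq {p q : Prog} {σ τ υ : State} {s t : ℕ} (hp : ExecLE p σ s τ)
    (hq : ExecLE q τ t υ) : ExecLE (.seq p q) σ (s + t + 1) υ := by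
  obtain ⟨a, ha, hp⟩ := hp
  obtain ⟨b, hb, hq⟩ := hq
  exact ⟨a + b + 1, by omega, .seq hp hq⟩

theorem ExecLE.write (a : ℕ) (i e : Expr) (σ : State) :
    ExecLE (.write a i e) σ (i.cost σ + e.cost σ + 1) (σ.update a (i.eval σ) (e.eval σ)) :=
  ⟨_, le_rfl, .write a i e σ⟩

theorem State.update_of_ne (σ : State) {a b : ℕ} (h : b ≠ a) (i x : ℕ) :
    σ.update a i x b = σ b := by
  simp [State.update, h]

theorem State.update_self (σ : State) (a i x : ℕ) : σ.update a i x a i = x := by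
  simp [State.update]

theorem State.update_self_of_ne (σ : State) (a : ℕ) {i j : ℕ} (h : j ≠ i) (x : ℕ) :
    σ.update a i x a j = σ a j := by
  simp [State.update, h]

/-! ### Contexts -/

/-- A context for computations: values `c : γ` of the variables that are in scope, a relation `R`
saying that a state holds these values at a given placement, and a measure `S` of their size.
A placement uses only arrays below `bd`. -/
structure Ctx where
  γ : Type
  P : Type
  bd : P → ℕ
  R : P → γ → State → Prop
  S : γ → ℕ
  frame : ∀ p c σ τ, (∀ a < bd p, τ a = σ a) → R p c σ → R p c τ

/-- The context that consists of the input. -/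
abbrev Ctx.input {α : Type} (enc : α → List ℕ) : Ctx where
  γ := α
  P := Unit
  bd _ := 1
  R _ a σ := ∀ i, σ 0 i = (enc a).getD i 0
  S a := inputSize (enc a)
  frame _ _ σ τ h hR i := by rw [h 0 (by norm_num)]; exact hR i

/-- The extension of a context by a number. -/
abbrev Ctx.nat (C : Ctx) : Ctx where
  γ := C.γ × ℕ
  P := { x : C.P × ℕ // C.bd x.1 ≤ x.2 }
  bd x := x.1.2 + 1
  R x c σ := C.R x.1.1 c.1 σ ∧ σ x.1.2 0 = c.2
  S c := C.S c.1 + Nat.size c.2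
  frame p c σ τ h hR := by
    refine ⟨C.frame _ c.1 σ τ (fun a ha => h a ?_) hR.1, ?_⟩
    · have := p.2
      omega
    · rw [h _ (by omega)]
      exact hR.2

/-- The extension of a context by a list. -/
abbrev Ctx.list (C : Ctx) : Ctx where
  γ := C.γ × List ℕ
  P := { x : C.P × ℕ // C.bd x.1 ≤ x.2 }
  bd x := x.1.2 + 2
  R x c σ := C.R x.1.1 c.1 σ ∧ (∀ i < c.2.length, σ x.1.2 i = c.2.getD i 0) ∧
    σ (x.1.2 + 1) 0 = c.2.length
  S c := C.S c.1 + inputSize c.2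
  frame p c σ τ h hR := by
    refine ⟨C.frame _ _ σ τ (fun a ha => h a ?_) hR.1, fun i hi => ?_, ?_⟩
    · have := p.2
      omega
    · rw [h _ (by omega)]
      exact hR.2.1 i hi
    · rw [h _ (by omega)]
      exact hR.2.2

/-- `f` is computed by a polynomial-time program: for each placement of the variables and each
`k` above it, some program leaves the arrays below `k` unchanged and puts the value into array `k`.
-/
def Comp (C : Ctx) (f : C.γ → ℕ) : Prop :=
  PolyBdd C.S (fun c => Nat.size (f c)) ∧
    ∀ (p : C.P) (k : ℕ), C.bd p ≤ k → ∃ (prog : Prog) (T : C.γ → ℕ), PolyBdd C.S T ∧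
      ∀ c σ, C.R p c σ → ∃ τ, ExecLE prog σ (T c) τ ∧ (∀ a < k, τ a = σ a) ∧ τ k 0 = f c

/-- A morphism of contexts, which forgets variables. -/
structure Weak (C' C : Ctx) where
  π : C'.γ → C.γ
  φ : C'.P → C.P
  bd_le : ∀ p, C.bd (φ p) ≤ C'.bd p
  rel : ∀ p c σ, C'.R p c σ → C.R (φ p) (π c) σ
  size_le : ∀ c, C.S (π c) ≤ C'.S c

namespace Weak

def refl (C : Ctx) : Weak C C := ⟨id, id, fun _ => le_rfl, fun _ _ _ h => h, fun _ => le_rfl⟩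

def nat (C : Ctx) : Weak C.nat C where
  π := Prod.fst
  φ p := p.1.1
  bd_le p := p.2.trans (Nat.le_succ _)
  rel _ _ _ h := h.1
  size_le _ := Nat.le_add_right _ _

def list (C : Ctx) : Weak C.list C where
  π := Prod.fst
  φ p := p.1.1
  bd_le p := p.2.trans (Nat.le_add_right _ 2)
  rel _ _ _ h := h.1
  size_le _ := Nat.le_add_right _ _

def trans {C₁ C₂ C₃ : Ctx} (f : Weak C₁ C₂) (g : Weak C₂ C₃) : Weak C₁ C₃ where
  π := g.π ∘ f.π
  φ := g.φ ∘ f.φ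
  bd_le _ := (g.bd_le _).trans (f.bd_le _)
  rel _ _ _ h := g.rel _ _ _ (f.rel _ _ _ h)
  size_le _ := (g.size_le _).trans (f.size_le _)

/-- Weakening under a binder: the last variable stays in its array, which remains admissible because
forgetting variables only lowers the bound on the arrays in use. -/
def mapNat {C' C : Ctx} (f : Weak C' C) : Weak C'.nat C.nat where
  π c := (f.π c.1, c.2)
  φ p := ⟨(f.φ p.1.1, p.1.2), (f.bd_le _).trans p.2⟩
  bd_le _ := le_rfl
  rel _ _ _ h := ⟨f.rel _ _ _ h.1, h.2⟩
  size_le c := Nat.add_le_add_right (f.size_le c.1) _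

end Weak

/-! ### Closure of polynomial-time functions under arithmetic, branching, substitution and reading.
-/

namespace Comp

variable {C C' : Ctx}

theorem weaken {f : C.γ → ℕ} (hf : Comp C f) (w : Weak C' C) : Comp C' fun c => f (w.π c) := by
  refine ⟨PolyBdd.comp (π := w.π) hf.1 (PolyBdd.self.mono w.size_le), fun p k hk => ?_⟩
  obtain ⟨prog, T, hT, h⟩ := hf.2 (w.φ p) k ((w.bd_le p).trans hk)
  exact ⟨prog, fun c => T (w.π c), PolyBdd.comp (π := w.π) hT (PolyBdd.self.mono w.size_le),
    fun c σ hR => h _ σ (w.rel _ _ _ hR)⟩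

theorem weakenNat {f : C.γ → ℕ} (hf : Comp C f) : Comp C.nat fun c => f c.1 :=
  hf.weaken (Weak.nat C)

theorem weakenList {f : C.γ → ℕ} (hf : Comp C f) : Comp C.list fun c => f c.1 :=
  hf.weaken (Weak.list C)

theorem congr {f g : C.γ → ℕ} (hf : Comp C f) (h : ∀ c, f c = g c) : Comp C g := by
  rwa [show g = f from funext fun c => (h c).symm]

theorem const (a : ℕ) : Comp C fun _ => a := by
  refine ⟨PolyBdd.const _, fun p k _ => ⟨.write k (.const 0) (.const a), fun _ => 20 + Nat.size a,
    PolyBdd.const _, fun c σ _ =>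
      ⟨_, (ExecLE.write k (.const 0) (.const a) σ).mono ?_, fun b hb => ?_, ?_⟩⟩⟩
  · simp only [Expr.cost, Nat.size_zero]
    omega
  · exact State.update_of_ne σ (by omega) _ _
  · simp [Expr.eval, State.update]

/-- Arrays are used like a stack: the second operand is computed into array `k + 1`, so its frame
condition protects the first operand in array `k`. -/
theorem op (o : Op) {f g : C.γ → ℕ} (hf : Comp C f) (hg : Comp C g) :
    Comp C fun c => o.apply (f c) (g c) := by
  refine ⟨((hf.1.add hg.1).add (PolyBdd.const 1)).mono fun c => o.size_apply_le _ _,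
    fun p k hk => ?_⟩
  obtain ⟨p₁, T₁, hT₁, h₁⟩ := hf.2 p k hk
  obtain ⟨p₂, T₂, hT₂, h₂⟩ := hg.2 p (k + 1) (by omega)
  refine ⟨.seq p₁ (.seq p₂ (.write k (.const 0)
      (.op o (.read k (.const 0)) (.read (k + 1) (.const 0))))),
    fun c => T₁ c + (T₂ c + (10 + 2 * (Nat.size (f c) + Nat.size (g c))) + 1) + 1,
    (hT₁.add ((hT₂.add ((PolyBdd.const 10).add ((PolyBdd.const 2).mul (hf.1.add hg.1)))).add
      (PolyBdd.const 1))).add (PolyBdd.const 1), fun c σ hR => ?_⟩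
  obtain ⟨σ₁, e₁, a₁, r₁⟩ := h₁ c σ hR
  obtain ⟨σ₂, e₂, a₂, r₂⟩ := h₂ c σ₁ (C.frame p c σ σ₁ (fun a ha => a₁ a (by omega)) hR)
  have r₁' : σ₂ k 0 = f c := by rw [a₂ k (by omega), r₁]
  refine ⟨_, e₁.seq (e₂.seq ((ExecLE.write _ _ _ _).mono ?_)), fun a ha => ?_, ?_⟩
  · simp only [Expr.cost, Expr.eval, r₁', r₂]
    have := o.size_apply_le (f c) (g c)
    have h0 : Nat.size 0 = 0 := by simp
    omega
  · rw [State.update_of_ne _ (by omega), a₂ a (by omega), a₁ a ha]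
  · simp only [Expr.eval, r₁', r₂, State.update_self]

theorem add {f g : C.γ → ℕ} (hf : Comp C f) (hg : Comp C g) : Comp C fun c => f c + g c :=
  op .plus hf hg

theorem sub {f g : C.γ → ℕ} (hf : Comp C f) (hg : Comp C g) : Comp C fun c => f c - g c :=
  op .minus hf hg

theorem mul {f g : C.γ → ℕ} (hf : Comp C f) (hg : Comp C g) : Comp C fun c => f c * g c :=
  op .times hf hg

theorem div {f g : C.γ → ℕ} (hf : Comp C f) (hg : Comp C g) : Comp C fun c => f c / g c :=
  op .quot hf hg

theorem mod {f g : C.γ → ℕ} (hf : Comp C f) (hg : Comp C g) : Comp C fun c => f c % g c :=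
  (hf.sub (hg.mul (hf.div hg))).congr fun c => by
    have := Nat.div_add_mod (f c) (g c)
    omega

theorem pow {f : C.γ → ℕ} (hf : Comp C f) (k : ℕ) : Comp C fun c => f c ^ k := by
  induction k with
  | zero => exact (const 1).congr fun c => by simp
  | succ k ih => exact (ih.mul hf).congr fun c => by rw [pow_succ]

/-- The last variable. -/
theorem var : Comp C.nat fun c => c.2 := by
  refine ⟨PolyBdd.self.mono fun c => Nat.le_add_left _ _, fun p k hk =>
    ⟨.write k (.const 0) (.read p.1.2 (.const 0)), fun c => 20 + Nat.size c.2,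
      (PolyBdd.const 20).add (PolyBdd.self.mono fun c => Nat.le_add_left _ _),
      fun c σ hR => ⟨_, (ExecLE.write _ _ _ σ).mono ?_, fun a ha => ?_, ?_⟩⟩⟩
  · simp only [Expr.cost, Expr.eval, hR.2, Nat.size_zero]
    omega
  · exact State.update_of_ne σ (by omega) _ _
  · simp only [Expr.eval, State.update_self, hR.2]

theorem length : Comp C.list fun c => c.2.length := by
  have hl : PolyBdd C.list.S fun c => Nat.size c.2.length := by
    refine PolyBdd.size (PolyBdd.self.mono fun c => ?_)
    have : c.2.length ≤ inputSize c.2 := by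
      unfold inputSize
      simp
    exact this.trans (Nat.le_add_left _ _)
  refine ⟨hl, fun p k hk =>
    ⟨.write k (.const 0) (.read (p.1.2 + 1) (.const 0)), fun c => 20 + Nat.size c.2.length,
      (PolyBdd.const 20).add hl,
      fun c σ hR => ⟨_, (ExecLE.write _ _ _ σ).mono ?_, fun a ha => ?_, ?_⟩⟩⟩
  · simp only [Expr.cost, Expr.eval, hR.2.2, Nat.size_zero]
    omega
  · exact State.update_of_ne σ (by omega) _ _
  · simp only [Expr.eval, State.update_self, hR.2.2]

theorem cond {b f g : C.γ → ℕ} (hb : Comp C b) (hf : Comp C f) (hg : Comp C g) :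
    Comp C fun c => if b c = 0 then g c else f c := by
  refine ⟨(hf.1.add hg.1).mono fun c => by
    dsimp only
    split_ifs <;> omega, fun p k hk => ?_⟩
  obtain ⟨p₀, T₀, hT₀, h₀⟩ := hb.2 p k hk
  obtain ⟨p₁, T₁, hT₁, h₁⟩ := hf.2 p k hk
  obtain ⟨p₂, T₂, hT₂, h₂⟩ := hg.2 p k hk
  refine ⟨.seq p₀ (.branch (.read k (.const 0)) p₁ p₂),
    fun c => T₀ c + (T₁ c + T₂ c + (10 + Nat.size (b c))) + 1,
    (hT₀.add ((hT₁.add hT₂).add ((PolyBdd.const 10).add hb.1))).add (PolyBdd.const 1),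
    fun c σ hR => ?_⟩
  obtain ⟨σ₀, e₀, a₀, r₀⟩ := h₀ c σ hR
  have hR' := C.frame p c σ σ₀ (fun a ha => a₀ a (by omega)) hR
  by_cases h : b c = 0
  · obtain ⟨σ₂, ⟨t, ht, e₂⟩, a₂, r₂⟩ := h₂ c σ₀ hR'
    refine ⟨σ₂, e₀.seq ⟨_, ?_, .branch_false (by simp [Expr.eval, r₀, h]) e₂⟩, fun a ha => ?_, ?_⟩
    · simp only [Expr.cost, Expr.eval, r₀, Nat.size_zero]
      omega
    · rw [a₂ a ha, a₀ a ha]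
    · simp [h, r₂]
  · obtain ⟨σ₂, ⟨t, ht, e₂⟩, a₂, r₂⟩ := h₁ c σ₀ hR'
    refine ⟨σ₂, e₀.seq ⟨_, ?_, .branch_true (by simp [Expr.eval, r₀, h]) e₂⟩, fun a ha => ?_, ?_⟩
    · simp only [Expr.cost, Expr.eval, r₀, Nat.size_zero]
      omega
    · rw [a₂ a ha, a₀ a ha]
    · simp [h, r₂]

/-- Evaluation of a function at a computed argument. -/
theorem subst {g : C.γ → ℕ} {f : C.nat.γ → ℕ} (hg : Comp C g) (hf : Comp C.nat f) :
    Comp C fun c => f (c, g c) := by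
  have hS : PolyBdd C.S fun c => C.nat.S (c, g c) := PolyBdd.self.add hg.1
  refine ⟨PolyBdd.comp (π := fun c => (c, g c)) hf.1 hS, fun p k hk => ?_⟩
  obtain ⟨p₁, T₁, hT₁, h₁⟩ := hg.2 p k hk
  obtain ⟨p₂, T₂, hT₂, h₂⟩ := hf.2 ⟨(p, k), hk⟩ (k + 1) le_rfl
  have hf1 := PolyBdd.comp (π := fun c => (c, g c)) hf.1 hS
  have hT2 := PolyBdd.comp (π := fun c => (c, g c)) hT₂ hS
  refine ⟨.seq p₁ (.seq p₂ (.write k (.const 0) (.read (k + 1) (.const 0)))),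
    fun c => T₁ c + (T₂ (c, g c) + (20 + Nat.size (f (c, g c))) + 1) + 1,
    (hT₁.add ((hT2.add ((PolyBdd.const 20).add hf1)).add (PolyBdd.const 1))).add
      (PolyBdd.const 1), fun c σ hR => ?_⟩
  obtain ⟨σ₁, e₁, a₁, r₁⟩ := h₁ c σ hR
  obtain ⟨σ₂, e₂, a₂, r₂⟩ := h₂ (c, g c) σ₁
    ⟨C.frame p c σ σ₁ (fun a ha => a₁ a (lt_of_lt_of_le ha hk)) hR, r₁⟩
  refine ⟨_, e₁.seq (e₂.seq ((ExecLE.write _ _ _ _).mono ?_)), fun a ha => ?_, ?_⟩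
  · simp only [Expr.cost, Expr.eval, r₂, Nat.size_zero]
    omega
  · rw [State.update_of_ne _ (by omega), a₂ a (by omega), a₁ a ha]
  · simp only [Expr.eval, r₂, State.update_self]

theorem inputSize_getD_le (l : List ℕ) (i : ℕ) : Nat.size (l.getD i 0) ≤ inputSize l := by
  by_cases h : i < l.length
  · have : 1 + Nat.size l[i] ≤ inputSize l :=
      List.single_le_sum (by simp) _ (List.mem_map.2 ⟨_, List.getElem_mem h, rfl⟩)
    rw [List.getD_eq_getElem _ _ h]
    omega
  · rw [List.getD_eq_default _ _ (by omega)]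
    simp

/-- Reading a list of the context. -/
theorem get (v : Weak C' C.list) {i : C'.γ → ℕ} (hi : Comp C' i) :
    Comp C' fun c => (v.π c).2.getD (i c) 0 := by
  have hl : PolyBdd C'.S fun c => Nat.size ((v.π c).2.getD (i c) 0) :=
    PolyBdd.self.mono fun c => (inputSize_getD_le _ _).trans
      ((Nat.le_add_left _ _).trans (v.size_le c))
  -- Nothing is known about the registers beyond the end of the list, so the default `0` has to be
  -- produced by an explicit length test.
  have hlen := ((length (C := C)).weaken v).sub hi
  refine ⟨hl, fun p k hk => ?_⟩
  obtain ⟨p₁, T₁, hT₁, h₁⟩ := hi.2 p k hk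
  obtain ⟨p₂, T₂, hT₂, h₂⟩ := hlen.2 p (k + 1) (by omega)
  refine ⟨.seq p₁ (.seq p₂ (.branch (.read (k + 1) (.const 0))
      (.write k (.const 0) (.read (v.φ p).1.2 (.read k (.const 0))))
      (.write k (.const 0) (.const 0)))),
    fun c => T₁ c + (T₂ c + (20 + (Nat.size ((v.π c).2.length - i c) + Nat.size (i c) +
      Nat.size ((v.π c).2.getD (i c) 0))) + 1) + 1,
    (hT₁.add ((hT₂.add ((PolyBdd.const 20).add ((hlen.1.add hi.1).add hl))).add
      (PolyBdd.const 1))).add (PolyBdd.const 1), fun c σ hR => ?_⟩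
  obtain ⟨σ₁, e₁, a₁, r₁⟩ := h₁ c σ hR
  have hR₁ := C'.frame p c σ σ₁ (fun a ha => a₁ a (lt_of_lt_of_le ha hk)) hR
  obtain ⟨σ₂, e₂, a₂, r₂⟩ := h₂ c σ₁ hR₁
  have hR₂ := C'.frame p c σ₁ σ₂ (fun a ha => a₂ a (by omega)) hR₁
  have r₁' : σ₂ k 0 = i c := by rw [a₂ k (by omega), r₁]
  have hpk : (v.φ p).1.2 + 2 ≤ k := (v.bd_le p).trans hk
  by_cases h : (v.π c).2.length - i c = 0
  · refine ⟨_, e₁.seq (e₂.seq ⟨_, ?_, .branch_false (by simp [Expr.eval, r₂, h])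
      (.write k (.const 0) (.const 0) σ₂)⟩), fun a ha => ?_, ?_⟩
    · simp only [Expr.cost, Expr.eval, r₂, Nat.size_zero]
      omega
    · rw [State.update_of_ne _ (by omega), a₂ a (by omega), a₁ a ha]
    · dsimp only
      rw [List.getD_eq_default _ _ (by omega)]
      simp only [Expr.eval, State.update_self]
  · have hget := (v.rel _ _ _ hR₂).2.1 (i c) (by omega)
    refine ⟨_, e₁.seq (e₂.seq ⟨_, ?_, .branch_true (by simp [Expr.eval, r₂, h])
      (.write k (.const 0) (.read (v.φ p).1.2 (.read k (.const 0))) σ₂)⟩), fun a ha => ?_, ?_⟩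
    · simp only [Expr.cost, Expr.eval, r₂, r₁', hget, Nat.size_zero]
      omega
    · rw [State.update_of_ne _ (by omega), a₂ a (by omega), a₁ a ha]
    · simp only [Expr.eval, r₁', hget, State.update_self]

/-- Reading the input. -/
theorem input {α : Type} (enc : α → List ℕ) :
    Comp (Ctx.input enc).nat fun c => (enc c.1).getD c.2 0 := by
  have hl : PolyBdd (Ctx.input enc).nat.S fun c => Nat.size ((enc c.1).getD c.2 0) :=
    PolyBdd.self.mono fun c => (inputSize_getD_le _ _).trans (Nat.le_add_right _ _)
  have hi : PolyBdd (Ctx.input enc).nat.S fun c => Nat.size c.2 :=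
    PolyBdd.self.mono fun c => Nat.le_add_left _ _
  refine ⟨hl, fun p k hk =>
    ⟨.write k (.const 0) (.read 0 (.read p.1.2 (.const 0))),
      fun c => 20 + (Nat.size c.2 + Nat.size ((enc c.1).getD c.2 0)),
      (PolyBdd.const 20).add (hi.add hl),
      fun c σ hR => ⟨_, (ExecLE.write _ _ _ σ).mono ?_, fun a ha => ?_, ?_⟩⟩⟩
  · simp only [Expr.cost, Expr.eval, hR.2, hR.1 _, Nat.size_zero]
    omega
  · exact State.update_of_ne σ (by omega) _ _
  · simp only [Expr.eval, State.update_self, hR.2, hR.1 _]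

end Comp

end RAM

namespace RAM

/-! ### Course-of-values recursion -/

/-- The list of the first `N` values of the sequence whose next term is `step` of the list of the
preceding ones. -/
def memo {γ : Type} (step : γ × List ℕ → ℕ) (c : γ) : ℕ → List ℕ
  | 0 => []
  | N + 1 => memo step c N ++ [step (c, memo step c N)]

section memo

variable {γ : Type} (step : γ × List ℕ → ℕ) (c : γ)

@[simp]
theorem length_memo (N : ℕ) : (memo step c N).length = N := by
  induction N with
  | zero => rfl
  | succ N ih => simp [memo, ih]

theorem memo_getD_succ {i N : ℕ} (h : i < N) :
    (memo step c (N + 1)).getD i 0 = (memo step c N).getD i 0 := by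
  rw [memo, List.getD_append]
  simpa using h

theorem memo_getD_self (N : ℕ) : (memo step c (N + 1)).getD N 0 = step (c, memo step c N) := by
  rw [memo, List.getD_append_right _ _ _ _ (by simp)]
  simp

theorem memo_getD {i N : ℕ} (h : i < N) :
    (memo step c N).getD i 0 = step (c, memo step c i) := by
  induction N with
  | zero => omega
  | succ N ih =>
    rcases Nat.lt_succ_iff_lt_or_eq.1 h with h | rfl
    · rw [memo_getD_succ step c h, ih h]
    · exact memo_getD_self step c i

theorem inputSize_append (l l' : List ℕ) : inputSize (l ++ l') = inputSize l + inputSize l' := by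
  simp [inputSize]

theorem inputSize_memo_mono {i N : ℕ} (h : i ≤ N) :
    inputSize (memo step c i) ≤ inputSize (memo step c N) := by
  induction h with
  | refl => rfl
  | step _ ih =>
    rw [memo, inputSize_append]
    exact ih.trans (Nat.le_add_right _ _)

theorem inputSize_le_of_forall (l : List ℕ) (B : ℕ)
    (h : ∀ i < l.length, Nat.size (l.getD i 0) ≤ B) :
    inputSize l ≤ l.length * (1 + B) := by
  have := List.sum_le_card_nsmul (l.map fun k => 1 + Nat.size k) (1 + B) (by
    intro x hx
    obtain ⟨y, hy, rfl⟩ := List.mem_map.1 hx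
    obtain ⟨i, hi, rfl⟩ := List.mem_iff_getElem.1 hy
    have := h i hi
    rw [List.getD_eq_getElem _ _ hi] at this
    omega)
  simpa [inputSize] using this

end memo

/-- The program that builds the list `memo step c (N c)`. -/
theorem exists_memo_prog {C : Ctx} {N : C.γ → ℕ} {step : C.list.γ → ℕ} (hN : Comp C N)
    (hNb : PolyBdd C.S N) (hstep : Comp C.list step)
    (hS : PolyBdd C.S fun c => inputSize (memo step c (N c))) (p : C.P) (k : ℕ) (hk : C.bd p ≤ k) :
    ∃ (prog : Prog) (T : C.γ → ℕ), PolyBdd C.S T ∧ ∀ c σ, C.R p c σ → ∃ τ,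
      ExecLE prog σ (T c) τ ∧ (∀ a < k, τ a = σ a) ∧
        C.list.R ⟨(p, k), hk⟩ (c, memo step c (N c)) τ := by
  -- Layout: `k` holds the list and `k + 1` its length, as `Ctx.list` prescribes; `k + 2` holds the
  -- final length, and the step works from `k + 3` on.
  obtain ⟨p₁, T₁, hT₁, h₁⟩ := hN.2 p (k + 2) (by omega)
  obtain ⟨p₂, T₂, hT₂, h₂⟩ := hstep.2 ⟨(p, k), hk⟩ (k + 3) (by simp)
  -- Every list that occurs in the loop is a prefix of the final one, so a single time bound `B`
  -- serves all rounds.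
  obtain ⟨B, hB, hB'⟩ := hT₂.exists_unif (g := fun c => C.S c + inputSize (memo step c (N c)))
    (PolyBdd.self.add hS)
  set body : Prog := .seq p₂ (.seq (.write k (.read (k + 1) (.const 0)) (.read (k + 3) (.const 0)))
    (.write (k + 1) (.const 0) (.op .plus (.read (k + 1) (.const 0)) (.const 1)))) with hbody
  set test : Expr := .op .minus (.read (k + 2) (.const 0)) (.read (k + 1) (.const 0)) with htest
  set D : C.γ → ℕ := fun c => 100 + (10 * N c + (inputSize (memo step c (N c)) + B c)) with hD
  have hDb : PolyBdd C.S D :=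
    (PolyBdd.const 100).add (((PolyBdd.const 10).mul hNb).add (hS.add hB))
  -- Induction on the number `d` of remaining rounds; a round costs at most `2 * D c`, and the final
  -- failing test at most `D c`.
  have key : ∀ c d i σ, i + d = N c → C.list.R ⟨(p, k), hk⟩ (c, memo step c i) σ →
      σ (k + 2) 0 = N c → ∃ τ, ExecLE (.loop test body) σ (d * (2 * D c) + D c) τ ∧
        (∀ a < k, τ a = σ a) ∧ C.list.R ⟨(p, k), hk⟩ (c, memo step c (N c)) τ := by
    intro c d
    induction d with
    | zero =>
      intro i σ hi hR hN'
      obtain rfl : i = N c := by omega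
      have hl : σ (k + 1) 0 = N c := by simpa using hR.2.2
      refine ⟨σ, ⟨_, ?_, .loop_false (by simp [htest, Expr.eval, Op.apply, hN', hl])⟩,
        fun _ _ => rfl, hR⟩
      have := size_le_self (N c)
      simp only [htest, Expr.cost, Expr.eval, Op.apply, hN', hl, Nat.size_zero, Nat.sub_self, hD]
      omega
    | succ d ih =>
      intro i σ hi hR hN'
      have hl : σ (k + 1) 0 = i := by simpa using hR.2.2
      obtain ⟨σ₂, e₂, a₂, r₂⟩ := h₂ (c, memo step c i) σ hR
      have hl₂ : σ₂ (k + 1) 0 = i := by rw [a₂ _ (by omega), hl]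
      set σ₃ := σ₂.update k i (step (c, memo step c i)) with hσ₃
      set σ₄ := σ₃.update (k + 1) 0 (i + 1) with hσ₄
      have hl₃ : σ₃ (k + 1) 0 = i := by rw [hσ₃, State.update_of_ne _ (by omega), hl₂]
      have hmem := inputSize_memo_mono step c (show i ≤ N c by omega)
      have hmem1 := inputSize_memo_mono step c (show i + 1 ≤ N c by omega)
      have hsz : Nat.size (step (c, memo step c i)) ≤ inputSize (memo step c (N c)) := by
        rw [← memo_getD_self step c i]
        exact (Comp.inputSize_getD_le _ _).trans hmem1
      have hT : T₂ (c, memo step c i) ≤ B c := hB' _ _ (by dsimp only; omega)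
      have hs1 := size_le_self i
      have hs2 := size_le_self (N c)
      have hs3 := size_le_self (i + 1)
      have hs4 := size_le_self (N c - i)
      have hbd : ExecLE body σ (D c + 8 * N c) σ₄ := by
        have w₁ := ExecLE.write k (.read (k + 1) (.const 0)) (.read (k + 3) (.const 0)) σ₂
        simp only [Expr.cost, Expr.eval, r₂, hl₂, Nat.size_zero, ← hσ₃] at w₁
        have w₂ := ExecLE.write (k + 1) (.const 0)
          (.op .plus (.read (k + 1) (.const 0)) (.const 1)) σ₃
        simp only [Expr.cost, Expr.eval, hl₃, Op.apply, Nat.size_zero, Nat.size_one, ← hσ₄] at w₂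
        refine (e₂.seq (w₁.seq w₂)).mono ?_
        simp only [hD]
        omega
      have hRC : C.R p c σ₄ := by
        refine C.frame p c σ σ₄ (fun a ha => ?_) hR.1
        rw [hσ₄, State.update_of_ne _ (by omega), hσ₃, State.update_of_ne _ (by omega),
          a₂ a (by omega)]
      have hR₄ : C.list.R ⟨(p, k), hk⟩ (c, memo step c (i + 1)) σ₄ := by
        refine ⟨hRC, fun j hj => ?_, ?_⟩
        · rw [length_memo] at hj
          dsimp only
          rw [hσ₄, State.update_of_ne _ (by omega)]
          rcases Nat.lt_succ_iff_lt_or_eq.1 hj with hj | rfl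
          · rw [memo_getD_succ step c hj, hσ₃, State.update_self_of_ne _ _ (by omega),
              a₂ k (by omega)]
            exact hR.2.1 j (by simpa using hj)
          · rw [memo_getD_self, hσ₃, State.update_self]
        · simp [hσ₄, State.update_self]
      have hN₄ : σ₄ (k + 2) 0 = N c := by
        rw [hσ₄, State.update_of_ne _ (by omega), hσ₃, State.update_of_ne _ (by omega),
          a₂ _ (by omega), hN']
      obtain ⟨τ, ⟨t, ht, e⟩, a, r⟩ := ih (i + 1) σ₄ (by omega) hR₄ hN₄
      obtain ⟨s, hs, eb⟩ := hbd
      refine ⟨τ, ⟨_, ?_, .loop_true ?_ eb e⟩, fun b hb => ?_, r⟩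
      · simp only [htest, Expr.cost, Expr.eval, Op.apply, hN', hl, Nat.size_zero]
        have h1 : (d + 1) * (2 * D c) = d * (2 * D c) + 2 * D c := by ring
        have h2 : 100 + 10 * N c ≤ D c := by simp only [hD]; omega
        omega
      · simp only [htest, Expr.eval, Op.apply, hN', hl]
        omega
      · rw [a b hb, hσ₄, State.update_of_ne _ (by omega), hσ₃, State.update_of_ne _ (by omega),
          a₂ b (by omega)]
  refine ⟨.seq p₁ (.seq (.write (k + 1) (.const 0) (.const 0)) (.loop test body)),
    fun c => T₁ c + (20 + (N c * (2 * D c) + D c) + 1) + 1,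
    (hT₁.add (((PolyBdd.const 20).add ((hNb.mul ((PolyBdd.const 2).mul hDb)).add hDb)).add
      (PolyBdd.const 1))).add (PolyBdd.const 1), fun c σ hR => ?_⟩
  obtain ⟨σ₁, e₁, a₁, r₁⟩ := h₁ c σ hR
  set σ₂ := σ₁.update (k + 1) 0 0 with hσ₂
  obtain ⟨τ, e, a, r⟩ := key c (N c) 0 σ₂ (by omega)
    ⟨C.frame p c σ σ₂ (fun a ha => by
      rw [hσ₂, State.update_of_ne _ (by omega), a₁ a (by omega)]) hR,
      fun j hj => by simp [memo] at hj, by simp [memo, hσ₂, State.update_self]⟩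
    (by rw [hσ₂, State.update_of_ne _ (by omega), r₁])
  refine ⟨τ, e₁.seq (ExecLE.seq (τ := σ₂) ?_ e), fun b hb => ?_, r⟩
  · refine (ExecLE.write (k + 1) (.const 0) (.const 0) σ₁).mono ?_
    simp only [Expr.cost, Nat.size_zero]
    omega
  · rw [a b hb, hσ₂, State.update_of_ne _ (by omega), a₁ b (by omega)]

/-- A function whose values are listed by a polynomial-time computable function is polynomial-time
computable. -/
theorem polyTimeComputable_of_comp {α : Type} {enc out : α → List ℕ}
    (hN : Comp (Ctx.input enc) fun a => (out a).length)
    (hNb : PolyBdd (Ctx.input enc).S fun a => (out a).length)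
    (hout : Comp (Ctx.input enc).nat fun c => (out c.1).getD c.2 0)
    (hS : PolyBdd (Ctx.input enc).S fun a => inputSize (out a)) :
    PolyTimeComputable enc out := by
  -- This step function looks only at the length of its list, so the recursion merely enumerates the
  -- output.
  have hmemo : ∀ a, ∀ N ≤ (out a).length,
      memo (fun c : α × List ℕ => (out c.1).getD c.2.length 0) a N = (out a).take N := by
    intro a N hN
    refine List.ext_getElem (by simp [hN]) fun i h₁ h₂ => ?_
    rw [length_memo] at h₁
    rw [← List.getD_eq_getElem _ 0, memo_getD _ _ h₁]
    dsimp only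
    rw [length_memo, List.getD_eq_getElem _ _ (by omega), List.getElem_take]
  have hmemo' := fun a => (hmemo a _ le_rfl).trans List.take_length
  have hstep : Comp (Ctx.input enc).list fun c => (out c.1).getD c.2.length 0 :=
    Comp.subst Comp.length (hout.weaken (Weak.list (Ctx.input enc)).mapNat)
  -- The input context occupies array `0` alone, so the list can be built directly in the output
  -- array `1`.
  obtain ⟨prog, T, ⟨q, hq⟩, h⟩ := exists_memo_prog hN hNb hstep
    (hS.mono fun a => by rw [hmemo' a]) () 1 le_rfl
  refine ⟨prog, q, fun a => ?_⟩
  obtain ⟨τ, ⟨t, ht, e⟩, -, r⟩ := h a (init (enc a)) fun i => by simp [init]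
  refine ⟨t, τ, e, ht.trans (hq a), fun i hi => ?_⟩
  have := r.2.1 i (by simpa using hi)
  rw [this, hmemo' a, List.getD_eq_getElem]

/-! ### Loops: tables, iteration, sums and products. -/

namespace Comp

variable {C : Ctx}

/-- A local definition of a whole table: it is built once and is then in scope as a list variable.
The value of `N`, not just its bit length, must be polynomial, because it counts rounds. -/
theorem letMemo {N : C.γ → ℕ} {step f : C.list.γ → ℕ} (hN : Comp C N) (hNb : PolyBdd C.S N)
    (hstep : Comp C.list step) (hS : PolyBdd C.S fun c => inputSize (memo step c (N c)))
    (hf : Comp C.list f) : Comp C fun c => f (c, memo step c (N c)) := by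
  have hS' : PolyBdd C.S fun c => C.list.S (c, memo step c (N c)) := PolyBdd.self.add hS
  have hf1 := PolyBdd.comp (π := fun c => (c, memo step c (N c))) hf.1 hS'
  refine ⟨hf1, fun p k hk => ?_⟩
  obtain ⟨p₁, T₁, hT₁, h₁⟩ := exists_memo_prog hN hNb hstep hS p k hk
  obtain ⟨p₂, T₂, hT₂, h₂⟩ := hf.2 ⟨(p, k), hk⟩ (k + 2) le_rfl
  have hT2 := PolyBdd.comp (π := fun c => (c, memo step c (N c))) hT₂ hS'
  refine ⟨.seq p₁ (.seq p₂ (.write k (.const 0) (.read (k + 2) (.const 0)))),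
    fun c => T₁ c + (T₂ (c, memo step c (N c)) + (20 + Nat.size (f (c, memo step c (N c)))) + 1)
      + 1,
    (hT₁.add ((hT2.add ((PolyBdd.const 20).add hf1)).add (PolyBdd.const 1))).add
      (PolyBdd.const 1), fun c σ hR => ?_⟩
  obtain ⟨σ₁, e₁, a₁, r₁⟩ := h₁ c σ hR
  obtain ⟨σ₂, e₂, a₂, r₂⟩ := h₂ _ σ₁ r₁
  refine ⟨_, e₁.seq (e₂.seq ((ExecLE.write _ _ _ _).mono ?_)), fun a ha => ?_, ?_⟩
  · simp only [Expr.cost, Expr.eval, r₂, Nat.size_zero]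
    omega
  · rw [State.update_of_ne _ (by omega), a₂ a (by omega), a₁ a ha]
  · simp only [Expr.eval, r₂, State.update_self]

/-- Iteration. -/
theorem iter {N x : C.γ → ℕ} {F : C.γ → ℕ → ℕ → ℕ} (hN : Comp C N) (hNb : PolyBdd C.S N)
    (hx : Comp C x) (hF : Comp C.nat.nat fun c => F c.1.1 c.1.2 c.2) {B : C.γ → ℕ}
    (hB : PolyBdd C.S B)
    (h : ∀ c, ∀ t ≤ N c, Nat.size (Nat.rec (x c) (F c) t : ℕ) ≤ B c) :
    Comp C fun c => (Nat.rec (x c) (F c) (N c) : ℕ) := by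
  -- Iteration is course-of-values recursion in which the last entry is the loop state and the
  -- length of the list is the counter.
  set step : C.list.γ → ℕ := fun c => if c.2.length = 0 then x c.1 else
    F c.1 (c.2.length - 1) (c.2.getD (c.2.length - 1) 0) with hstep
  have hlast : Comp C.list fun c => c.2.getD (c.2.length - 1) 0 :=
    get (Weak.refl _) (length.sub (const 1))
  have hs : Comp C.list step := by
    refine cond length ?_ hx.weakenList
    have h1 : Comp C.list.nat fun c => F c.1.1 c.2 (c.1.2.getD (c.1.2.length - 1) 0) :=
      subst (C := C.list.nat) (f := fun c : C.list.nat.nat.γ => F c.1.1.1 c.1.2 c.2) hlast.weakenNat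
        (hF.weaken (Weak.list C).mapNat.mapNat)
    exact subst (C := C.list)
      (f := fun c : C.list.nat.γ => F c.1.1 c.2 (c.1.2.getD (c.1.2.length - 1) 0))
      (length.sub (const 1)) h1
  have hval : ∀ c i N, i < N → (memo step c N).getD i 0 = Nat.rec (x c) (F c) i := by
    intro c i N hi
    rw [memo_getD _ _ hi]
    induction i generalizing N with
    | zero => simp [hstep, memo]
    | succ i ih =>
      have hlen := length_memo step c (i + 1)
      have : step (c, memo step c (i + 1)) =
          F c i ((memo step c (i + 1)).getD i 0) := by
        conv_lhs => rw [hstep]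
        simp only [← hstep, hlen, Nat.add_sub_cancel, Nat.succ_ne_zero, if_false]
      rw [this, memo_getD _ _ (Nat.lt_succ_self i), ih (i + 1) (by omega)]
  -- Entry `i` is the state after `i` rounds, so `N c` rounds need `N c + 1` entries.
  have := letMemo (N := fun c => N c + 1) (hN.add (const 1)) (hNb.add (PolyBdd.const 1)) hs
    (((hNb.add (PolyBdd.const 1)).mul ((PolyBdd.const 1).add hB)).mono fun c => ?_) hlast
  · exact this.congr fun c => by
      dsimp only
      rw [length_memo, Nat.add_sub_cancel, hval _ _ _ (Nat.lt_succ_self _)]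
  · refine (inputSize_le_of_forall _ (B c) fun i hi => ?_).trans_eq (by rw [length_memo])
    rw [length_memo] at hi
    rw [hval _ _ _ hi]
    exact h c i (by omega)

/-- A uniform bound for a function with a loop variable. -/
theorem exists_size_bound {f : C.γ → ℕ → ℕ} (hf : Comp C.nat fun c => f c.1 c.2)
    {N : C.γ → ℕ} (hNb : PolyBdd C.S N) :
    ∃ B, PolyBdd C.S B ∧ ∀ c, ∀ i < N c, Nat.size (f c i) ≤ B c := by
  obtain ⟨B, hB, h⟩ := hf.1.exists_unif (g := fun c => C.S c + N c) (PolyBdd.self.add hNb)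
  exact ⟨B, hB, fun c i hi => h c (c, i) <|
    Nat.add_le_add_left ((size_le_self i).trans hi.le) _⟩

theorem sum {N : C.γ → ℕ} {f : C.γ → ℕ → ℕ} (hN : Comp C N) (hNb : PolyBdd C.S N)
    (hf : Comp C.nat fun c => f c.1 c.2) : Comp C fun c => ∑ i ∈ Finset.range (N c), f c i := by
  obtain ⟨B, hB, h⟩ := hf.exists_size_bound hNb
  have hrec : ∀ c t, (Nat.rec 0 (fun i x => x + f c i) t : ℕ) = ∑ i ∈ Finset.range t, f c i := by
    intro c t
    induction t with
    | zero => rfl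
    | succ t ih => rw [Finset.sum_range_succ, ← ih]
  refine (iter (F := fun c i x => x + f c i) hN hNb (const 0) (var.add hf.weakenNat)
    (hNb.mul (hB.add (PolyBdd.const 1))) fun c t ht => ?_).congr fun c => hrec c _
  rw [hrec]
  refine le_trans ?_ (Nat.mul_le_mul_right _ ht)
  have ht' := fun i hi => h c i (lt_of_lt_of_le hi ht)
  clear ht
  induction t with
  | zero => simp
  | succ t ih =>
    rw [Finset.sum_range_succ, add_mul, one_mul]
    have := ih fun i hi => ht' i (by omega)
    have := ht' t (by omega)
    exact (size_add_le _ _).trans (by omega)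

/-- Bit lengths add up under multiplication, so a product of polynomially many factors keeps
polynomial bit length. This makes a common denominator affordable. -/
theorem prod {N : C.γ → ℕ} {f : C.γ → ℕ → ℕ} (hN : Comp C N) (hNb : PolyBdd C.S N)
    (hf : Comp C.nat fun c => f c.1 c.2) : Comp C fun c => ∏ i ∈ Finset.range (N c), f c i := by
  obtain ⟨B, hB, h⟩ := hf.exists_size_bound hNb
  have hrec : ∀ c t, (Nat.rec 1 (fun i x => x * f c i) t : ℕ) = ∏ i ∈ Finset.range t, f c i := by
    intro c t
    induction t with
    | zero => rfl
    | succ t ih => rw [Finset.prod_range_succ, ← ih]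
  refine (iter (F := fun c i x => x * f c i) hN hNb (const 1) (var.mul hf.weakenNat)
    ((hNb.mul hB).add (PolyBdd.const 1)) fun c t ht => ?_).congr fun c => hrec c _
  rw [hrec]
  refine le_trans ?_ (Nat.add_le_add_right (Nat.mul_le_mul_right _ ht) _)
  have ht' := fun i hi => h c i (lt_of_lt_of_le hi ht)
  clear ht
  induction t with
  | zero => simp
  | succ t ih =>
    rw [Finset.prod_range_succ, add_mul, one_mul]
    have := ih fun i hi => ht' i (by omega)
    have := ht' t (by omega)
    exact (size_mul_le _ _).trans (by omega)

end Comp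

/-! ### Polynomial-time decidable predicates. -/

/-- The predicate `P` is decided in polynomial time. -/
def Dec (C : Ctx) (P : C.γ → Prop) : Prop := ∃ d : C.γ → ℕ, Comp C d ∧ ∀ c, d c ≠ 0 ↔ P c

namespace Dec

variable {C : Ctx} {P Q : C.γ → Prop} {f g : C.γ → ℕ}

theorem congr (hP : Dec C P) (h : ∀ c, P c ↔ Q c) : Dec C Q :=
  let ⟨_, hd, hd'⟩ := hP
  ⟨_, hd, fun c => (hd' c).trans (h c)⟩

theorem ite [∀ c, Decidable (P c)] (hP : Dec C P) (hf : Comp C f) (hg : Comp C g) :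
    Comp C fun c => if P c then f c else g c := by
  obtain ⟨d, hd, hd'⟩ := hP
  refine (Comp.cond hd hf hg).congr fun c => ?_
  by_cases h : P c
  · rw [if_pos h, if_neg ((hd' c).2 h)]
  · rw [if_neg h, if_pos (not_not.1 fun h' => h ((hd' c).1 h'))]

theorem ind [∀ c, Decidable (P c)] (hP : Dec C P) : Comp C fun c => if P c then 1 else 0 :=
  hP.ite (Comp.const 1) (Comp.const 0)

theorem lt (hf : Comp C f) (hg : Comp C g) : Dec C fun c => f c < g c :=
  ⟨_, hg.sub hf, fun _ => by omega⟩

theorem le (hf : Comp C f) (hg : Comp C g) : Dec C fun c => f c ≤ g c :=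
  (lt hf (hg.add (Comp.const 1))).congr fun _ => Nat.lt_succ_iff

theorem not (hP : Dec C P) : Dec C fun c => ¬ P c := by
  obtain ⟨d, hd, hd'⟩ := hP
  exact ⟨_, (Comp.const 1).sub hd, fun c => Iff.trans (by omega) (not_congr (hd' c))⟩

theorem and (hP : Dec C P) (hQ : Dec C Q) : Dec C fun c => P c ∧ Q c := by
  obtain ⟨d, hd, hd'⟩ := hP
  obtain ⟨e, he, he'⟩ := hQ
  exact ⟨_, hd.mul he, fun c => mul_ne_zero_iff.trans (and_congr (hd' c) (he' c))⟩

theorem or (hP : Dec C P) (hQ : Dec C Q) : Dec C fun c => P c ∨ Q c :=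
  (hP.not.and hQ.not).not.congr fun c => by tauto

theorem eq (hf : Comp C f) (hg : Comp C g) : Dec C fun c => f c = g c :=
  ((le hf hg).and (le hg hf)).congr fun c => by omega

theorem weaken {C' : Ctx} (hP : Dec C P) (w : Weak C' C) : Dec C' fun c => P (w.π c) :=
  let ⟨_, hd, hd'⟩ := hP
  ⟨_, hd.weaken w, fun _ => hd' _⟩

theorem subst {P : C.nat.γ → Prop} (hf : Comp C f) (hP : Dec C.nat P) :
    Dec C fun c => P (c, f c) :=
  let ⟨_, hd, hd'⟩ := hP
  ⟨_, hf.subst hd, fun _ => hd' _⟩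

/-- A bounded search succeeds exactly when the sum of the deciding values is nonzero. -/
theorem exists_lt {P : C.γ → ℕ → Prop} (hf : Comp C f) (hfb : PolyBdd C.S f)
    (hP : Dec C.nat fun c => P c.1 c.2) : Dec C fun c => ∃ i < f c, P c i := by
  obtain ⟨d, hd, hd'⟩ := hP
  refine ⟨_, Comp.sum (f := fun c i => d (c, i)) hf hfb hd, fun c => ?_⟩
  simp only [ne_eq, Finset.sum_eq_zero_iff, Finset.mem_range, not_forall, exists_prop]
  exact exists_congr fun i => and_congr_right fun _ => hd' (c, i)

end Dec

theorem Comp.card {C : Ctx} {f : C.γ → ℕ} {P : C.γ → ℕ → Prop} [∀ c, DecidablePred (P c)]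
    (hf : Comp C f) (hfb : PolyBdd C.S f) (hP : Dec C.nat fun c => P c.1 c.2) :
    Comp C fun c => ((Finset.range (f c)).filter (P c)).card :=
  (Comp.sum (f := fun c i => if P c i then 1 else 0) hf hfb hP.ind).congr fun c => by
    rw [Finset.card_filter]

theorem Comp.sumFilter {C : Ctx} {f : C.γ → ℕ} {g : C.γ → ℕ → ℕ} {P : C.γ → ℕ → Prop}
    [∀ c, DecidablePred (P c)] (hf : Comp C f) (hfb : PolyBdd C.S f)
    (hP : Dec C.nat fun c => P c.1 c.2) (hg : Comp C.nat fun c => g c.1 c.2) :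
    Comp C fun c => ∑ i ∈ (Finset.range (f c)).filter (P c), g c i :=
  (Comp.sum (f := fun c i => if P c i then g c i else 0) hf hfb
    (hP.ite hg (Comp.const 0))).congr fun c => by
    rw [Finset.sum_filter]

end RAM

namespace FairAuction

open Finset

/-! ### The allocation rule, over an arbitrary ordered monoid of weights -/

section Rule

variable {R : Type*} [AddCommMonoid R] [LinearOrder R]

/-- The total weight of the goods below `m` that `f` assigns to `i`. -/
def bundleSum {M : Type*} [AddCommMonoid M] (w : ℕ → M) (f : ℕ → ℕ) (m i : ℕ) : M :=
  ∑ h ∈ range m with f h = i, w h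

/-- The size of a good in units of `t / K ^ 3`, rounded down and capped at `K ^ 2`. -/
def roundedSize (K : ℕ) (t x : R) : ℕ := #{c ∈ range (K ^ 2) | (c + 1) • t ≤ K ^ 3 • x}

/-- The rounded size of a good if it is large, and zero if it is small. -/
def largeSize (K : ℕ) (t x : R) : ℕ := if roundedSize K t x < K then 0 else roundedSize K t x

/-- The weight of a good if it is small, and zero if it is large. -/
def smallPart (K : ℕ) (t x : R) : R := if roundedSize K t x < K then x else 0

/-- The number of units that the agents lack to have `Q` units each, under the assignment `f`. -/
def deficit (n m Q : ℕ) (s : ℕ → ℕ) (f : ℕ → ℕ) : ℕ := ∑ i ∈ range n, (Q - bundleSum s f m i)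

/-- Some assignment of the large goods leaves a deficit that the small goods can compensate. -/
def Attainable (K n m : ℕ) (w : ℕ → R) (t : R) : Prop :=
  ∃ f : ℕ → ℕ, (∀ h < m, f h < n) ∧
    deficit n m (K ^ 2 - K) (fun h => largeSize K t (w h)) f • t ≤
      K ^ 3 • ∑ h ∈ range m, smallPart K t (w h)

/-- The maximum of zero and the first values of a sequence. -/
def maxUpto (f : ℕ → R) : ℕ → R
  | 0 => 0
  | N + 1 => max (maxUpto f N) (f N)

open Classical in
/-- The largest attainable multiple of a weight; this is `K` times an approximation of the maximin
share. -/
noncomputable def shareLevel (K n m : ℕ) (w : ℕ → R) : R :=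
  maxUpto (fun g => maxUpto (fun j => if Attainable K n m w (j • w g) then j • w g else 0)
    (K * m + 1)) m

/-- The weight `x` suffices for a bundle. -/
def Full (K : ℕ) (T x : R) : Prop := (K - 2) • T ≤ (2 * K ^ 2) • x

instance (K : ℕ) (T x : R) : Decidable (Full K T x) := inferInstanceAs (Decidable (_ ≤ _))

/-- The weight of the open bag, before good `h` is processed. -/
def openBag (K : ℕ) (T : R) (w : ℕ → R) : ℕ → R
  | 0 => 0
  | h + 1 => if Full K T (w h) then openBag K T w h
      else if Full K T (openBag K T w h + w h) then 0 else openBag K T w h + w h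

/-- The number of bags that are closed before good `h` is processed. -/
def closedBags (K : ℕ) (T : R) (w : ℕ → R) (h : ℕ) : ℕ :=
  #{g ∈ range h | ¬ Full K T (w g) ∧ Full K T (openBag K T w g + w g)}

/-- The number of the bundle of good `h`: full goods are on their own, the others are put into
bags. -/
def bagOf (K : ℕ) (T : R) (m : ℕ) (w : ℕ → R) (h : ℕ) : ℕ :=
  if Full K T (w h) then m + h else closedBags K T w h

/-- The weight of bundle `k`. -/
def bagWeight (K : ℕ) (T : R) (m : ℕ) (w : ℕ → R) (k : ℕ) : R :=
  bundleSum w (bagOf K T m w) m k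

/-- The number of elements of `V` that precede `k` if we sort by `key`, breaking ties by index. -/
def rankIn (key : ℕ → R) (V : Finset ℕ) (k : ℕ) : ℕ :=
  #{l ∈ V | key l < key k ∨ key l = key k ∧ l < k}

/-- The bundles that suffice for an agent. -/
def fullBags (K : ℕ) (T : R) (m : ℕ) (w : ℕ → R) : Finset ℕ :=
  {k ∈ range (2 * m) | Full K T (bagWeight K T m w k)}

/-- The position (in the order of increasing bids) of the agent who receives good `h`. -/
def slotAt (K : ℕ) (T : R) (n m : ℕ) (w : ℕ → R) (h : ℕ) : ℕ :=
  if T ≠ 0 ∧ Full K T (bagWeight K T m w (bagOf K T m w h)) then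
    min (rankIn (bagWeight K T m w) (fullBags K T m w) (bagOf K T m w h)) (n - 1)
  else n - 1

/-- The position of the agent who receives good `h`. -/
noncomputable def slot (K n m : ℕ) (w : ℕ → R) : ℕ → ℕ := slotAt K (shareLevel K n m w) n m w

theorem slot_lt (K : ℕ) {n : ℕ} (m : ℕ) (w : ℕ → R) (hn : 0 < n) (h : ℕ) : slot K n m w h < n := by
  unfold slot slotAt
  split_ifs <;> omega

end Rule

/-! ### Invariance under strictly monotone additive maps -/

section Invariance

theorem map_bundleSum {R R' : Type*} [AddCommMonoid R] [AddCommMonoid R'] (φ : R →+ R')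
    (w : ℕ → R) (f : ℕ → ℕ) (m i : ℕ) :
    bundleSum (fun h => φ (w h)) f m i = φ (bundleSum w f m i) := by
  simp [bundleSum]

variable {R R' : Type*} [AddCommMonoid R] [LinearOrder R] [AddCommMonoid R'] [LinearOrder R']
  {φ : R →+ R'}

theorem roundedSize_map (hφ : StrictMono φ) (K : ℕ) (t x : R) :
    roundedSize K (φ t) (φ x) = roundedSize K t x := by
  simp only [roundedSize, ← map_nsmul, hφ.le_iff_le]

theorem largeSize_map (hφ : StrictMono φ) (K : ℕ) (t x : R) :
    largeSize K (φ t) (φ x) = largeSize K t x := by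
  simp only [largeSize, roundedSize_map hφ]

theorem smallPart_map (hφ : StrictMono φ) (K : ℕ) (t x : R) :
    smallPart K (φ t) (φ x) = φ (smallPart K t x) := by
  simp only [smallPart, roundedSize_map hφ]
  split_ifs <;> simp

theorem attainable_map (hφ : StrictMono φ) (K n m : ℕ) (w : ℕ → R) (t : R) :
    Attainable K n m (fun h => φ (w h)) (φ t) ↔ Attainable K n m w t := by
  simp only [Attainable, largeSize_map hφ, smallPart_map hφ, ← map_sum, ← map_nsmul,
    hφ.le_iff_le]

theorem maxUpto_map (hφ : StrictMono φ) (f : ℕ → R) (N : ℕ) :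
    maxUpto (fun i => φ (f i)) N = φ (maxUpto f N) := by
  induction N with
  | zero => simp [maxUpto]
  | succ N ih => rw [maxUpto, ih, maxUpto, hφ.monotone.map_max]

theorem shareLevel_map (hφ : StrictMono φ) (K n m : ℕ) (w : ℕ → R) :
    shareLevel K n m (fun h => φ (w h)) = φ (shareLevel K n m w) := by
  simp only [shareLevel, ← map_nsmul, attainable_map hφ, ← maxUpto_map hφ]
  congr 1
  ext g
  congr 1
  ext j
  have := attainable_map hφ K n m w (j • w g)
  rw [map_nsmul] at this
  by_cases ha : Attainable K n m w (j • w g)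
  · rw [if_pos ha, if_pos (this.2 ha), map_nsmul]
  · rw [if_neg ha, if_neg (mt this.1 ha), map_zero]

theorem full_map (hφ : StrictMono φ) (K : ℕ) (T x : R) : Full K (φ T) (φ x) ↔ Full K T x := by
  simp only [Full, ← map_nsmul, hφ.le_iff_le]

theorem openBag_map (hφ : StrictMono φ) (K : ℕ) (T : R) (w : ℕ → R) (h : ℕ) :
    openBag K (φ T) (fun h => φ (w h)) h = φ (openBag K T w h) := by
  induction h with
  | zero => simp [openBag]
  | succ h ih =>
    simp only [openBag, ih, full_map hφ, ← map_add]
    split_ifs <;> simp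

theorem closedBags_map (hφ : StrictMono φ) (K : ℕ) (T : R) (w : ℕ → R) (h : ℕ) :
    closedBags K (φ T) (fun h => φ (w h)) h = closedBags K T w h := by
  simp only [closedBags, openBag_map hφ, full_map hφ, ← map_add]

theorem bagOf_map (hφ : StrictMono φ) (K : ℕ) (T : R) (m : ℕ) (w : ℕ → R) :
    bagOf K (φ T) m (fun h => φ (w h)) = bagOf K T m w := by
  ext h
  simp only [bagOf, full_map hφ, closedBags_map hφ]

theorem bagWeight_map (hφ : StrictMono φ) (K : ℕ) (T : R) (m : ℕ) (w : ℕ → R) (k : ℕ) :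
    bagWeight K (φ T) m (fun h => φ (w h)) k = φ (bagWeight K T m w k) := by
  simp only [bagWeight, bagOf_map hφ, map_bundleSum]

theorem rankIn_map (hφ : StrictMono φ) (key : ℕ → R) (V : Finset ℕ) (k : ℕ) :
    rankIn (fun l => φ (key l)) V k = rankIn key V k := by
  simp only [rankIn, hφ.lt_iff_lt, hφ.injective.eq_iff]

/-- Every ingredient of the rule is built from sums, natural multiples and comparisons. This is
applied to the inclusion of `ℝ≥0` into `ℝ`, where the weights are analysed, and to division by a
common denominator, which reduces rational data to natural numbers. -/
theorem slot_map (hφ : StrictMono φ) (K n m : ℕ) (w : ℕ → R) :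
    slot K n m (fun h => φ (w h)) = slot K n m w := by
  ext h
  have hb : bagWeight K (φ (shareLevel K n m w)) m (fun h => φ (w h)) =
      fun k => φ (bagWeight K (shareLevel K n m w) m w k) := by
    ext k
    exact bagWeight_map hφ _ _ _ _ _
  have h0 : φ (shareLevel K n m w) ≠ 0 ↔ shareLevel K n m w ≠ 0 := by
    rw [← map_zero φ, hφ.injective.ne_iff]
  simp only [slot, shareLevel_map hφ, slotAt, fullBags, hb, full_map hφ, rankIn_map hφ,
    bagOf_map hφ, h0]

end Invariance

end FairAuction

namespace FairAuction

open Finset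

/-! ### Bundles -/

section Bundles

variable {M : Type*} [AddCommMonoid M]

theorem bundleSum_eq_sum_ite (w : ℕ → M) (f : ℕ → ℕ) (m i : ℕ) :
    bundleSum w f m i = ∑ h ∈ range m, if f h = i then w h else 0 :=
  sum_filter _ _

theorem bundleSum_succ (w : ℕ → M) (f : ℕ → ℕ) (m i : ℕ) :
    bundleSum w f (m + 1) i = bundleSum w f m i + if f m = i then w m else 0 := by
  simp only [bundleSum_eq_sum_ite, sum_range_succ]

theorem bundleSum_congr {w w' : ℕ → M} {f g : ℕ → ℕ} {m i : ℕ} (hw : ∀ h < m, w h = w' h)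
    (h : ∀ h < m, f h = g h) : bundleSum w f m i = bundleSum w' g m i := by
  simp only [bundleSum_eq_sum_ite]
  exact sum_congr rfl fun x hx => by rw [h x (mem_range.1 hx), hw x (mem_range.1 hx)]

theorem sum_bundleSum (w : ℕ → M) (f : ℕ → ℕ) (m : ℕ) (I : Finset ℕ) :
    ∑ i ∈ I, bundleSum w f m i = ∑ h ∈ range m with f h ∈ I, w h := by
  simp only [bundleSum_eq_sum_ite]
  rw [sum_comm, sum_filter]
  exact sum_congr rfl fun h _ => sum_ite_eq I (f h) fun _ => w h

theorem sum_range_bundleSum (w : ℕ → M) {f : ℕ → ℕ} {n m : ℕ} (hf : ∀ h < m, f h < n) :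
    ∑ i ∈ range n, bundleSum w f m i = ∑ h ∈ range m, w h := by
  rw [sum_bundleSum, filter_true_of_mem fun h hh => mem_range.2 (hf h (mem_range.1 hh))]

theorem bundleSum_nonneg {w : ℕ → ℝ} (hw : ∀ h, 0 ≤ w h) (f : ℕ → ℕ) (m i : ℕ) :
    0 ≤ bundleSum w f m i := sum_nonneg fun h _ => hw h

theorem le_bundleSum {w : ℕ → ℝ} (hw : ∀ h, 0 ≤ w h) (f : ℕ → ℕ) {m h : ℕ} (hh : h < m) :
    w h ≤ bundleSum w f m (f h) :=
  single_le_sum (f := w) (fun g _ => hw g) (mem_filter.2 ⟨mem_range.2 hh, rfl⟩)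

end Bundles

/-! ### The approximation of the maximin share -/

/-- Small goods can be distributed such that each agent receives her demand up to the size of one
good. -/
theorem exists_fill {n : ℕ} (hn : 0 < n) {δ : ℝ} {x : ℕ → ℝ} (hx : ∀ h, 0 ≤ x h)
    (hxδ : ∀ h, x h ≤ δ) (m : ℕ) (d : ℕ → ℝ)
    (hd : ∑ i ∈ range n, max (d i) 0 ≤ ∑ h ∈ range m, x h) :
    ∃ f : ℕ → ℕ, (∀ h < m, f h < n) ∧ ∀ i < n, d i - δ ≤ bundleSum x f m i := by
  by_cases hall : ∀ i < n, d i ≤ δ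
  · exact ⟨fun _ => 0, fun _ _ => hn, fun i hi =>
      (sub_nonpos.2 (hall i hi)).trans (bundleSum_nonneg hx _ _ _)⟩
  push Not at hall
  obtain ⟨i, hi, hiδ⟩ := hall
  have hδ : 0 ≤ δ := (hx 0).trans (hxδ 0)
  induction m generalizing d i with
  | zero =>
    exfalso
    have : max (d i) 0 ≤ ∑ i ∈ range n, max (d i) 0 :=
      single_le_sum (f := fun i => max (d i) 0) (fun _ _ => le_max_right _ _) (mem_range.2 hi)
    simp only [range_zero, sum_empty] at hd
    linarith [le_max_left (d i) 0]
  | succ m ih =>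
    -- Greedy choice: the last good goes to an agent whose demand exceeds `δ`. Her demand stays
    -- nonnegative, so the total demand drops by exactly `x m` and the hypothesis survives.
    set d' := Function.update d i (d i - x m) with hd'
    have hsum : ∑ j ∈ range n, max (d' j) 0 ≤ ∑ h ∈ range m, x h := by
      have h1 := add_sum_erase (range n) (fun j => max (d j) 0) (mem_range.2 hi)
      have h2 := add_sum_erase (range n) (fun j => max (d' j) 0) (mem_range.2 hi)
      have h3 : ∑ j ∈ (range n).erase i, max (d' j) 0 = ∑ j ∈ (range n).erase i, max (d j) 0 :=
        sum_congr rfl fun j hj => by rw [hd', Function.update_of_ne (ne_of_mem_erase hj)]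
      have h4 : d' i = d i - x m := by simp [hd']
      rw [sum_range_succ] at hd
      rw [h4, max_eq_left (by linarith [hxδ m])] at h2
      rw [max_eq_left (by linarith)] at h1
      linarith
    obtain ⟨f, hf, hfd⟩ : ∃ f : ℕ → ℕ, (∀ h < m, f h < n) ∧
        ∀ j < n, d' j - δ ≤ bundleSum x f m j := by
      by_cases hall : ∀ j < n, d' j ≤ δ
      · exact ⟨fun _ => 0, fun _ _ => hn, fun j hj =>
          (sub_nonpos.2 (hall j hj)).trans (bundleSum_nonneg hx _ _ _)⟩
      push Not at hall
      obtain ⟨j, hj, hjδ⟩ := hall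
      exact ih d' hsum j hj hjδ
    refine ⟨Function.update f m i, fun h hh => ?_, fun j hj => ?_⟩
    · rcases eq_or_ne h m with rfl | hne
      · simpa using hi
      · rw [Function.update_of_ne hne]
        exact hf h (by omega)
    · rw [bundleSum_succ, bundleSum_congr (w' := x) (g := f) (fun _ _ => rfl)
        (fun h hh => Function.update_of_ne (by omega) _ _), Function.update_self]
      have := hfd j hj
      rcases eq_or_ne i j with rfl | hne
      · rw [hd', Function.update_self] at this
        rw [if_pos rfl]
        linarith
      · rw [hd', Function.update_of_ne hne.symm] at this
        rw [if_neg hne]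
        linarith

section Rounding

variable {K : ℕ} {t x : ℝ}

theorem roundedSize_eq (ht : 0 < t) (hx : 0 ≤ x) :
    roundedSize K t x = min (K ^ 2) ⌊K ^ 3 * x / t⌋₊ := by
  have : (range (K ^ 2)).filter (fun c => (c + 1) • t ≤ K ^ 3 • x) =
      range (min (K ^ 2) ⌊K ^ 3 * x / t⌋₊) := by
    ext c
    have h : (c + 1) • t ≤ K ^ 3 • x ↔ c < ⌊K ^ 3 * x / t⌋₊ := by
      rw [← Nat.succ_le_iff, Nat.le_floor_iff (by positivity), le_div_iff₀ ht]
      simp [nsmul_eq_mul]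
    rw [mem_filter, h, mem_range, mem_range, lt_min_iff]
  rw [roundedSize, this, card_range]

theorem roundedSize_mul_le (ht : 0 < t) (hx : 0 ≤ x) : roundedSize K t x * t ≤ K ^ 3 * x := by
  rw [← le_div_iff₀ ht, roundedSize_eq ht hx]
  exact le_trans (by exact_mod_cast min_le_right _ _) (Nat.floor_le (by positivity))

theorem lt_roundedSize_add_one_mul (ht : 0 < t) (hx : 0 ≤ x) (h : roundedSize K t x < K ^ 2) :
    K ^ 3 * x < (roundedSize K t x + 1) * t := by
  rw [← div_lt_iff₀ ht]
  rw [roundedSize_eq ht hx] at h ⊢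
  rw [min_eq_right (by simp at h; omega)]
  exact Nat.lt_floor_add_one _

end Rounding

/-- Large goods follow the attaining assignment, and `exists_fill` covers the deficits with small
goods. In units of `t / K ^ 3` the target is `K ^ 2 - K`, rounding down only undercounts, and
filling loses at most one small good, that is `K` units. This leaves `K ^ 2 - 2 * K` units, which is
`(K - 2) * t / K ^ 2`. -/
theorem exists_bundles_of_attainable {K n m : ℕ} {w : ℕ → ℝ} {t : ℝ} (hK : 1 ≤ K) (hn : 0 < n)
    (hw : ∀ h, 0 ≤ w h) (ht : 0 < t) (h : Attainable K n m w t) :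
    ∃ f : ℕ → ℕ, (∀ h < m, f h < n) ∧ ∀ i < n, (K - 2) * t ≤ K ^ 2 * bundleSum w f m i := by
  obtain ⟨f₁, hf₁, h⟩ := h
  have hK' : (1 : ℝ) ≤ K := by exact_mod_cast hK
  have hK0 : (0 : ℝ) < K := by linarith
  have hKK : K ≤ K ^ 2 := by nlinarith
  set s : ℕ → ℕ := fun h => largeSize K t (w h) with hs
  set y : ℕ → ℝ := fun h => smallPart K t (w h) with hy
  have hy0 : ∀ h, 0 ≤ y h := fun h => by
    simp only [hy, smallPart]
    split_ifs
    · exact hw h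
    · exact le_rfl
  have hyδ : ∀ h, y h ≤ t / K ^ 2 := fun h => by
    simp only [hy, smallPart]
    split_ifs with hc
    · have h1 := lt_roundedSize_add_one_mul ht (hw h) (lt_of_lt_of_le hc hKK)
      have h2 : ((roundedSize K t (w h) : ℝ) + 1) ≤ K := by exact_mod_cast hc
      have h3 : (K : ℝ) ^ 3 * w h ≤ K * t := h1.le.trans (by gcongr)
      rw [le_div_iff₀ (by positivity)]
      have : (K : ℝ) * (w h * K ^ 2) ≤ K * t := by
         linarith [h3, show (K : ℝ) * (w h * K ^ 2) = K ^ 3 * w h by ring]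
      exact le_of_mul_le_mul_left this hK0
    · positivity
  set Q := K ^ 2 - K with hQ
  have hQ' : (Q : ℝ) = K ^ 2 - K := by rw [hQ]; push_cast [hKK]; ring
  set d : ℕ → ℝ := fun i => ((Q - bundleSum s f₁ m i : ℕ) : ℝ) * (t / K ^ 3) with hd
  obtain ⟨f₂, hf₂, hfd⟩ := exists_fill hn hy0 hyδ m d (by
    have h1 : ∀ i, max (d i) 0 = d i := fun i => max_eq_left (by positivity)
    simp only [h1]
    simp only [hd, ← sum_mul, ← Nat.cast_sum]
    rw [mul_div_assoc', div_le_iff₀ (by positivity), mul_comm _ ((K : ℝ) ^ 3)]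
    simpa [deficit, nsmul_eq_mul] using h)
  refine ⟨fun h => if roundedSize K t (w h) < K then f₂ h else f₁ h, fun h hh => ?_,
    fun i hi => ?_⟩
  · dsimp only
    split_ifs
    exacts [hf₂ h hh, hf₁ h hh]
  · have hle : ((bundleSum s f₁ m i : ℕ) : ℝ) * (t / K ^ 3) + bundleSum y f₂ m i ≤
        bundleSum w (fun h => if roundedSize K t (w h) < K then f₂ h else f₁ h) m i := by
      simp only [bundleSum_eq_sum_ite]
      push_cast
      rw [sum_mul, ← sum_add_distrib]
      refine sum_le_sum fun h _ => ?_
      by_cases hc : roundedSize K t (w h) < K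
      · simp only [hs, hy, largeSize, smallPart, hc, if_true]
        simp
      · simp only [hs, hy, largeSize, smallPart, hc, if_false]
        rw [ite_self, add_zero]
        split_ifs
        · have := roundedSize_mul_le (K := K) ht (hw h)
          rw [mul_div_assoc', div_le_iff₀ (by positivity)]
          linarith
        · rw [zero_mul]
    have h1 := hfd i hi
    have h2 : (Q : ℝ) * (t / K ^ 3) ≤ (bundleSum s f₁ m i : ℕ) * (t / K ^ 3) + d i := by
      have : Q ≤ bundleSum s f₁ m i + (Q - bundleSum s f₁ m i) := by omega
      simp only [hd, ← add_mul]
      gcongr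
      exact_mod_cast this
    have h3 : (K : ℝ) ^ 2 * (Q * (t / K ^ 3) - t / K ^ 2) = (K - 2) * t := by
      rw [hQ']
      field_simp
      ring
    rw [← h3]
    gcongr
    linarith

/-- The partition itself serves as the assignment. A large good has at least `K` units, so rounding
it down costs at most a factor `1 + 1 / K`. On a bundle of at most `K ^ 2` rounded units this is at
most `K` units, exactly the slack in the target `K ^ 2 - K`. -/
theorem attainable_of_bundles {K n m : ℕ} {w : ℕ → ℝ} {t : ℝ} (hK : 1 ≤ K)
    (hw : ∀ h, 0 ≤ w h) (ht : 0 < t) {f : ℕ → ℕ} (hf : ∀ h < m, f h < n)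
    (h : ∀ i < n, t ≤ K * bundleSum w f m i) : Attainable K n m w t := by
  refine ⟨f, hf, ?_⟩
  have hK' : (1 : ℝ) ≤ K := by exact_mod_cast hK
  have hK0 : (0 : ℝ) < K := by linarith
  have hKK : K ≤ K ^ 2 := by nlinarith
  set s : ℕ → ℕ := fun h => largeSize K t (w h) with hs
  set y : ℕ → ℝ := fun h => smallPart K t (w h) with hy
  have hy0 : ∀ h, 0 ≤ y h := fun h => by
    simp only [hy, smallPart]
    split_ifs
    · exact hw h
    · exact le_rfl
  rw [deficit, ← sum_range_bundleSum y hf, sum_smul, smul_sum]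
  refine sum_le_sum fun i hi => ?_
  rw [nsmul_eq_mul, nsmul_eq_mul]
  push_cast
  -- A bundle whose large goods reach the target has no deficit; only in the other case is the
  -- rounding error estimated.
  by_cases hQ : K ^ 2 - K ≤ bundleSum s f m i
  · rw [Nat.sub_eq_zero_of_le hQ]
    have := bundleSum_nonneg hy0 f m i
    simp only [Nat.cast_zero, zero_mul]
    positivity
  · push Not at hQ
    rw [Nat.cast_sub hQ.le, Nat.cast_sub hKK]
    push_cast
    have key : (K : ℝ) * (K ^ 3 * bundleSum w f m i) ≤
        (K + 1) * ((bundleSum s f m i : ℕ) * t) + K * (K ^ 3 * bundleSum y f m i) := by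
      have hsi : ∀ h ∈ range m, f h = i → s h ≤ bundleSum s f m i := fun h hh hi =>
        single_le_sum (f := s) (fun _ _ => Nat.zero_le _) (mem_filter.2 ⟨hh, hi⟩)
      rw [bundleSum, bundleSum, bundleSum]
      push_cast
      rw [sum_mul, mul_sum, mul_sum, mul_sum, mul_sum, mul_sum, ← sum_add_distrib]
      refine sum_le_sum fun h hh => ?_
      obtain ⟨hh, hi⟩ := mem_filter.1 hh
      have hsh := hsi h hh hi
      simp only [hs, hy, largeSize, smallPart] at hsh ⊢
      by_cases hc : roundedSize K t (w h) < K
      · simp [hc]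
      · rw [if_neg hc] at hsh
        simp only [hc, if_false, mul_zero, add_zero]
        -- The whole bundle stays below `K ^ 2 - K` rounded units, so the cap at `K ^ 2` is inactive
        -- for this good.
        have h1 := lt_roundedSize_add_one_mul (K := K) ht (hw h)
           (by simp only [hs, largeSize] at hQ; omega)
        have h2 : (K : ℝ) ≤ roundedSize K t (w h) := by exact_mod_cast not_lt.1 hc
        nlinarith
    have hb := h i (mem_range.1 hi)
    have h1 : ((bundleSum s f m i : ℕ) : ℝ) ≤ K ^ 2 := by
      have : bundleSum s f m i ≤ K ^ 2 := by omega
      exact_mod_cast this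
    have h2 : (K : ℝ) * (K ^ 2 * t) ≤ K * (K ^ 3 * bundleSum w f m i) := by
      have : (K : ℝ) ^ 2 * t ≤ K ^ 2 * (K * bundleSum w f m i) := by gcongr
      have h3 := mul_le_mul_of_nonneg_left this hK0.le
      linarith [show (K : ℝ) * (K ^ 2 * (K * bundleSum w f m i)) =
        K * (K ^ 3 * bundleSum w f m i) by ring]
    have h3 : ((bundleSum s f m i : ℕ) : ℝ) * t ≤ K ^ 2 * t := by gcongr
    refine le_of_mul_le_mul_left ?_ hK0
    nlinarith

section maxUpto

variable (f : ℕ → ℝ) (N : ℕ)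

theorem maxUpto_nonneg : 0 ≤ maxUpto f N := by
  induction N with
  | zero => exact le_rfl
  | succ N ih => exact le_max_of_le_left ih

variable {f N} in
theorem le_maxUpto {i : ℕ} (hi : i < N) : f i ≤ maxUpto f N := by
  induction N with
  | zero => omega
  | succ N ih =>
    rcases Nat.lt_succ_iff_lt_or_eq.1 hi with hi | rfl
    · exact le_max_of_le_left (ih hi)
    · exact le_max_right _ _

theorem maxUpto_eq_zero_or : maxUpto f N = 0 ∨ ∃ i < N, maxUpto f N = f i := by
  induction N with
  | zero => exact Or.inl rfl
  | succ N ih =>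
    rw [maxUpto]
    rcases max_choice (maxUpto f N) (f N) with h | h
    · rw [h]
      exact ih.imp_right fun ⟨i, hi, h⟩ => ⟨i, by omega, h⟩
    · exact Or.inr ⟨N, by omega, h⟩

end maxUpto

theorem shareLevel_nonneg (K n m : ℕ) (w : ℕ → ℝ) : 0 ≤ shareLevel K n m w := maxUpto_nonneg _ _

theorem attainable_shareLevel {K n m : ℕ} {w : ℕ → ℝ} (h : 0 < shareLevel K n m w) :
    Attainable K n m w (shareLevel K n m w) := by
  unfold shareLevel at h ⊢
  rcases maxUpto_eq_zero_or (fun g => maxUpto (fun j =>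
    open Classical in if Attainable K n m w (j • w g) then j • w g else 0) (K * m + 1)) m with
    h0 | ⟨g, -, hg⟩
  · exact absurd h0 h.ne'
  · rw [hg] at h ⊢
    rcases maxUpto_eq_zero_or (fun j =>
      open Classical in if Attainable K n m w (j • w g) then j • w g else 0) (K * m + 1) with
      h0 | ⟨j, -, hj⟩
    · exact absurd h0 h.ne'
    · rw [hj] at h ⊢
      split_ifs at h ⊢ with ha
      · exact ha
      · exact absurd h (lt_irrefl _)

/-- If `μ > 0`, let `g` be the heaviest good of a bundle of weight `μ`, so that `w g ≤ μ ≤ m * w g`.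
The largest multiple of `w g` not exceeding `K * μ` has a factor of at most `K * m`, so it is among
the candidates, and it misses `K * μ` by less than `w g ≤ μ`. -/
theorem le_shareLevel {K n m : ℕ} {w : ℕ → ℝ} (hK : 1 ≤ K) (hw : ∀ h, 0 ≤ w h) {f : ℕ → ℕ}
    (hf : ∀ h < m, f h < n) {μ : ℝ} (h : ∀ i < n, μ ≤ bundleSum w f m i) {i₀ : ℕ}
    (hμ : bundleSum w f m i₀ = μ) : (K - 1) * μ ≤ shareLevel K n m w := by
  have hK' : (1 : ℝ) ≤ K := by exact_mod_cast hK
  have hK0 : (0 : ℝ) < K := by linarith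
  have hμ0' : 0 ≤ μ := hμ ▸ bundleSum_nonneg hw _ _ _
  rcases hμ0'.eq_or_lt with hμ0 | hμ0
  · rw [← hμ0, mul_zero]
    exact shareLevel_nonneg _ _ _ _
  have hne : ((range m).filter fun h => f h = i₀).Nonempty := by
    rw [nonempty_iff_ne_empty]
    intro h0
    rw [bundleSum, h0, sum_empty] at hμ
    exact hμ0.ne hμ
  obtain ⟨g, hg, hmax⟩ := exists_max_image _ w hne
  have hgm : g < m := mem_range.1 (mem_filter.1 hg).1
  have h1 : w g ≤ μ := hμ ▸ single_le_sum (f := w) (fun h _ => hw h) hg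
  have h2 : μ ≤ m * w g := by
    rw [← hμ, bundleSum]
    calc _ ≤ #{h ∈ range m | f h = i₀} • w g := sum_le_card_nsmul _ _ _ hmax
      _ ≤ m * w g := by
        rw [nsmul_eq_mul]
        gcongr
        · exact hw g
        · exact (card_filter_le _ _).trans_eq (card_range m)
  have hg0 : 0 < w g := by
    by_contra hc
    have : w g = 0 := le_antisymm (not_lt.1 hc) (hw g)
    rw [this, mul_zero] at h2
    linarith
  set j := ⌊K * μ / w g⌋₊ with hj
  have hj1 : j * w g ≤ K * μ := by
    rw [← le_div_iff₀ hg0]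
    exact Nat.floor_le (by positivity)
  have hj2 : K * μ < (j + 1) * w g := by
    rw [← div_lt_iff₀ hg0]
    exact Nat.lt_floor_add_one _
  have hjm : j < K * m + 1 := by
    have : (j : ℝ) * w g ≤ (K * m : ℕ) * w g := hj1.trans (by
      push_cast
      rw [mul_assoc]
      gcongr)
    have := le_of_mul_le_mul_right this hg0
    have : j ≤ K * m := by exact_mod_cast this
    omega
  refine le_trans ?_ (le_maxUpto hgm)
  refine le_trans ?_ (le_maxUpto hjm)
  have hge : (K - 1) * μ ≤ j • w g := by
    rw [nsmul_eq_mul]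
    linarith
  by_cases hj0 : j • w g ≤ 0
  · split_ifs <;> linarith
  · rwa [if_pos]
    refine attainable_of_bundles hK hw (not_le.1 hj0) hf fun i hi => ?_
    rw [nsmul_eq_mul]
    exact hj1.trans (by have := h i hi; gcongr)

end FairAuction

namespace FairAuction

open Finset

/-! ### Ranks -/

section Rank

variable {R : Type*} [LinearOrder R] {key : ℕ → R} {V : Finset ℕ}

theorem rankIn_lt_rankIn {k l : ℕ} (hk : k ∈ V) (h : key k < key l ∨ key k = key l ∧ k < l) :
    rankIn key V k < rankIn key V l := by
  refine card_lt_card ⟨fun x hx => ?_, fun hc => ?_⟩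
  · simp only [mem_filter] at hx ⊢
    refine ⟨hx.1, ?_⟩
    rcases hx.2 with h1 | ⟨h1, h1'⟩ <;> rcases h with h2 | ⟨h2, h2'⟩
    · exact Or.inl (h1.trans h2)
    · exact Or.inl (h2 ▸ h1)
    · exact Or.inl (h1 ▸ h2)
    · exact Or.inr ⟨h1.trans h2, h1'.trans h2'⟩
  · have := hc (mem_filter.2 ⟨hk, h⟩)
    simp at this

theorem key_le_of_rankIn_le {k l : ℕ} (hl : l ∈ V) (h : rankIn key V k ≤ rankIn key V l) :
    key k ≤ key l := by
  by_contra hc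
  exact absurd (rankIn_lt_rankIn hl (Or.inl (not_le.1 hc))) (not_lt.2 h)

theorem rankIn_injOn : Set.InjOn (rankIn key V) V := by
  intro k hk l hl h
  by_contra hne
  rcases lt_trichotomy (key k) (key l) with h1 | h1 | h1
  · exact absurd h (rankIn_lt_rankIn hk (Or.inl h1)).ne
  · rcases lt_or_gt_of_ne hne with h2 | h2
    · exact absurd h (rankIn_lt_rankIn hk (Or.inr ⟨h1, h2⟩)).ne
    · exact absurd h (rankIn_lt_rankIn hl (Or.inr ⟨h1.symm, h2⟩)).ne'
  · exact absurd h (rankIn_lt_rankIn hl (Or.inl h1)).ne'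

theorem rankIn_lt_card {k : ℕ} (hk : k ∈ V) : rankIn key V k < #V :=
  card_lt_card ⟨filter_subset _ _, fun hc => by simpa using hc hk⟩

/-- Ties are broken by index, so ranks are distinct; being smaller than `#V`, they exhaust the
range. -/
theorem image_rankIn : V.image (rankIn key V) = range #V := by
  refine eq_of_subset_of_card_le (fun p hp => ?_) ?_
  · obtain ⟨k, hk, rfl⟩ := mem_image.1 hp
    exact mem_range.2 (rankIn_lt_card hk)
  · rw [card_range, card_image_of_injOn rankIn_injOn]

theorem exists_rankIn_eq {p : ℕ} (hp : p < #V) : ∃ k ∈ V, rankIn key V k = p :=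
  mem_image.1 (image_rankIn (key := key) ▸ mem_range.2 hp)

end Rank

/-! ### Bag filling -/

section Bags

variable {K m : ℕ} {T θ : ℝ} {w : ℕ → ℝ}

/-- The threshold is half of the weight `(K - 2) * T / K ^ 2` that an attainable level guarantees to
each agent. The analysis of the bags uses only that `Full` is some positive threshold `θ`. -/
theorem full_iff (hK : 2 ≤ K) (T x : ℝ) :
    Full K T x ↔ (K - 2) * T / (2 * K ^ 2) ≤ x := by
  have : (2 : ℝ) ≤ K := by exact_mod_cast hK
  rw [Full, nsmul_eq_mul, nsmul_eq_mul, div_le_iff₀ (by positivity), Nat.cast_sub hK]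
  push_cast
  rw [mul_comm x]

variable (hθ : 0 < θ) (hF : ∀ x, Full K T x ↔ θ ≤ x) (hw : ∀ h, 0 ≤ w h)

theorem closedBags_succ (K : ℕ) (T : ℝ) (w : ℕ → ℝ) (h : ℕ) :
    closedBags K T w (h + 1) = closedBags K T w h +
      if ¬ Full K T (w h) ∧ Full K T (openBag K T w h + w h) then 1 else 0 := by
  simp only [closedBags, card_filter, sum_range_succ]

theorem closedBags_le (K : ℕ) (T : ℝ) (w : ℕ → ℝ) (h : ℕ) : closedBags K T w h ≤ h :=
  (card_filter_le _ _).trans_eq (card_range h)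

include hθ hF hw in
theorem openBag_mem (h : ℕ) : 0 ≤ openBag K T w h ∧ openBag K T w h < θ := by
  induction h with
  | zero => exact ⟨le_rfl, hθ⟩
  | succ h ih =>
    simp only [openBag, hF]
    have := hw h
    split_ifs
    · exact ih
    · exact ⟨le_rfl, hθ⟩
    · exact ⟨by linarith, by linarith⟩

include hθ hF hw in
/-- The bags while they are filled. -/
theorem bundleSum_bagOf_prefix {h : ℕ} (hm : h ≤ m) {k : ℕ} (hk : k < m) :
    (k < closedBags K T w h →
      θ ≤ bundleSum w (bagOf K T m w) h k ∧ bundleSum w (bagOf K T m w) h k < 2 * θ) ∧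
    (k = closedBags K T w h → bundleSum w (bagOf K T m w) h k = openBag K T w h) ∧
    (closedBags K T w h < k → bundleSum w (bagOf K T m w) h k = 0) := by
  induction h with
  | zero => simp [bundleSum, openBag, closedBags]
  | succ h ih =>
    obtain ⟨ih₁, ih₂, ih₃⟩ := ih (by omega)
    rw [bundleSum_succ, closedBags_succ, openBag]
    by_cases hf : Full K T (w h)
    · have h1 : ¬ m + h = k := by omega
      simp only [bagOf, hf, if_true, h1, if_false, not_true, false_and, add_zero]
      exact ⟨ih₁, ih₂, ih₃⟩
    · simp only [bagOf, hf, if_false, not_false_eq_true, true_and]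
      have hb := openBag_mem hθ hF hw h
      have hwθ : w h < θ := not_le.1 (mt (hF _).2 hf)
      change (_ → θ ≤ bundleSum w (bagOf K T m w) h k + _ ∧ _) ∧
        (_ → bundleSum w (bagOf K T m w) h k + _ = _) ∧
          (_ → bundleSum w (bagOf K T m w) h k + _ = 0)
      by_cases hc : Full K T (openBag K T w h + w h)
      · simp only [hc, if_true]
        rw [hF] at hc
        refine ⟨fun hlt => ?_, fun heq => ?_, fun hlt => ?_⟩
        · rcases Nat.lt_succ_iff_lt_or_eq.1 hlt with h1 | h1
          · rw [if_neg (by omega), add_zero]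
            exact ih₁ h1
          -- The bag that closes now held less than `θ` and receives a good lighter than `θ`.
          · rw [if_pos h1.symm, ih₂ h1]
            exact ⟨hc, by linarith⟩
        · rw [if_neg (by omega), add_zero, ih₃ (by omega)]
        · rw [if_neg (by omega), add_zero, ih₃ (by omega)]
      · simp only [hc, if_false, add_zero]
        refine ⟨fun hlt => ?_, fun heq => ?_, fun hlt => ?_⟩
        · rw [if_neg (by omega), add_zero]
          exact ih₁ hlt
        · rw [if_pos heq.symm, ih₂ heq]
        · rw [if_neg (by omega), add_zero, ih₃ hlt]

include hθ hF hw in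
theorem bagWeight_of_lt_closedBags {k : ℕ} (hk : k < closedBags K T w m) :
    θ ≤ bagWeight K T m w k ∧ bagWeight K T m w k < 2 * θ :=
  (bundleSum_bagOf_prefix hθ hF hw le_rfl (hk.trans_le (closedBags_le _ _ _ _))).1 hk

theorem bagOf_lt {h : ℕ} (hh : h < m) : bagOf K T m w h < 2 * m := by
  have := closedBags_le K T w h
  unfold bagOf
  split_ifs <;> omega

/-- Bag numbers of goods below `m` stay below `m`, so bundle `m + g` can contain no good other than
`g`. -/
theorem bagWeight_add {g : ℕ} (hg : g < m) :
    bagWeight K T m w (m + g) = if Full K T (w g) then w g else 0 := by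
  rw [bagWeight, bundleSum_eq_sum_ite, sum_eq_single g]
  · have := closedBags_le K T w g
    have h1 : ¬ closedBags K T w g = m + g := by omega
    by_cases hf : Full K T (w g)
    · simp [bagOf, hf]
    · simp [bagOf, hf, h1]
  · intro h hh hne
    have := closedBags_le K T w h
    rw [if_neg]
    unfold bagOf
    have := mem_range.1 hh
    split_ifs <;> omega
  · intro h
    exact absurd (mem_range.2 hg) h

include hθ hF hw in
-- Closed bags (numbers below `m`) and goods standing alone (numbers from `m` on) are different full
-- bundles, and closed bags weigh less than `2 * θ`. The predicate is trivial when `n` bundles are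
-- to be found, and an upper bound on the weight when ranks are compared.
theorem le_card_fullBags {P : ℝ → Prop} [DecidablePred P] (hP : ∀ y < 2 * θ, P y) :
    closedBags K T w m + #{g ∈ range m | Full K T (w g) ∧ P (w g)} ≤
      #{k ∈ fullBags K T m w | P (bagWeight K T m w k)} := by
  have hcm := closedBags_le K T w m
  rw [← card_image_of_injective {g ∈ range m | Full K T (w g) ∧ P (w g)}
    (add_right_injective m), ← card_range (closedBags K T w m), ← card_union_of_disjoint]
  · refine card_le_card fun k hk => ?_
    simp only [fullBags, mem_filter, mem_range]
    rcases mem_union.1 hk with hk | hk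
    · rw [mem_range] at hk
      have := bagWeight_of_lt_closedBags hθ hF hw hk
      exact ⟨⟨by omega, (hF _).2 this.1⟩, hP _ this.2⟩
    · obtain ⟨g, hg, rfl⟩ := mem_image.1 hk
      simp only [mem_filter, mem_range] at hg
      rw [bagWeight_add hg.1, if_pos hg.2.1]
      exact ⟨⟨by omega, hg.2.1⟩, hg.2.2⟩
  · rw [disjoint_left]
    intro k hk hk'
    rw [mem_range] at hk
    obtain ⟨g, -, rfl⟩ := mem_image.1 hk'
    omega

include hθ hF hw in
-- Each such good lies in a closed bag, of weight below `2 * θ`, or in the open one.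
theorem sum_not_full_le (h : ℕ) : ∑ g ∈ range h with ¬ Full K T (w g), w g ≤
    2 * θ * closedBags K T w h + openBag K T w h := by
  induction h with
  | zero => simp [openBag, closedBags]
  | succ h ih =>
    rw [sum_filter] at ih ⊢
    rw [sum_range_succ, closedBags_succ, openBag]
    have hb := openBag_mem hθ hF hw h
    by_cases hf : Full K T (w h)
    · simpa [hf] using ih
    · have hwθ : w h < θ := not_le.1 (mt (hF _).2 hf)
      by_cases hc : Full K T (openBag K T w h + w h)
      · simp only [hf, hc, if_true, if_false, not_false_eq_true, and_self]
        push_cast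
        linarith
      · simp only [hf, hc, if_false, not_false_eq_true, and_false, if_true]
        push_cast
        linarith

include hθ hF hw in
/-- If the agents in `I` have bundles of weight at least `2 * θ`, whose full goods satisfy `P`,
then these full goods and the bags are at least as many as the agents. -/
theorem card_le_of_bundles {P : ℝ → Prop} [DecidablePred P] {f : ℕ → ℕ} {I : Finset ℕ}
    (hI : ∀ i ∈ I, 2 * θ ≤ bundleSum w f m i)
    (hP : ∀ h < m, f h ∈ I → Full K T (w h) → P (w h)) :
    #I ≤ closedBags K T w m + #{g ∈ range m | Full K T (w g) ∧ P (w g)} := by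
  set A := I.filter fun i => ∃ h < m, f h = i ∧ Full K T (w h) with hA
  set B := I.filter fun i => ¬ ∃ h < m, f h = i ∧ Full K T (w h) with hB
  have hAB : #A + #B = #I := card_filter_add_card_filter_not _
  have hcA : #A ≤ #{g ∈ range m | Full K T (w g) ∧ P (w g)} := by
    refine le_trans (card_le_card ?_) (card_image_le (f := f))
    intro i hi
    obtain ⟨hi, h, hh, rfl, hf⟩ := mem_filter.1 hi
    exact mem_image_of_mem _ (mem_filter.2 ⟨mem_range.2 hh, hf, hP h hh hi hf⟩)
  -- Agents in `B` own no full good, so together they take `2 * θ` each from a total that is less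
  -- than `2 * θ` times the number of closed bags plus one.
  have hcB : #B ≤ closedBags K T w m := by
    have h1 : #B • (2 * θ) ≤ ∑ i ∈ B, bundleSum w f m i :=
      card_nsmul_le_sum _ _ _ fun i hi => hI i (mem_filter.1 hi).1
    have h2 : ∑ i ∈ B, bundleSum w f m i ≤ ∑ g ∈ range m with ¬ Full K T (w g), w g := by
      rw [sum_bundleSum]
      refine sum_le_sum_of_subset_of_nonneg (fun h hh => ?_) fun h _ _ => hw h
      obtain ⟨hm, hhB⟩ := mem_filter.1 hh
      refine mem_filter.2 ⟨hm, fun hf => ?_⟩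
      exact (mem_filter.1 hhB).2 ⟨h, mem_range.1 hm, rfl, hf⟩
    have h3 := sum_not_full_le hθ hF hw m
    have h4 := openBag_mem hθ hF hw m
    rw [nsmul_eq_mul] at h1
    have h5 : (#B : ℝ) * (2 * θ) < (closedBags K T w m + 1) * (2 * θ) := by linarith
    have h6 := lt_of_mul_lt_mul_right h5 (by linarith)
    have : #B < closedBags K T w m + 1 := by exact_mod_cast h6
    omega
  omega

end Bags

/-! ### The weights of the positions -/

section Slots

variable {K n m : ℕ} {w : ℕ → ℝ}

theorem slotAt_zero (h : ℕ) : slotAt K 0 n m w h = n - 1 := by simp [slotAt]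

/-- Description of the bundles of the positions. -/
theorem exists_bags_of_slotAt {T : ℝ} (hT : T ≠ 0) (hw : ∀ h, 0 ≤ w h)
    (hV : n ≤ #(fullBags K T m w)) {p : ℕ}
    (hp : p < n) :
    ∃ k ∈ fullBags K T m w, rankIn (bagWeight K T m w) (fullBags K T m w) k = p ∧
      bagWeight K T m w k ≤ bundleSum w (slotAt K T n m w) m p ∧
      (p < n - 1 → bundleSum w (slotAt K T n m w) m p = bagWeight K T m w k) := by
  obtain ⟨k, hk, hr⟩ := exists_rankIn_eq (key := bagWeight K T m w) (hp.trans_le hV)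
  have hmem : ∀ h < m, Full K T (bagWeight K T m w (bagOf K T m w h)) →
      bagOf K T m w h ∈ fullBags K T m w := fun h hh hf =>
    mem_filter.2 ⟨mem_range.2 (bagOf_lt hh), hf⟩
  have hsub : ∀ h, bagOf K T m w h = k → slotAt K T n m w h = p := fun h hh => by
    rw [slotAt, hh, if_pos ⟨hT, (mem_filter.1 hk).2⟩, hr]
    omega
  refine ⟨k, hk, hr, ?_, fun hpn => ?_⟩
  · rw [bagWeight, bundleSum, bundleSum]
    refine sum_le_sum_of_subset_of_nonneg (fun h hh => ?_) fun h _ _ => hw h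
    obtain ⟨hm, hh⟩ := mem_filter.1 hh
    exact mem_filter.2 ⟨hm, hsub h hh⟩
  · rw [bagWeight, bundleSum, bundleSum]
    congr 1
    -- Both the default slot and the cap are `n - 1`, so a lower slot can only come from a full
    -- bundle of exactly that rank.
    refine filter_congr fun h hh => ⟨fun hs => ?_, hsub h⟩
    unfold slotAt at hs
    split_ifs at hs with hc
    · exact rankIn_injOn (hmem h (mem_range.1 hh) hc.2) hk (by rw [hr]; omega)
    · omega

/-- What the positions receive. -/
theorem slot_spec (hK : 3 ≤ K) (hn : 0 < n) (hw : ∀ h, 0 ≤ w h) :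
    (∀ p < n, (K - 2) * shareLevel K n m w ≤ 2 * K ^ 2 * bundleSum w (slot K n m w) m p) ∧
    (∀ p q, p ≤ q → q < n →
      bundleSum w (slot K n m w) m p ≤ bundleSum w (slot K n m w) m q) ∧
    ∀ f : ℕ → ℕ, (∀ h < m, f h < n) →
      (∀ i < n, (K - 2) * shareLevel K n m w ≤ K ^ 2 * bundleSum w f m i) → ∀ i < n,
      rankIn (bundleSum w f m) (range n) i < n - 1 →
      bundleSum w (slot K n m w) m (rankIn (bundleSum w f m) (range n) i) ≤ bundleSum w f m i := by
  have hK' : (3 : ℝ) ≤ K := by exact_mod_cast hK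
  have hK0 : (0 : ℝ) < K ^ 2 := by positivity
  unfold slot
  have hT0 := shareLevel_nonneg K n m w
  have hex : 0 < shareLevel K n m w → ∃ f : ℕ → ℕ, (∀ h < m, f h < n) ∧
      ∀ i < n, (K - 2) * shareLevel K n m w ≤ K ^ 2 * bundleSum w f m i := fun h =>
    exists_bundles_of_attainable (by omega) hn hw h (attainable_shareLevel h)
  generalize shareLevel K n m w = T at hT0 hex ⊢
  -- At level zero every weight would be full, so the rule gives everything to the last position,
  -- and all claims about lower positions are trivial.
  rcases hT0.eq_or_lt with rfl | hT
  · have hz : ∀ p < n - 1, bundleSum w (slotAt K 0 n m w) m p = 0 := fun p hp =>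
      sum_eq_zero fun h hh => by
        have := (mem_filter.1 hh).2
        rw [slotAt_zero] at this
        omega
    refine ⟨fun p _ => ?_, fun p q hpq hq => ?_, fun f _ _ i _ hr => ?_⟩
    · have := bundleSum_nonneg hw (slotAt K 0 n m w) m p
      rw [mul_zero]
      positivity
    · rcases hpq.eq_or_lt with rfl | hpq
      · rfl
      · rw [hz p (by omega)]
        exact bundleSum_nonneg hw _ _ _
    · rw [hz _ hr]
      exact bundleSum_nonneg hw _ _ _
  · set θ : ℝ := (K - 2) * T / (2 * K ^ 2) with hθ'
    have hθ : 0 < θ := by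
      have : (0 : ℝ) < K - 2 := by linarith
      positivity
    have hF : ∀ x, Full K T x ↔ θ ≤ x := full_iff (by omega) T
    have h2θ : ∀ x : ℝ, (K - 2) * T ≤ K ^ 2 * x ↔ 2 * θ ≤ x := fun x => by
      rw [hθ', ← mul_div_assoc, mul_div_mul_left _ _ two_ne_zero, div_le_iff₀ hK0, mul_comm x]
    have h1θ : ∀ x : ℝ, (K - 2) * T ≤ 2 * K ^ 2 * x ↔ θ ≤ x := fun x => by
      rw [hθ', div_le_iff₀ (by positivity), mul_comm x]
    -- Attainability yields `n` bundles of weight at least `2 * θ`, and the counting argument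
    -- converts them into `n` full bundles of the rule.
    have hV : n ≤ #(fullBags K T m w) := by
      obtain ⟨f, hf, hfb⟩ := hex hT
      have h1 := card_le_of_bundles (P := fun _ => True) (I := range n) hθ hF hw
        (fun i hi => (h2θ _).1 (hfb i (mem_range.1 hi))) fun _ _ _ _ => trivial
      have h2 := le_card_fullBags (m := m) (P := fun _ => True) hθ hF hw fun _ _ => trivial
      rw [card_range] at h1
      exact h1.trans (h2.trans (card_filter_le _ _))
    have hbag := fun p (hp : p < n) => exists_bags_of_slotAt hT.ne' hw hV hp
    refine ⟨fun p hp => ?_, fun p q hpq hq => ?_, fun f hf hfb i hi hr => ?_⟩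
    · obtain ⟨k, hk, -, hle, -⟩ := hbag p hp
      exact (h1θ _).2 (((hF _).1 (mem_filter.1 hk).2).trans hle)
    · rcases hpq.eq_or_lt with rfl | hlt
      · rfl
      obtain ⟨k, hk, hrk, -, heq⟩ := hbag p (by omega)
      obtain ⟨l, hl, hrl, hle, -⟩ := hbag q hq
      rw [heq (by omega)]
      exact (key_le_of_rankIn_le hl (by omega)).trans hle
    · by_contra hc
      push Not at hc
      set p := rankIn (bundleSum w f m) (range n) i with hp
      have hi2 : 2 * θ ≤ bundleSum w f m i := (h2θ _).1 (hfb i hi)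
      obtain ⟨k, hk, hrk, -, heq⟩ := hbag p (by omega)
      rw [heq hr] at hc
      set x := bagWeight K T m w k with hx
      -- The agent of rank `p` and her predecessors are `p + 1` agents with bundles lighter than
      -- `x`. Counting gives `p + 1` full bundles lighter than `x`, although `x` has rank `p`.
      set I := insert i ((range n).filter fun j => bundleSum w f m j < bundleSum w f m i ∨
        bundleSum w f m j = bundleSum w f m i ∧ j < i) with hI
      have hcI : #I = p + 1 := by
        rw [hI, card_insert_of_notMem (by simp), hp, rankIn]
      have hIle : ∀ j ∈ I, j < n ∧ bundleSum w f m j ≤ bundleSum w f m i := by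
        intro j hj
        rcases mem_insert.1 hj with rfl | hj
        · exact ⟨hi, le_rfl⟩
        · obtain ⟨hj, hj'⟩ := mem_filter.1 hj
          exact ⟨mem_range.1 hj, hj'.elim le_of_lt fun h => h.1.le⟩
      have h1 := card_le_of_bundles (P := fun y => y < x) (I := I) (f := f) (m := m) hθ hF hw
        (fun j hj => (h2θ _).1 (hfb j (hIle j hj).1)) fun h hh hfI _ =>
          lt_of_le_of_lt ((le_bundleSum hw f hh).trans (hIle _ hfI).2) hc
      have h2 := le_card_fullBags (m := m) (P := fun y => y < x) hθ hF hw
        fun y hy => by linarith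
      have h3 : #{l ∈ fullBags K T m w | bagWeight K T m w l < x} ≤ p := by
        rw [← hrk, rankIn]
        exact card_le_card fun l hl =>
          mem_filter.2 ⟨(mem_filter.1 hl).1, Or.inl (mem_filter.1 hl).2⟩
      omega

end Slots

end FairAuction

namespace FairAuction

open Finset

/-! ### Sorting the agents by their bids -/

/-- The extension of a tuple by zeros. -/
def extend {R : Type*} [Zero R] {k : ℕ} (x : Fin k → R) (i : ℕ) : R :=
  if h : i < k then x ⟨i, h⟩ else 0

@[simp]
theorem extend_val {R : Type*} [Zero R] {k : ℕ} (x : Fin k → R) (i : Fin k) :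
    extend x i = x i := by
  simp [extend]

theorem extend_comp {R R' : Type*} [AddCommMonoid R] [AddCommMonoid R'] (φ : R →+ R') {k : ℕ}
    (x : Fin k → R) : (extend fun i => φ (x i)) = fun i => φ (extend x i) := by
  ext i
  unfold extend
  split_ifs <;> simp

theorem coe_strictMono : StrictMono NNReal.toRealHom.toAddMonoidHom := fun _ _ h =>
  NNReal.coe_lt_coe.2 h

section Position

variable {R : Type*} [AddCommMonoid R] [LinearOrder R] {n : ℕ}

/-- The position of each agent if the agents are sorted by their bids. -/
noncomputable def position (b : Fin n → R) : Equiv.Perm (Fin n) :=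
  Equiv.ofBijective (fun i => ⟨rankIn (extend b) (range n) i, by
    simpa using rankIn_lt_card (key := extend b) (V := range n) (mem_range.2 i.2)⟩)
    (Finite.injective_iff_bijective.1 fun i j h => Fin.ext <|
      rankIn_injOn (key := extend b) (mem_coe.2 (mem_range.2 i.2)) (mem_coe.2 (mem_range.2 j.2))
        (Fin.mk.inj_iff.1 h))

theorem position_val (b : Fin n → R) (i : Fin n) :
    (position b i : ℕ) = rankIn (extend b) (range n) i := rfl

theorem le_of_position_le {b : Fin n → R} {i j : Fin n} (h : position b i ≤ position b j) :
    b i ≤ b j := by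
  rw [← extend_val b i, ← extend_val b j]
  exact key_le_of_rankIn_le (mem_range.2 j.2) h

end Position

/-- The rearrangement inequality. -/
theorem sum_mul_le_sum_mul_position {n : ℕ} {Z : Fin n → ℝ} (hZ : Monotone Z) (b : Fin n → ℝ)
    (σ : Equiv.Perm (Fin n)) : ∑ i, b i * Z (σ i) ≤ ∑ i, b i * Z (position b i) := by
  have hm : Monovary b fun i => Z (position b i) := fun i j h =>
    le_of_position_le (le_of_not_gt fun hc => absurd (hZ hc.le) (not_le.2 h))
  simpa using hm.sum_mul_comp_perm_le_sum_mul (σ := σ.trans (position b).symm)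

/-! ### The mechanism -/

section Mechanism

variable (K : ℕ) {n m : ℕ}

/-- The weight that the agent at position `p` receives. -/
noncomputable def slotWeight (w : Fin m → ℝ≥0) (p : Fin n) : ℝ≥0 :=
  bundleSum (extend w) (slot K n m (extend w)) m p

/-- The welfare that the allocation rule achieves. -/
noncomputable def sortedWelfare (w : Fin m → ℝ≥0) (b : Fin n → ℝ≥0) : ℝ≥0 :=
  ∑ i, b i * slotWeight K w (position b i)

/-- The mechanism: a fixed partition of the goods, whose bundles are assigned in the order of the
bids, with Clarke payments. -/
noncomputable def fairMechanism : Mechanism where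
  alloc {n m} _ w b g := (position b).symm ⟨slot K n m (extend w) g,
    slot_lt K m (extend w) (NeZero.pos n) g⟩
  pay w b i := sortedWelfare K w (Function.update b i 0) -
    ∑ j ∈ univ.erase i, b j * slotWeight K w (position b j)

theorem weight_eq_bundleSum (w : Fin m → ℝ≥0) {A : Allocation n m} {f : ℕ → ℕ}
    (hf : ∀ g : Fin m, f g = A g) (i : Fin n) :
    weight w (A.bundle i) = bundleSum (extend w) f m i := by
  rw [bundleSum_eq_sum_ite,
    ← Fin.sum_univ_eq_sum_range (fun h => if f h = i then extend w h else 0),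
    weight, Allocation.bundle, sum_filter]
  refine sum_congr rfl fun g _ => ?_
  simp [hf, Fin.ext_iff]

theorem weight_fairMechanism [NeZero n] (w : Fin m → ℝ≥0) (b : Fin n → ℝ≥0) (i : Fin n) :
    weight w (((fairMechanism K).alloc w b).bundle i) = slotWeight K w (position b i) := by
  rw [weight, Allocation.bundle, sum_filter, slotWeight, bundleSum_eq_sum_ite,
    ← Fin.sum_univ_eq_sum_range (fun h => if slot K n m (extend w) h = position b i then
      extend w h else 0)]
  refine sum_congr rfl fun g _ => ?_
  simp only [fairMechanism, Equiv.symm_apply_eq, Fin.ext_iff, extend_val]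

variable {K} in
theorem coe_slotWeight (w : Fin m → ℝ≥0) (p : Fin n) : (slotWeight K w p : ℝ) =
    bundleSum (fun h => ((extend w h : ℝ≥0) : ℝ))
      (slot K n m fun h => ((extend w h : ℝ≥0) : ℝ)) m p := by
  have h := slot_map (φ := NNReal.toRealHom.toAddMonoidHom) coe_strictMono K n m (extend w)
  have h2 := map_bundleSum NNReal.toRealHom.toAddMonoidHom (extend w)
    (slot K n m (extend w)) m p
  rw [← h] at h2
  simp only [slotWeight, ← h]
  exact h2.symm

theorem slotWeight_monotone (hK : 3 ≤ K) (w : Fin m → ℝ≥0) :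
    Monotone (slotWeight K w : Fin n → ℝ≥0) := by
  intro p q hpq
  rw [← NNReal.coe_le_coe, coe_slotWeight, coe_slotWeight]
  exact (slot_spec hK (Nat.zero_lt_of_lt p.2) fun h => NNReal.coe_nonneg _).2.1 p q hpq q.2

variable {K}

/-- The rule is maximal in its range: the bundle weights increase with the position and do not
depend on the bids, so sorting by bids is the best arrangement. -/
theorem sum_mul_slotWeight_le (hK : 3 ≤ K) (w : Fin m → ℝ≥0) (b : Fin n → ℝ≥0)
    (σ : Equiv.Perm (Fin n)) : ∑ i, b i * slotWeight K w (σ i) ≤ sortedWelfare K w b := by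
  have h := sum_mul_le_sum_mul_position (Z := fun p => (slotWeight K w p : ℝ))
    (fun p q hpq => NNReal.coe_le_coe.2 (slotWeight_monotone K hK w hpq)) (fun i => (b i : ℝ)) σ
  have hp : position (fun i => (b i : ℝ)) = position b := by
    ext i
    have := extend_comp NNReal.toRealHom.toAddMonoidHom b
    rw [position_val, position_val, ← rankIn_map (φ := NNReal.toRealHom.toAddMonoidHom)
      coe_strictMono (extend b), ← this]
    rfl
  rw [hp] at h
  rw [← NNReal.coe_le_coe, sortedWelfare]
  push_cast
  exact h

/-- With the bid of `i` set to zero, the old arrangement still yields this welfare. Hence the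
truncated subtraction in the Clarke payment is a genuine one. -/
theorem sum_erase_le (hK : 3 ≤ K) (w : Fin m → ℝ≥0) (b : Fin n → ℝ≥0) (i : Fin n) :
    ∑ j ∈ univ.erase i, b j * slotWeight K w (position b j) ≤
      sortedWelfare K w (Function.update b i 0) := by
  refine le_trans ?_ (sum_mul_slotWeight_le hK w _ (position b))
  rw [← add_sum_erase _ _ (mem_univ i), Function.update_self, zero_mul, zero_add]
  exact (sum_congr rfl fun j hj => by
    rw [Function.update_of_ne (ne_of_mem_erase hj)]).le

/-- The utility is the welfare under the true parameter, minus a term that does not depend on the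
bid. -/
theorem utility_fairMechanism [NeZero n] (hK : 3 ≤ K) (w : Fin m → ℝ≥0) (b : Fin n → ℝ≥0)
    (i : Fin n) (x : ℝ≥0) : (fairMechanism K).utility w b i x =
      ((∑ j, Function.update b i x j * slotWeight K w (position b j) : ℝ≥0) : ℝ) -
        sortedWelfare K w (Function.update b i 0) := by
  rw [Mechanism.utility, weight_fairMechanism]
  have h1 : (fairMechanism K).pay w b i = sortedWelfare K w (Function.update b i 0) -
    ∑ j ∈ univ.erase i, b j * slotWeight K w (position b j) := rfl
  have h2 : ∑ j, Function.update b i x j * slotWeight K w (position b j) =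
      x * slotWeight K w (position b i) +
        ∑ j ∈ univ.erase i, b j * slotWeight K w (position b j) := by
    rw [← add_sum_erase _ _ (mem_univ i), Function.update_self]
    congr 1
    exact sum_congr rfl fun j hj => by rw [Function.update_of_ne (ne_of_mem_erase hj)]
  rw [h1, h2, NNReal.coe_sub (sum_erase_le hK w b i)]
  push_cast
  ring

/-- A bid influences the utility only through the arrangement it selects, and the truthful bid
selects the arrangement of largest true welfare. -/
theorem fairMechanism_isDSIC (hK : 3 ≤ K) : (fairMechanism K).IsDSIC := by
  intro n m _ w b i x
  have h : (fairMechanism K).utility w (Function.update b i x) i x =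
      (sortedWelfare K w (Function.update b i x) : ℝ) -
        sortedWelfare K w (Function.update b i 0) := by
    rw [utility_fairMechanism hK, Function.update_idem, Function.update_idem]
    rfl
  rw [h]
  constructor
  · rw [utility_fairMechanism hK]
    exact sub_le_sub_right (NNReal.coe_le_coe.2 (sum_mul_slotWeight_le hK w _ _)) _
  · rw [sub_nonneg, NNReal.coe_le_coe]
    -- Individual rationality: compare with the arrangement chosen for bid zero, whose welfare can
    -- only grow with the parameter of `i`.
    refine le_trans ?_ (sum_mul_slotWeight_le hK w (Function.update b i x)
      (position (Function.update b i 0)))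
    refine sum_le_sum fun j _ => mul_le_mul_left ?_ _
    rcases eq_or_ne j i with rfl | hne
    · simp
    · rw [Function.update_of_ne hne, Function.update_of_ne hne]

end Mechanism

/-! ### Fairness and efficiency -/

section Guarantees

variable {K n m : ℕ} [NeZero n]

theorem le_maximinShare (w : Fin m → ℝ≥0) {f : ℕ → ℕ} (hf : ∀ h < m, f h < n) {x : ℝ≥0}
    (hx : ∀ i < n, x ≤ bundleSum (extend w) f m i) : x ≤ maximinShare n w := by
  refine le_trans ?_ (le_sup' _ (mem_univ fun g : Fin m => (⟨f g, hf g g.2⟩ : Fin n)))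
  refine le_inf' _ _ fun i _ => ?_
  rw [weight_eq_bundleSum w (f := f) fun g => rfl]
  exact hx i i.2

theorem exists_maximinShare (n : ℕ) [NeZero n] (w : Fin m → ℝ≥0) : ∃ f : ℕ → ℕ, (∀ h < m, f h < n) ∧
    (∀ i < n, maximinShare n w ≤ bundleSum (extend w) f m i) ∧
      ∃ i₀, bundleSum (extend w) f m i₀ = maximinShare n w := by
  obtain ⟨P, -, hP⟩ := exists_mem_eq_sup' (univ_nonempty (α := Allocation n m))
    fun P => (univ : Finset (Fin n)).inf' univ_nonempty fun j => weight w (P.bundle j)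
  obtain ⟨i₀, -, hi₀⟩ := exists_mem_eq_inf' (univ_nonempty (α := Fin n))
    fun j => weight w (P.bundle j)
  have h : maximinShare n w = weight w (P.bundle i₀) := hP.trans hi₀
  have hf : ∀ g : Fin m, extend (fun g => (P g : ℕ)) g = P g := fun g => by simp
  refine ⟨extend fun g => (P g : ℕ), fun h hh => ?_, fun i hi => ?_, i₀, ?_⟩
  · rw [hf ⟨h, hh⟩]
    exact (P ⟨h, hh⟩).2
  · rw [← weight_eq_bundleSum w hf ⟨i, hi⟩, h, ← hi₀]
    exact inf'_le _ (mem_univ _)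
  · rw [← weight_eq_bundleSum w hf i₀, h]

/-- Each position gets at least `(K - 2) * T / (2 * K ^ 2)` with `T ≥ (K - 1) * μ`, and `(K - 1) *
(K - 2) ≥ K ^ 2 - 3 * K`; the loss relative to one half is thus at most `3 / (2 * K)`. -/
theorem fairMechanism_isApproxMMS (hK : 3 ≤ K) {ε : ℝ} (hε : 3 / (2 * K) ≤ ε)
    (w : Fin m → ℝ≥0) (b : Fin n → ℝ≥0) :
    IsApproxMMS (1 / 2 - ε) w ((fairMechanism K).alloc w b) := by
  intro i
  have hK' : (3 : ℝ) ≤ K := by exact_mod_cast hK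
  rw [weight_fairMechanism, coe_slotWeight]
  have hw : ∀ h, 0 ≤ ((extend w h : ℝ≥0) : ℝ) := fun h => NNReal.coe_nonneg _
  obtain ⟨f, hf, hfμ, i₀, hi₀⟩ := exists_maximinShare n w
  have hcoe := fun j => map_bundleSum NNReal.toRealHom.toAddMonoidHom (extend w) f m j
  have h1 := le_shareLevel (K := K) (by omega) hw hf (μ := maximinShare n w)
    (fun j hj => (NNReal.coe_le_coe.2 (hfμ j hj)).trans_eq (hcoe j).symm) (i₀ := i₀)
    ((hcoe i₀).trans (congrArg NNReal.toReal hi₀))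
  have h2 := (slot_spec (m := m) hK (NeZero.pos n) hw).1 _ (position b i).2
  set μ := (maximinShare n w : ℝ)
  set Z : ℝ := bundleSum (fun h => ((extend w h : ℝ≥0) : ℝ))
    (slot K n m fun h => ((extend w h : ℝ≥0) : ℝ)) m
    (position b i)
  have hμ : 0 ≤ μ := NNReal.coe_nonneg _
  have h3 : (K - 2) * ((K - 1) * μ) ≤ 2 * K ^ 2 * Z :=
    (mul_le_mul_of_nonneg_left h1 (by linarith)).trans h2
  have h4 : 3 * K ≤ 2 * K ^ 2 * ε := by
    rw [div_le_iff₀ (by positivity)] at hε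
    nlinarith
  have h5 : (2 * K ^ 2) * ((1 / 2 - ε) * μ) ≤ 2 * K ^ 2 * Z := by nlinarith
  exact le_of_mul_le_mul_left h5 (by positivity)

theorem sum_slotWeight (w : Fin m → ℝ≥0) : ∑ p : Fin n, slotWeight K w p = ∑ g, w g := by
  have h := sum_range_bundleSum (extend w) (f := slot K n m (extend w)) (n := n) (m := m)
    fun h _ => slot_lt K m _ (NeZero.pos n) h
  rw [← Fin.sum_univ_eq_sum_range, ← Fin.sum_univ_eq_sum_range] at h
  simpa [slotWeight] using h

theorem socialWelfare_le_sortedWelfare (hK : 3 ≤ K) (w : Fin m → ℝ≥0) (v : Fin n → ℝ≥0)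
    {A : Allocation n m} (hA : IsMMS w A) : socialWelfare w v A ≤ sortedWelfare K w v := by
  have hw : ∀ h, 0 ≤ ((extend w h : ℝ≥0) : ℝ) := fun h => NNReal.coe_nonneg _
  have hn := NeZero.pos n
  set f : ℕ → ℕ := extend fun g => (A g : ℕ) with hf
  have hfA : ∀ g : Fin m, f g = A g := fun g => by simp [hf]
  have hfn : ∀ h < m, f h < n := fun h hh => by
    rw [hfA ⟨h, hh⟩]
    exact (A ⟨h, hh⟩).2
  set U : Fin n → ℝ := fun i => weight w (A.bundle i) with hU
  have hUf : ∀ i : Fin n, U i = bundleSum (fun h => ((extend w h : ℝ≥0) : ℝ)) f m i := fun i =>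
    (congrArg NNReal.toReal (weight_eq_bundleSum w hfA i)).trans
      (map_bundleSum NNReal.toRealHom.toAddMonoidHom (extend w) f m i).symm
  have hpos : ∀ i : Fin n, (position U i : ℕ) =
      rankIn (bundleSum (fun h => ((extend w h : ℝ≥0) : ℝ)) f m) (range n) i := fun i => by
    rw [position_val, rankIn, rankIn]
    congr 1
    refine filter_congr fun j hj => ?_
    rw [extend_val, hUf, show extend U j = _ from (extend_val U ⟨j, mem_range.1 hj⟩).trans (hUf _)]
  -- The only use of the MMS property: an attainable level yields a partition with bundles of weight
  -- `x`, so `x` is at most the maximin share.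
  have hshare : ∀ i < n, (K - 2) * shareLevel K n m (fun h => ((extend w h : ℝ≥0) : ℝ)) ≤
      K ^ 2 * bundleSum (fun h => ((extend w h : ℝ≥0) : ℝ)) f m i := by
    intro i hi
    have hK0 : (0 : ℝ) < K ^ 2 := by positivity
    have hK3 : (3 : ℝ) ≤ K := by exact_mod_cast hK
    rcases (shareLevel_nonneg K n m fun h => ((extend w h : ℝ≥0) : ℝ)).eq_or_lt with h0 | h0
    · rw [← h0, mul_zero]
      have := bundleSum_nonneg hw f m i
      positivity
    · obtain ⟨f', hf', hb⟩ := exists_bundles_of_attainable (by omega) hn hw h0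
        (attainable_shareLevel h0)
      set x : ℝ := (K - 2) * shareLevel K n m (fun h => ((extend w h : ℝ≥0) : ℝ)) / K ^ 2 with hx
      have hle : x.toNNReal ≤ maximinShare n w := by
        refine le_maximinShare w hf' fun j hj => Real.toNNReal_le_iff_le_coe.2 ?_
        refine le_trans ?_ (map_bundleSum NNReal.toRealHom.toAddMonoidHom (extend w) f' m j).le
        rw [hx, div_le_iff₀ hK0, mul_comm _ ((K : ℝ) ^ 2)]
        exact hb j hj
      have h2 : x ≤ U ⟨i, hi⟩ := Real.toNNReal_le_iff_le_coe.1 (hle.trans (hA ⟨i, hi⟩))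
      rw [hUf, hx, div_le_iff₀ hK0, mul_comm _ ((K : ℝ) ^ 2)] at h2
      exact h2
  set Y : Fin n → ℝ := fun p => U ((position U).symm p) with hY
  have hYmono : Monotone Y := fun p q hpq => le_of_position_le (b := U) (by simpa using hpq)
  have hZY : ∀ p : Fin n, (p : ℕ) < n - 1 → (slotWeight K w p : ℝ) ≤ Y p := by
    intro p hp
    have h := (slot_spec hK hn hw).2.2 f hfn hshare ((position U).symm p) (Fin.is_lt _)
    rw [← hpos, ← hUf, Equiv.apply_symm_apply] at h
    rw [coe_slotWeight]
    exact h hp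
  -- Both allocations distribute all goods.
  have hsum : ∑ p : Fin n, ((slotWeight K w p : ℝ≥0) : ℝ) = ∑ p, Y p := by
    have h1 : ∑ p, Y p = ∑ i, U i := Equiv.sum_comp (position U).symm U
    have h2 := congrArg NNReal.toReal (sum_slotWeight (K := K) (n := n) w)
    have h3 : ∑ i, weight w (A.bundle i) = ∑ g, w g := by
      simp only [weight, Allocation.bundle]
      exact sum_fiberwise_of_maps_to (fun g _ => mem_univ (A g)) w
    have h4 := congrArg NNReal.toReal h3
    push_cast at h2 h4
    rw [h1, h2, ← h4]
  set q : Equiv.Perm (Fin n) := position fun i => (v i : ℝ) with hq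
  have h1 : ∑ i, (v i : ℝ) * U i ≤ ∑ i, (v i : ℝ) * Y (q i) := by
    have := sum_mul_le_sum_mul_position hYmono (fun i => (v i : ℝ)) (position U)
    simpa [hY] using this
  have h2 : ∑ i, (v i : ℝ) * Y (q i) ≤ ∑ i, (v i : ℝ) * slotWeight K w (q i) := by
    set top : Fin n := ⟨n - 1, by omega⟩ with htop
    set V := (v (q.symm top) : ℝ) with hV
    -- Below the top both factors are nonnegative, and at the top the first vanishes. Since the
    -- totals agree, the terms with `V` cancel in the sum.
    have hterm : ∀ i, 0 ≤ (V - v i) * (Y (q i) - slotWeight K w (q i)) := by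
      intro i
      rcases lt_or_ge (q i : ℕ) (n - 1) with h | h
      · refine mul_nonneg (sub_nonneg.2 ?_) (sub_nonneg.2 (hZY _ h))
        refine le_of_position_le (b := fun i => (v i : ℝ)) ?_
        rw [← hq, Equiv.apply_symm_apply]
        exact h.le
      · have : q i = top := Fin.ext (by have := (q i).2; simp only [htop]; omega)
        rw [hV, ← this, Equiv.symm_apply_apply, sub_self, zero_mul]
    have hs := sum_nonneg fun i (_ : i ∈ univ) => hterm i
    have hY' : ∑ i, Y (q i) = ∑ i, (slotWeight K w (q i) : ℝ) := by
      rw [Equiv.sum_comp q Y, Equiv.sum_comp q fun p => (slotWeight K w p : ℝ), hsum]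
    have : ∑ i, (V - v i) * (Y (q i) - slotWeight K w (q i)) =
        V * (∑ i, Y (q i) - ∑ i, (slotWeight K w (q i) : ℝ)) -
          (∑ i, (v i : ℝ) * Y (q i) - ∑ i, (v i : ℝ) * slotWeight K w (q i)) := by
      rw [← sum_sub_distrib, ← sum_sub_distrib, mul_sum, ← sum_sub_distrib]
      exact sum_congr rfl fun i _ => by ring
    rw [hY', sub_self, mul_zero] at this
    linarith
  have h3 := NNReal.coe_le_coe.2 (sum_mul_slotWeight_le hK w v q)
  push_cast at h3
  rw [← NNReal.coe_le_coe, socialWelfare]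
  push_cast
  exact h1.trans (h2.trans h3)

theorem optFAMMS_le_socialWelfare (hK : 3 ≤ K) (w : Fin m → ℝ≥0) (v : Fin n → ℝ≥0) :
    optFAMMS w v ≤ socialWelfare w v ((fairMechanism K).alloc w v) := by
  refine sup'_le _ _ fun A hA => ?_
  refine (socialWelfare_le_sortedWelfare hK w v
    (by classical simpa [feasible] using hA)).trans_eq ?_
  simp only [socialWelfare, weight_fairMechanism, sortedWelfare]

end Guarantees

end FairAuction

namespace FairAuction

open Finset

/-! ### A dynamic program for the distribution of the large goods -/

section DynamicProgram

/-- The code of a distribution: a number whose `l`-th digit in base `n + 1` is the number of agents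
at level `l`. -/
def levelCode (n : ℕ) (lev : ℕ → ℕ) : ℕ := ∑ i ∈ range n, (n + 1) ^ lev i

/-- A level holds at most `n` agents, so in base `n + 1` no carries occur and the digits are the
counts. -/
theorem digit_levelCode (n : ℕ) (lev : ℕ → ℕ) (l : ℕ) :
    levelCode n lev / (n + 1) ^ l % (n + 1) = #{i ∈ range n | lev i = l} := by
  set S := ∑ i ∈ range n with lev i < l, (n + 1) ^ lev i with hS
  set X := ∑ i ∈ range n with l < lev i, (n + 1) ^ (lev i - l - 1) with hX
  have hsplit : levelCode n lev =
      S + (n + 1) ^ l * (#{i ∈ range n | lev i = l} + (n + 1) * X) := by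
    rw [levelCode, hS, hX, mul_add, card_filter, mul_sum, mul_sum, mul_sum, sum_filter, sum_filter,
      ← sum_add_distrib, ← sum_add_distrib]
    refine sum_congr rfl fun i _ => ?_
    rcases lt_trichotomy (lev i) l with h | h | h
    · rw [if_pos h, if_neg h.ne, if_neg h.not_gt]
      simp
    · rw [if_neg (by omega), if_pos h, if_neg (by omega), h]
      simp
    · rw [if_neg (by omega), if_neg (by omega), if_pos h, ← pow_succ', ← pow_add]
      simp only [mul_zero, zero_add]
      congr 1
      omega
  have hlt : S < (n + 1) ^ l := by
    have h1 : S * (n + 1) ≤ n * (n + 1) ^ l := by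
      rw [hS, sum_mul]
      refine (sum_le_card_nsmul _ _ ((n + 1) ^ l) fun i hi => ?_).trans ?_
      · rw [← pow_succ]
        exact Nat.pow_le_pow_right (by omega) (mem_filter.1 hi).2
      · rw [smul_eq_mul]
        gcongr
        exact (card_filter_le _ _).trans_eq (card_range n)
    have h2 : S * (n + 1) < (n + 1) ^ l * (n + 1) := by
      have : 0 < (n + 1) ^ l := by positivity
      nlinarith
    exact lt_of_mul_lt_mul_right h2 (by omega)
  have hcard : #{i ∈ range n | lev i = l} < n + 1 :=
    Nat.lt_succ_of_le ((card_filter_le _ _).trans_eq (card_range n))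
  rw [hsplit, Nat.add_mul_div_left _ _ (by positivity), Nat.div_eq_of_lt hlt, zero_add,
    Nat.add_mul_mod_self_left, Nat.mod_eq_of_lt hcard]

theorem levelCode_lt {n Q : ℕ} {lev : ℕ → ℕ} (h : ∀ i, lev i ≤ Q) :
    levelCode n lev < (n + 1) ^ (Q + 1) := by
  calc levelCode n lev ≤ #(range n) • (n + 1) ^ Q :=
        sum_le_card_nsmul _ _ _ fun i _ => Nat.pow_le_pow_right (by omega) (h i)
    _ = n * (n + 1) ^ Q := by simp
    _ < (n + 1) * (n + 1) ^ Q := by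
        gcongr
        omega
    _ = _ := by ring

/-- `c` is the code of a distribution of the first `h` goods, with levels capped at `Q`. -/
def Reachable (n Q : ℕ) (s : ℕ → ℕ) (h c : ℕ) : Prop :=
  ∃ f : ℕ → ℕ, (∀ g < h, f g < n) ∧ levelCode n (fun i => min Q (bundleSum s f h i)) = c

variable {n Q : ℕ} {s : ℕ → ℕ}

theorem reachable_lt {h c : ℕ} (hc : Reachable n Q s h c) : c < (n + 1) ^ (Q + 1) := by
  obtain ⟨f, -, rfl⟩ := hc
  exact levelCode_lt fun i => min_le_left _ _

theorem reachable_zero {c : ℕ} : Reachable n Q s 0 c ↔ c = n := by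
  simp [Reachable, bundleSum, levelCode, eq_comm]

theorem levelCode_update {lev lev' : ℕ → ℕ} {i : ℕ} (hi : i < n)
    (h : ∀ j, j ≠ i → lev' j = lev j) :
    levelCode n lev' + (n + 1) ^ lev i = levelCode n lev + (n + 1) ^ lev' i := by
  rw [levelCode, levelCode, ← add_sum_erase _ _ (mem_range.2 hi),
    ← add_sum_erase (range n) (fun i => (n + 1) ^ lev i) (mem_range.2 hi),
    sum_congr rfl fun j hj => by rw [h j (ne_of_mem_erase hj)]]
  ring

/-- Good `h` lifts one agent from level `l` to `e`, which changes the code by `(n + 1) ^ e - (n + 1)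
^ l`. Agents at one level are interchangeable, so a nonzero digit `l` in the earlier code is all
that is needed; the inequality keeps the subtraction from truncating. -/
theorem reachable_succ {h c : ℕ} : Reachable n Q s (h + 1) c ↔
    ∃ l < Q + 1, ∃ e < Q + 1, e = min Q (l + s h) ∧ (n + 1) ^ e ≤ c + (n + 1) ^ l ∧
      0 < (c + (n + 1) ^ l - (n + 1) ^ e) / (n + 1) ^ l % (n + 1) ∧
      Reachable n Q s h (c + (n + 1) ^ l - (n + 1) ^ e) := by
  constructor
  · rintro ⟨f, hf, rfl⟩
    set lev := fun i => min Q (bundleSum s f h i) with hlev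
    have hup := levelCode_update (lev := lev)
      (lev' := fun i => min Q (bundleSum s f (h + 1) i)) (hf h (by omega)) fun j hj => by
        simp only [hlev, bundleSum_succ, if_neg hj.symm, add_zero]
    have he : min Q (bundleSum s f (h + 1) (f h)) = min Q (lev (f h) + s h) := by
      simp only [hlev, bundleSum_succ, if_true]
      omega
    rw [he] at hup
    refine ⟨lev (f h), Nat.lt_succ_of_le (min_le_left _ _), _,
      Nat.lt_succ_of_le (min_le_left _ _), rfl, by omega, ?_⟩
    rw [hup, Nat.add_sub_cancel, digit_levelCode]
    exact ⟨card_pos.2 ⟨f h, mem_filter.2 ⟨mem_range.2 (hf h (by omega)), rfl⟩⟩,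
      f, fun g hg => hf g (by omega), rfl⟩
  · rintro ⟨l, -, e, -, he, hle, hd, f, hf, hc⟩
    rw [← hc, digit_levelCode] at hd
    obtain ⟨i, hi⟩ := card_pos.1 hd
    obtain ⟨hin, hil⟩ := mem_filter.1 hi
    have hin := mem_range.1 hin
    have hfu : ∀ g < h, Function.update f h i g = f g := fun g hg =>
      Function.update_of_ne (by omega) _ _
    have hb : ∀ j, bundleSum s (Function.update f h i) h j = bundleSum s f h j := fun j =>
      bundleSum_congr (fun _ _ => rfl) hfu
    refine ⟨Function.update f h i, fun g hg => ?_, ?_⟩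
    · rcases eq_or_ne g h with rfl | hne
      · rw [Function.update_self]
        exact hin
      · rw [Function.update_of_ne hne]
        exact hf g (by omega)
    · have hup := levelCode_update (lev := fun i => min Q (bundleSum s f h i))
        (lev' := fun j => min Q (bundleSum s (Function.update f h i) (h + 1) j))
        hin fun j hj => by
          simp only [bundleSum_succ, hb, Function.update_self, if_neg hj.symm, add_zero]
      have h1 : min Q (bundleSum s (Function.update f h i) (h + 1) i) = e := by
        rw [bundleSum_succ, hb, Function.update_self, if_pos rfl, he]
        omega
      rw [h1, hil, hc] at hup
      omega

/-- The deficit of a distribution, in terms of its code. -/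
theorem deficit_eq {m : ℕ} (f : ℕ → ℕ) : deficit n m Q s f =
    ∑ l ∈ range Q, levelCode n (fun i => min Q (bundleSum s f m i)) / (n + 1) ^ l % (n + 1) *
      (Q - l) := by
  simp only [digit_levelCode, card_filter, sum_mul]
  rw [sum_comm, deficit]
  refine sum_congr rfl fun i _ => ?_
  simp only [ite_mul, one_mul, zero_mul]
  rw [sum_ite_eq]
  simp only [mem_range]
  split_ifs <;> omega

/-- Capping levels at `Q` does not affect deficits, so the code determines the deficit. For fixed
`Q` the number of codes is polynomial in `n`. -/
theorem exists_deficit_iff {m : ℕ} {P : ℕ → Prop} :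
    (∃ f : ℕ → ℕ, (∀ h < m, f h < n) ∧ P (deficit n m Q s f)) ↔
      ∃ c < (n + 1) ^ (Q + 1), Reachable n Q s m c ∧
        P (∑ l ∈ range Q, c / (n + 1) ^ l % (n + 1) * (Q - l)) := by
  constructor
  · rintro ⟨f, hf, hP⟩
    rw [deficit_eq] at hP
    have hr : Reachable n Q s m _ := ⟨f, hf, rfl⟩
    exact ⟨_, reachable_lt hr, hr, hP⟩
  · rintro ⟨c, -, ⟨f, hf, rfl⟩, hP⟩
    exact ⟨f, hf, by rwa [deficit_eq]⟩

end DynamicProgram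

end FairAuction

/-! ### The dynamic program in polynomial time. -/

namespace RAM

variable {C : Ctx}

/-- For a fixed bound the search unrolls into finitely many programs, so no uniformity in `i` is
required; in particular `i` may occur as an exponent. -/
theorem Dec.exists_const {P : C.γ → ℕ → Prop} (N : ℕ) (h : ∀ i, Dec C fun c => P c i) :
    Dec C fun c => ∃ i < N, P c i := by
  induction N with
  | zero => exact ⟨_, Comp.const 0, fun c => by simp⟩
  | succ N ih =>
    exact (ih.or (h N)).congr fun c => by
      simp only [Nat.lt_succ_iff_lt_or_eq, or_and_right, exists_or, exists_eq_left]

theorem Comp.sumConst {f : C.γ → ℕ → ℕ} (N : ℕ) (h : ∀ i, Comp C fun c => f c i) :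
    Comp C fun c => ∑ i ∈ Finset.range N, f c i := by
  induction N with
  | zero => exact (Comp.const 0).congr fun c => by simp
  | succ N ih => exact (ih.add (h N)).congr fun c => by rw [Finset.sum_range_succ]

theorem Comp.natMin {f g : C.γ → ℕ} (hf : Comp C f) (hg : Comp C g) :
    Comp C fun c => min (f c) (g c) :=
  (hf.sub (hf.sub hg)).congr fun c => by omega

theorem Comp.natMax {f g : C.γ → ℕ} (hf : Comp C f) (hg : Comp C g) :
    Comp C fun c => max (f c) (g c) :=
  (hf.add (hg.sub hf)).congr fun c => by omega

open FairAuction in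
-- The reachability table is a flat list with rows of length `D`: entry `h * D + x` is nonzero
-- exactly when code `x` is reachable after `h` goods.
theorem Dec.exists_deficit {n m t X : C.γ → ℕ} {s : C.γ → ℕ → ℕ} (Q : ℕ) (hn : Comp C n)
    (hnb : PolyBdd C.S n) (hm : Comp C m) (hmb : PolyBdd C.S m)
    (hs : Comp C.nat fun c => s c.1 c.2) (ht : Comp C t) (hX : Comp C X) :
    Dec C fun c => ∃ f : ℕ → ℕ, (∀ h < m c, f h < n c) ∧
      deficit (n c) (m c) Q (s c) f * t c ≤ X c := by
  classical
  set D : C.γ → ℕ := fun c => (n c + 1) ^ (Q + 1) with hD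
  have hDC : Comp C D := (hn.add (.const 1)).pow _
  have hDb : PolyBdd C.S D := (hnb.add (.const 1)).pow _
  set prev : C.list.γ → ℕ → ℕ → ℕ := fun c l e =>
    c.2.length % D c.1 + (n c.1 + 1) ^ l - (n c.1 + 1) ^ e with hprev
  have hB : Comp C.list fun c => n c.1 + 1 := (hn.add (.const 1)).weakenList
  have hj := Comp.length (C := C)
  have hDL : Comp C.list fun c => D c.1 := hDC.weakenList
  have hcode := hj.mod hDL
  have hprevC : ∀ l e, Comp C.list fun c => prev c l e := fun l e =>
    (hcode.add (hB.pow l)).sub (hB.pow e)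
  have hidx := (hj.div hDL).sub (.const 1)
  have hsL : Comp C.list fun c => s c.1 (c.2.length / D c.1 - 1) :=
    Comp.subst (f := fun c : C.list.nat.γ => s c.1.1 c.2) hidx (hs.weaken (Weak.list C).mapNat)
  -- The length of the list locates the current entry: quotient and remainder by `D` are the row and
  -- the code. The bound `prev < D` keeps the lookup inside the preceding row.
  set cond : C.list.γ → Prop := fun c => if c.2.length / D c.1 = 0 then
      c.2.length % D c.1 = n c.1 else
      ∃ l < Q + 1, ∃ e < Q + 1, e = min Q (l + s c.1 (c.2.length / D c.1 - 1)) ∧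
        (n c.1 + 1) ^ e ≤ c.2.length % D c.1 + (n c.1 + 1) ^ l ∧
        0 < prev c l e / (n c.1 + 1) ^ l % (n c.1 + 1) ∧ prev c l e < D c.1 ∧
        c.2.getD ((c.2.length / D c.1 - 1) * D c.1 + prev c l e) 0 ≠ 0 with hcond
  have hcondC : Dec C.list cond := by
    have h1 : Dec C.list fun c => c.2.length / D c.1 = 0 := .eq (hj.div hDL) (.const 0)
    have h2 : Dec C.list fun c => c.2.length % D c.1 = n c.1 := .eq hcode hn.weakenList
    have h3 : Dec C.list fun c =>
        ∃ l < Q + 1, ∃ e < Q + 1, e = min Q (l + s c.1 (c.2.length / D c.1 - 1)) ∧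
        (n c.1 + 1) ^ e ≤ c.2.length % D c.1 + (n c.1 + 1) ^ l ∧
        0 < prev c l e / (n c.1 + 1) ^ l % (n c.1 + 1) ∧ prev c l e < D c.1 ∧
        c.2.getD ((c.2.length / D c.1 - 1) * D c.1 + prev c l e) 0 ≠ 0 :=
      .exists_const _ fun l => .exists_const _ fun e =>
        (Dec.eq (.const e) (Comp.natMin (.const Q) ((Comp.const l).add hsL))).and <|
        (Dec.le (hB.pow e) (hcode.add (hB.pow l))).and <|
        (Dec.lt (.const 0) (((hprevC l e).div (hB.pow l)).mod hB)).and <|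
        (Dec.lt (hprevC l e) hDL).and <|
        (Dec.eq (Comp.get (Weak.refl _) ((hidx.mul hDL).add (hprevC l e))) (.const 0)).not
    refine ((h1.and h2).or (h1.not.and h3)).congr fun c => ?_
    simp only [hcond]
    split_ifs with h <;> simp [h]
  set step : C.list.γ → ℕ := fun c => if cond c then 1 else 0 with hstep
  have hstepC : Comp C.list step := hcondC.ind
  have hD0 : ∀ c, 0 < D c := fun c => by positivity
  have hval : ∀ c h N x, x < D c → h * D c + x < N →
      ((memo step c N).getD (h * D c + x) 0 ≠ 0 ↔ Reachable (n c) Q (s c) h x) := by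
    intro c h
    induction h with
    | zero =>
      intro N x hx hN
      rw [memo_getD _ _ hN, reachable_zero]
      have h1 : (memo step c (0 * D c + x)).length = x := by simp
      simp only [hstep, hcond]
      rw [← hstep]
      simp only [h1, Nat.div_eq_of_lt hx, Nat.mod_eq_of_lt hx, if_true]
      split_ifs <;> simp [*]
    | succ h ih =>
      intro N x hx hN
      have h1 : (memo step c ((h + 1) * D c + x)).length = (h + 1) * D c + x := by simp
      have h2 : ((h + 1) * D c + x) / D c = h + 1 := by
        rw [mul_comm, Nat.mul_add_div (hD0 c), Nat.div_eq_of_lt hx, add_zero]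
      have h3 : ((h + 1) * D c + x) % D c = x := by
        rw [mul_comm, Nat.mul_add_mod, Nat.mod_eq_of_lt hx]
      rw [memo_getD _ _ hN, reachable_succ]
      have h4 : step (c, memo step c ((h + 1) * D c + x)) ≠ 0 ↔
          cond (c, memo step c ((h + 1) * D c + x)) := by
        change (if _ then 1 else 0) ≠ 0 ↔ _
        rw [ne_eq, ite_eq_right_iff, not_forall]
        simp
      rw [h4]
      simp only [hcond, hprev, h1, h2, h3, Nat.succ_ne_zero, if_false, Nat.add_sub_cancel]
      refine exists_congr fun l => and_congr_right fun _ => exists_congr fun e =>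
        and_congr_right fun _ => and_congr_right fun _ => and_congr_right fun _ =>
        and_congr_right fun _ => ⟨fun hh => ?_, fun hh => ?_⟩
      · refine (ih ((h + 1) * D c + x) _ hh.1 ?_).1 hh.2
        have := hh.1
        rw [add_mul, one_mul]
        omega
      · have hlt : _ < D c := reachable_lt hh
        refine ⟨hlt, (ih ((h + 1) * D c + x) _ hlt ?_).2 hh⟩
        rw [add_mul, one_mul]
        omega
  have hN : Comp C fun c => (m c + 1) * D c := (hm.add (.const 1)).mul hDC
  have hNb : PolyBdd C.S fun c => (m c + 1) * D c := (hmb.add (.const 1)).mul hDb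
  have hsize : PolyBdd C.S fun c => inputSize (memo step c ((m c + 1) * D c)) := by
    refine (hNb.mul (.const 2)).mono fun c => ?_
    refine (inputSize_le_of_forall _ 1 fun i hi => ?_).trans_eq (by rw [length_memo])
    rw [memo_getD _ _ (by simpa using hi)]
    simp only [hstep]
    split_ifs <;> simp
  have hfin : Dec C.list fun c => ∃ x < D c.1, c.2.getD (m c.1 * D c.1 + x) 0 ≠ 0 ∧
      (∑ l ∈ Finset.range Q, x / (n c.1 + 1) ^ l % (n c.1 + 1) * (Q - l)) * t c.1 ≤ X c.1 := by
    have hDL' : PolyBdd C.list.S fun c => D c.1 :=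
      PolyBdd.comp (π := (Weak.list C).π) hDb (PolyBdd.self.mono (Weak.list C).size_le)
    refine Dec.exists_lt hDL hDL' ?_
    refine (Dec.eq (Comp.get (Weak.nat C.list)
      (((hm.mul hDC).weakenList.weakenNat).add .var)) (.const 0)).not.and ?_
    exact Dec.le ((Comp.sumConst Q fun l =>
      ((Comp.var.div (hB.weakenNat.pow l)).mod hB.weakenNat).mul (.const (Q - l))).mul
      ht.weakenList.weakenNat) hX.weakenList.weakenNat
  obtain ⟨d, hd, hd'⟩ := hfin
  refine ⟨_, Comp.letMemo hN hNb hstepC hsize hd, fun c => (hd' _).trans ?_⟩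
  refine Iff.trans ?_ (exists_deficit_iff (P := fun y => y * t c ≤ X c)).symm
  refine exists_congr fun x => and_congr_right fun hx => and_congr_left fun _ =>
    hval c (m c) _ x hx ?_
  rw [add_mul, one_mul]
  exact Nat.add_lt_add_left hx _

end RAM

/-! ### The partition rule in polynomial time. -/

namespace RAM

variable {C : Ctx}

theorem PolyBdd.weakenNat {f : C.γ → ℕ} (h : PolyBdd C.S f) :
    PolyBdd C.nat.S fun c => f c.1 :=
  PolyBdd.comp (π := (Weak.nat C).π) h (PolyBdd.self.mono (Weak.nat C).size_le)

theorem Comp.underNat {f : C.γ → ℕ → ℕ} (h : Comp C.nat fun c => f c.1 c.2) :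
    Comp C.nat.nat fun c => f c.1.1 c.2 :=
  h.weaken (Weak.nat C).mapNat

theorem Comp.app {f : C.γ → ℕ → ℕ} {g : C.γ → ℕ} (h : Comp C.nat fun c => f c.1 c.2)
    (hg : Comp C g) : Comp C fun c => f c (g c) :=
  hg.subst h

open FairAuction

theorem Comp.maxUpto {f : C.γ → ℕ → ℕ} {N : C.γ → ℕ} (hN : Comp C N) (hNb : PolyBdd C.S N)
    (hf : Comp C.nat fun c => f c.1 c.2) : Comp C fun c => maxUpto (f c) (N c) := by
  obtain ⟨B, hB, h⟩ := hf.exists_size_bound hNb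
  have hrec : ∀ c t, (Nat.rec 0 (fun i x => max x (f c i)) t : ℕ) =
      FairAuction.maxUpto (f c) t := by
    intro c t
    induction t with
    | zero => rfl
    | succ t ih => rw [FairAuction.maxUpto, ← ih]
  refine (iter (F := fun c i x => max x (f c i)) hN hNb (const 0) (var.natMax hf.weakenNat)
    hB fun c t ht => ?_).congr fun c => hrec c _
  rw [hrec]
  induction t with
  | zero => simp [FairAuction.maxUpto]
  | succ t ih =>
    rw [FairAuction.maxUpto]
    rcases max_choice (FairAuction.maxUpto (f c) t) (f c t) with h' | h' <;> rw [h']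
    · exact ih (by omega)
    · exact h c t (by omega)

section Rule

variable {K : ℕ} {n m t x T : C.γ → ℕ} {w : C.γ → ℕ → ℕ}

theorem Comp.roundedSize (ht : Comp C t) (hx : Comp C x) :
    Comp C fun c => roundedSize K (t c) (x c) :=
  Comp.card (f := fun _ => K ^ 2) (P := fun c i => (i + 1) • t c ≤ K ^ 3 • x c) (.const _)
    (.const _) <| (Dec.le ((Comp.var.add (.const 1)).mul ht.weakenNat)
      ((Comp.const (K ^ 3)).mul hx.weakenNat)).congr fun c => by simp only [smul_eq_mul]

theorem Comp.largeSize (ht : Comp C t) (hx : Comp C x) :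
    Comp C fun c => largeSize K (t c) (x c) :=
  (Dec.lt (ht.roundedSize hx) (.const K)).ite (.const 0) (ht.roundedSize hx)

theorem Comp.smallPart (ht : Comp C t) (hx : Comp C x) :
    Comp C fun c => smallPart K (t c) (x c) :=
  (Dec.lt (ht.roundedSize hx) (.const K)).ite hx (.const 0)

theorem Dec.attainable (hn : Comp C n) (hnb : PolyBdd C.S n) (hm : Comp C m)
    (hmb : PolyBdd C.S m) (hw : Comp C.nat fun c => w c.1 c.2) (ht : Comp C t) :
    Dec C fun c => Attainable K (n c) (m c) (w c) (t c) :=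
  (Dec.exists_deficit (s := fun c h => FairAuction.largeSize K (t c) (w c h)) (K ^ 2 - K) hn hnb hm
    hmb (ht.weakenNat.largeSize hw) ht ((Comp.const (K ^ 3)).mul
      (Comp.sum (f := fun c h => FairAuction.smallPart K (t c) (w c h)) hm hmb
        (ht.weakenNat.smallPart hw)))).congr fun c => by
    simp only [Attainable, smul_eq_mul]

/-- Only `m * (K * m + 1)` candidate levels have to be tested, each by the dynamic program. -/
theorem Comp.shareLevel (hn : Comp C n) (hnb : PolyBdd C.S n) (hm : Comp C m)
    (hmb : PolyBdd C.S m) (hw : Comp C.nat fun c => w c.1 c.2) :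
    Comp C fun c => shareLevel K (n c) (m c) (w c) := by
  classical
  have hj : Comp C.nat.nat fun c => c.2 • w c.1.1 c.1.2 := Comp.var.mul hw.weakenNat
  have hA : Dec C.nat.nat fun c => Attainable K (n c.1.1) (m c.1.1) (w c.1.1)
      (c.2 • w c.1.1 c.1.2) :=
    Dec.attainable hn.weakenNat.weakenNat hnb.weakenNat.weakenNat hm.weakenNat.weakenNat
      hmb.weakenNat.weakenNat (w := fun c : C.nat.nat.γ => w c.1.1)
      (hw.weaken ((Weak.nat C.nat).trans (Weak.nat C)).mapNat) hj
  exact Comp.maxUpto (f := fun c g => FairAuction.maxUpto (fun j =>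
      if Attainable K (n c) (m c) (w c) (j • w c g) then j • w c g else 0) (K * m c + 1)) hm hmb <|
    Comp.maxUpto (C := C.nat) (f := fun c j =>
      if Attainable K (n c.1) (m c.1) (w c.1) (j • w c.1 c.2) then j • w c.1 c.2 else 0)
      (((Comp.const K).mul hm.weakenNat).add (.const 1))
      (((PolyBdd.const K).mul hmb.weakenNat).add (.const 1)) (hA.ite hj (.const 0))

theorem Dec.full (hT : Comp C T) (hx : Comp C x) : Dec C fun c => Full K (T c) (x c) :=
  (Dec.le ((Comp.const (K - 2)).mul hT) ((Comp.const (2 * K ^ 2)).mul hx)).congr fun c => by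
    simp only [Full, smul_eq_mul]

theorem Comp.openBag (hm : Comp C m) (hmb : PolyBdd C.S m)
    (hw : Comp C.nat fun c => w c.1 c.2) (hT : Comp C T) :
    Comp C fun c => openBag K (T c) (w c) (m c) := by
  obtain ⟨B, hB, h⟩ := hw.exists_size_bound hmb
  have hw' : Comp C.nat.nat fun c => w c.1.1 c.1.2 := hw.weakenNat
  have hT' : Comp C.nat.nat fun c => T c.1.1 := hT.weakenNat.weakenNat
  have hrec : ∀ c t, (Nat.rec 0 (fun i x => if Full K (T c) (w c i) then x else
      if Full K (T c) (x + w c i) then 0 else x + w c i) t : ℕ) =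
        FairAuction.openBag K (T c) (w c) t := by
    intro c t
    induction t with
    | zero => rfl
    | succ t ih => rw [FairAuction.openBag, ← ih]
  refine (iter (F := fun c i x => if Full K (T c) (w c i) then x else
      if Full K (T c) (x + w c i) then 0 else x + w c i) hm hmb (const 0)
    ((Dec.full hT' hw').ite var ((Dec.full hT' (var.add hw')).ite (const 0) (var.add hw')))
    (hmb.mul (hB.add (PolyBdd.const 1))) fun c t ht => ?_).congr fun c => hrec c _
  rw [hrec]
  refine le_trans ?_ (Nat.mul_le_mul_right _ ht)
  have ht' := fun i hi => h c i (lt_of_lt_of_le hi ht)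
  clear ht
  induction t with
  | zero => simp [FairAuction.openBag]
  | succ t ih =>
    rw [FairAuction.openBag, add_mul, one_mul]
    have h1 := ih fun i hi => ht' i (by omega)
    have h2 := ht' t (by omega)
    have h3 := size_add_le (FairAuction.openBag K (T c) (w c) t) (w c t)
    split_ifs
    · omega
    · simp
    · omega

/-- An index that is capped at `m` is polynomially bounded. -/
theorem PolyBdd.capped (hmb : PolyBdd C.S m) : PolyBdd C.nat.S fun c => min c.2 (m c.1) :=
  hmb.weakenNat.mono fun _ => min_le_right _ _

/-- A variable has bounded bit length but possibly exponential value, so it cannot bound a loop.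
Indices of goods are below `m`, so capping them there changes nothing relevant. -/
theorem Comp.capped (hm : Comp C m) : Comp C.nat fun c => min c.2 (m c.1) :=
  Comp.var.natMin hm.weakenNat

theorem Comp.closedBags (hm : Comp C m) (hmb : PolyBdd C.S m)
    (hw : Comp C.nat fun c => w c.1 c.2) (hT : Comp C T) :
    Comp C fun c => closedBags K (T c) (w c) (m c) := by
  have ho : Comp C.nat fun c => FairAuction.openBag K (T c.1) (w c.1) (min c.2 (m c.1)) :=
    Comp.openBag (C := C.nat) (w := fun c => w c.1) hm.capped hmb.capped hw.underNat hT.weakenNat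
  refine (Comp.card (P := fun c g => ¬ Full K (T c) (w c g) ∧
      Full K (T c) (FairAuction.openBag K (T c) (w c) (min g (m c)) + w c g)) hm hmb
    ((Dec.full hT.weakenNat hw).not.and (Dec.full hT.weakenNat (ho.add hw)))).congr fun c => ?_
  rw [FairAuction.closedBags]
  congr 1
  refine Finset.filter_congr fun g hg => ?_
  rw [min_eq_left (Finset.mem_range.1 hg).le]

theorem Comp.bagOf (hm : Comp C m) (hmb : PolyBdd C.S m)
    (hw : Comp C.nat fun c => w c.1 c.2) (hT : Comp C T) :
    Comp C.nat fun c => bagOf K (T c.1) (m c.1) (w c.1) (min c.2 (m c.1)) :=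
  (Dec.full hT.weakenNat (Comp.app (C := C.nat) (f := fun c => w c.1) hw.underNat hm.capped)).ite
    (hm.weakenNat.add hm.capped)
    (Comp.closedBags (C := C.nat) (w := fun c => w c.1) hm.capped hmb.capped hw.underNat
      hT.weakenNat)

/-- Bundle weights, for an assignment that can be computed on the goods. -/
theorem Comp.bundleSum {f : C.γ → ℕ → ℕ} (hm : Comp C m) (hmb : PolyBdd C.S m)
    (hw : Comp C.nat fun c => w c.1 c.2) (hf : Comp C.nat fun c => f c.1 (min c.2 (m c.1))) :
    Comp C.nat fun c => bundleSum (w c.1) (f c.1) (m c.1) c.2 := by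
  refine (Comp.sumFilter (C := C.nat) (g := fun c h => w c.1 h)
    (P := fun c h => f c.1 (min h (m c.1)) = c.2) hm.weakenNat hmb.weakenNat
    (Dec.eq (Comp.underNat (f := fun c h => f c (min h (m c))) hf) Comp.var.weakenNat)
    hw.underNat).congr fun c => ?_
  rw [FairAuction.bundleSum]
  refine Finset.sum_congr (Finset.filter_congr fun h hh => ?_) fun _ _ => rfl
  rw [min_eq_left (Finset.mem_range.1 hh).le]

theorem Comp.bagWeight (hm : Comp C m) (hmb : PolyBdd C.S m)
    (hw : Comp C.nat fun c => w c.1 c.2) (hT : Comp C T) :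
    Comp C.nat fun c => bagWeight K (T c.1) (m c.1) (w c.1) c.2 :=
  Comp.bundleSum (f := fun c => FairAuction.bagOf K (T c) (m c) (w c)) hm hmb hw
    (hm.bagOf hmb hw hT)

theorem Comp.rankIn {key : C.γ → ℕ → ℕ} {P : C.γ → ℕ → Prop} [∀ c, DecidablePred (P c)]
    (hn : Comp C n) (hnb : PolyBdd C.S n) (hkey : Comp C.nat fun c => key c.1 c.2)
    (hP : Dec C.nat fun c => P c.1 c.2) :
    Comp C.nat fun c => rankIn (key c.1) ((Finset.range (n c.1)).filter (P c.1)) c.2 := by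
  have h1 : Comp C.nat.nat fun c => key c.1.1 c.2 := hkey.underNat
  have h2 : Comp C.nat.nat fun c => key c.1.1 c.1.2 := hkey.weakenNat
  refine (Comp.card (C := C.nat) (P := fun c l => P c.1 l ∧ (key c.1 l < key c.1 c.2 ∨
    key c.1 l = key c.1 c.2 ∧ l < c.2)) hn.weakenNat hnb.weakenNat
    ((hP.weaken (Weak.nat C).mapNat).and ((Dec.lt h1 h2).or
      ((Dec.eq h1 h2).and (Dec.lt .var Comp.var.weakenNat))))).congr fun c => ?_
  rw [FairAuction.rankIn, Finset.filter_filter]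

theorem Comp.slot (hn : Comp C n) (hnb : PolyBdd C.S n) (hm : Comp C m) (hmb : PolyBdd C.S m)
    (hw : Comp C.nat fun c => w c.1 c.2) :
    Comp C.nat fun c => slot K (n c.1) (m c.1) (w c.1) (min c.2 (m c.1)) := by
  have hT : Comp C fun c => FairAuction.shareLevel K (n c) (m c) (w c) :=
    hn.shareLevel hnb hm hmb hw
  generalize hT' : (fun c => FairAuction.shareLevel K (n c) (m c) (w c)) = T at hT
  have hb := hm.bagOf (K := K) hmb hw hT
  have hY := hm.bagWeight (K := K) hmb hw hT
  have hf : Dec C.nat fun c => Full K (T c.1)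
      (FairAuction.bagWeight K (T c.1) (m c.1) (w c.1) c.2) := Dec.full hT.weakenNat hY
  have hr : Comp C.nat fun c => FairAuction.rankIn
      (FairAuction.bagWeight K (T c.1) (m c.1) (w c.1)) (fullBags K (T c.1) (m c.1) (w c.1)) c.2 :=
    Comp.rankIn (key := fun c => FairAuction.bagWeight K (T c) (m c) (w c))
      (P := fun c k => Full K (T c) (FairAuction.bagWeight K (T c) (m c) (w c) k))
      ((Comp.const 2).mul hm) ((PolyBdd.const 2).mul hmb) hY hf
  have hn1 : Comp C.nat fun c => n c.1 - 1 := (hn.sub (.const 1)).weakenNat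
  have hmain : Comp C.nat fun c => FairAuction.slotAt K (T c.1) (n c.1) (m c.1) (w c.1)
      (min c.2 (m c.1)) := by
    refine Dec.ite ((Dec.eq hT.weakenNat (.const 0)).not.and (Dec.subst hb
      (hf.weaken (Weak.nat C).mapNat))) (Comp.natMin ?_ hn1) hn1
    exact Comp.app (C := C.nat) (f := fun c => FairAuction.rankIn
      (FairAuction.bagWeight K (T c.1) (m c.1) (w c.1)) (fullBags K (T c.1) (m c.1) (w c.1)))
      (Comp.underNat (f := fun c => FairAuction.rankIn
        (FairAuction.bagWeight K (T c) (m c) (w c)) (fullBags K (T c) (m c) (w c))) hr) hb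
  refine hmain.congr fun c => ?_
  rw [FairAuction.slot, ← hT']

end Rule

end RAM

namespace FairAuction

open Finset

/-! ### The mechanism on natural numbers -/

section NatRule

variable (K n m : ℕ) (W B : ℕ → ℕ)

/-- The welfare of the allocation rule, for natural weights and bids. -/
noncomputable def natWelfare : ℕ :=
  ∑ i ∈ range n, B i * bundleSum W (slot K n m W) m (rankIn B (range n) i)

/-- The welfare of the agents other than `i`. -/
noncomputable def natOthers (i : ℕ) : ℕ :=
  ∑ j ∈ range n, if j = i then 0 else B j * bundleSum W (slot K n m W) m (rankIn B (range n) j)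

/-- The payment of agent `i`. -/
noncomputable def natPay (i : ℕ) : ℕ :=
  natWelfare K n m W (Function.update B i 0) - natOthers K n m W B i

/-- The owner of good `g`. -/
noncomputable def natOwner (g : ℕ) : ℕ :=
  ∑ i ∈ range n, if rankIn B (range n) i = slot K n m W g then i else 0

end NatRule

/-- Division by a positive number. -/
noncomputable def divHom (D : ℕ) : ℕ →+ ℝ≥0 where
  toFun x := x / D
  map_zero' := by simp
  map_add' x y := by rw [Nat.cast_add, add_div]

theorem divHom_apply (D x : ℕ) : divHom D x = x / D := rfl

theorem divHom_strictMono {D : ℕ} (hD : D ≠ 0) : StrictMono (divHom D) := fun _ _ h =>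
  div_lt_div_of_pos_right (Nat.cast_lt.2 h) (Nat.cast_pos.2 (Nat.pos_of_ne_zero hD))

section Scaling

variable {K n m D E : ℕ} {W B : ℕ → ℕ} {w : Fin m → ℝ≥0} {b : Fin n → ℝ≥0}

/-- Weights over a common denominator are the image of their numerators under a strictly monotone
additive map, so the rule may be run on the numerators. -/
theorem slot_of_scaled (hD : D ≠ 0) (hw : extend w = fun h => divHom D (W h)) :
    slot K n m (extend w) = slot K n m W := by
  rw [hw, slot_map (divHom_strictMono hD)]

theorem slotWeight_of_scaled (hD : D ≠ 0) (hw : extend w = fun h => divHom D (W h)) (p : Fin n) :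
    slotWeight K w p = divHom D (bundleSum W (slot K n m W) m p) := by
  rw [slotWeight, slot_of_scaled hD hw, hw, map_bundleSum]

theorem position_of_scaled (hE : E ≠ 0) (hb : extend b = fun i => divHom E (B i)) (i : Fin n) :
    (position b i : ℕ) = rankIn B (range n) i := by
  rw [position_val, hb, rankIn_map (divHom_strictMono hE)]

theorem mul_slotWeight_of_scaled (hD : D ≠ 0) (hE : E ≠ 0)
    (hw : extend w = fun h => divHom D (W h)) (hb : extend b = fun i => divHom E (B i))
    (i : Fin n) : b i * slotWeight K w (position b i) =
      divHom (D * E) (B i * bundleSum W (slot K n m W) m (rankIn B (range n) i)) := by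
  rw [slotWeight_of_scaled hD hw, position_of_scaled hE hb, ← extend_val b i,
    congrFun hb i, divHom_apply, divHom_apply, divHom_apply, div_mul_div_comm, mul_comm (E : ℝ≥0)]
  push_cast
  rfl

theorem sortedWelfare_of_scaled (hD : D ≠ 0) (hE : E ≠ 0)
    (hw : extend w = fun h => divHom D (W h)) (hb : extend b = fun i => divHom E (B i)) :
    sortedWelfare K w b = divHom (D * E) (natWelfare K n m W B) := by
  rw [sortedWelfare, natWelfare, map_sum, ← Fin.sum_univ_eq_sum_range (fun i => divHom (D * E)
    (B i * bundleSum W (slot K n m W) m (rankIn B (range n) i)))]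
  exact sum_congr rfl fun i _ => mul_slotWeight_of_scaled hD hE hw hb i

theorem extend_update (b : Fin n → ℝ≥0) (i : Fin n) :
    extend (Function.update b i 0) = Function.update (extend b) i 0 := by
  ext j
  by_cases hj : j < n
  · rw [show extend (Function.update b i 0) j = _ from extend_val (Function.update b i 0) ⟨j, hj⟩]
    rcases eq_or_ne (⟨j, hj⟩ : Fin n) i with rfl | h
    · simp
    · rw [Function.update_of_ne h, Function.update_of_ne fun h' => h (Fin.ext h')]
      exact congrArg _ (extend_val b ⟨j, hj⟩).symm
  · have h : j ≠ i := fun h' => hj (h' ▸ i.2)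
    simp [extend, hj, Function.update_of_ne h]

theorem pay_of_scaled [NeZero n] (hD : D ≠ 0) (hE : E ≠ 0)
    (hw : extend w = fun h => divHom D (W h)) (hb : extend b = fun i => divHom E (B i))
    (i : Fin n) : (fairMechanism K).pay w b i = divHom (D * E) (natPay K n m W B i) := by
  have h1 : sortedWelfare K w (Function.update b i 0) =
      divHom (D * E) (natWelfare K n m W (Function.update B i 0)) := by
    refine sortedWelfare_of_scaled hD hE hw ?_
    rw [extend_update, hb]
    ext j
    rcases eq_or_ne j i with rfl | h
    · simp
    · rw [Function.update_of_ne h, Function.update_of_ne h]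
  have h2 : ∑ j ∈ univ.erase i, b j * slotWeight K w (position b j) =
      divHom (D * E) (natOthers K n m W B i) := by
    rw [natOthers, map_sum, ← Fin.sum_univ_eq_sum_range (fun j => divHom (D * E)
      (if j = i then 0 else B j * bundleSum W (slot K n m W) m (rankIn B (range n) j))),
      ← add_sum_erase _ _ (mem_univ i), if_pos rfl, map_zero, zero_add]
    refine sum_congr rfl fun j hj => ?_
    rw [if_neg fun h => ne_of_mem_erase hj (Fin.ext h)]
    exact mul_slotWeight_of_scaled hD hE hw hb j
  change sortedWelfare K w (Function.update b i 0) - _ = _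
  -- Casts into `ℝ≥0` and division respect truncated subtraction, so the order of the two terms is
  -- irrelevant here.
  rw [h1, h2, natPay, divHom_apply, divHom_apply, divHom_apply, Nat.cast_tsub, NNReal.sub_div]

/-- Positions form a permutation, so exactly one agent satisfies the condition in the sum and her
index is the value. -/
theorem alloc_of_scaled [NeZero n] (hD : D ≠ 0) (hE : E ≠ 0)
    (hw : extend w = fun h => divHom D (W h)) (hb : extend b = fun i => divHom E (B i))
    (g : Fin m) : ((fairMechanism K).alloc w b g : ℕ) = natOwner K n m W B g := by
  set i := (fairMechanism K).alloc w b g with hi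
  have h : (position b i : ℕ) = slot K n m W g := by
    rw [hi, ← slot_of_scaled hD hw]
    simp [fairMechanism]
  rw [natOwner, sum_eq_single_of_mem (i : ℕ) (mem_range.2 i.2)]
  · rw [← position_of_scaled hE hb, if_pos h]
  · intro j hj hne
    refine if_neg fun hc => hne ?_
    rw [← h, ← position_of_scaled hE hb ⟨j, mem_range.1 hj⟩] at hc
    exact congrArg Fin.val ((position b).injective (Fin.ext hc))

end Scaling

/-! ### Rational data -/

section Rational

variable {k : ℕ} (x : Fin k → ℚ≥0)

/-- The numerators of a tuple of rational numbers. -/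
def numAt (i : ℕ) : ℕ := extend (fun i => (x i).num) i

/-- The denominators of a tuple of rational numbers. -/
def denAt (i : ℕ) : ℕ := extend (fun i => (x i).den) i

/-- A common denominator. -/
def commonDen : ℕ := ∏ i ∈ range k, denAt x i

/-- The numerators over the common denominator. -/
def scaled (i : ℕ) : ℕ := numAt x i * commonDen x / denAt x i

theorem commonDen_ne_zero : commonDen x ≠ 0 := by
  refine prod_ne_zero_iff.2 fun i hi => ?_
  rw [denAt, show extend _ i = _ from extend_val (fun i => (x i).den) ⟨i, mem_range.1 hi⟩]
  exact (x _).den_ne_zero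

theorem extend_eq_scaled :
    (extend fun i => (x i : ℝ≥0)) = fun i => divHom (commonDen x) (scaled x i) := by
  ext1 i
  by_cases hi : i < k
  · have h1 : extend (fun i => (x i : ℝ≥0)) i = x ⟨i, hi⟩ :=
      extend_val (fun i => (x i : ℝ≥0)) ⟨i, hi⟩
    have h2 : numAt x i = (x ⟨i, hi⟩).num := extend_val (fun i => (x i).num) ⟨i, hi⟩
    have h3 : denAt x i = (x ⟨i, hi⟩).den := extend_val (fun i => (x i).den) ⟨i, hi⟩
    have h4 : denAt x i ∣ commonDen x := dvd_prod_of_mem _ (mem_range.2 hi)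
    have h5 : (denAt x i : ℝ≥0) ≠ 0 := by
      rw [h3]
      exact Nat.cast_ne_zero.2 (x _).den_ne_zero
    have h6 : (commonDen x : ℝ≥0) ≠ 0 := Nat.cast_ne_zero.2 (commonDen_ne_zero x)
    rw [h1, divHom_apply, scaled, Nat.cast_div (h4.mul_left _) h5, NNRat.cast_def, ← h2, ← h3]
    push_cast
    field_simp
  -- Outside the tuple the numerator is zero, hence so is the quotient, even though the denominator
  -- is zero there.
  · simp [scaled, numAt, extend, hi]

end Rational

theorem getD_ofFn {k : ℕ} (f : Fin k → ℕ) (j : ℕ) : (List.ofFn f).getD j 0 = extend f j := by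
  by_cases hj : j < k
  · rw [List.getD_eq_getElem _ _ (by simpa using hj)]
    simp [extend, hj]
  · rw [List.getD_eq_default _ _ (by simpa using hj)]
    simp [extend, hj]

theorem getD_flatMap_pair {α : Type*} (f g : α → ℕ) (l : List α) (j : ℕ) :
    (l.flatMap fun x => [f x, g x]).getD j 0 =
      if j % 2 = 0 then (l.map f).getD (j / 2) 0 else (l.map g).getD (j / 2) 0 := by
  induction l generalizing j with
  | nil => simp
  | cons x l ih =>
    match j with
    | 0 => simp
    | 1 => simp
    | j + 2 =>
      rw [Nat.add_mod_right, Nat.add_div_right _ two_pos]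
      simpa using ih j

theorem getD_flatMap_ofFn {α : Type*} {k : ℕ} (f g : α → ℕ) (x : Fin k → α) (j : ℕ) :
    ((List.ofFn x).flatMap fun x => [f x, g x]).getD j 0 =
      if j % 2 = 0 then extend (fun i => f (x i)) (j / 2)
        else extend (fun i => g (x i)) (j / 2) := by
  rw [getD_flatMap_pair, List.map_ofFn, List.map_ofFn, getD_ofFn, getD_ofFn]
  rfl

theorem length_flatMap_ofFn {α : Type*} {k : ℕ} (f g : α → ℕ) (x : Fin k → α) :
    ((List.ofFn x).flatMap fun x => [f x, g x]).length = 2 * k := by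
  simp [List.length_flatMap, Function.comp_def, List.ofFn_const, mul_comm]

namespace RatInstance

variable (I : RatInstance)

theorem length_encode : I.encode.length = 2 + 2 * I.m + 2 * I.n := by
  rw [encode, List.length_append, List.length_append, length_flatMap_ofFn, length_flatMap_ofFn]
  rfl

theorem encode_getD_zero : I.encode.getD 0 0 = I.n := rfl

theorem encode_getD_one : I.encode.getD 1 0 = I.m := rfl

theorem encode_getD_goods {j : ℕ} (hj : j < 2 * I.m) : I.encode.getD (j + 2) 0 =
    if j % 2 = 0 then numAt I.w (j / 2) else denAt I.w (j / 2) := by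
  rw [encode, List.getD_append _ _ _ _ (by
    rw [List.length_append, length_flatMap_ofFn, List.length_cons]; simp; omega),
    List.getD_append_right _ _ _ _ (by simp)]
  exact getD_flatMap_ofFn _ _ _ j

theorem encode_getD_agents (j : ℕ) : I.encode.getD (j + (2 + 2 * I.m)) 0 =
    if j % 2 = 0 then numAt I.b (j / 2) else denAt I.b (j / 2) := by
  have h : ([I.n, I.m] ++ (List.ofFn I.w).flatMap fun q => [q.num, q.den]).length =
      2 + 2 * I.m := by
    rw [List.length_append, length_flatMap_ofFn]
    rfl
  rw [encode, List.getD_append_right _ _ _ _ (by omega), h, Nat.add_sub_cancel]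
  exact getD_flatMap_ofFn _ _ _ j

end RatInstance

end FairAuction

/-! ### Payments and owners in polynomial time. -/

namespace RAM

open FairAuction

theorem length_le_inputSize (l : List ℕ) : l.length ≤ inputSize l := by
  induction l with
  | nil => simp
  | cons a l ih =>
    rw [List.length_cons, show inputSize (a :: l) = 1 + Nat.size a + inputSize l from rfl]
    omega

section Rule

variable {C : Ctx} {K : ℕ} {n m : C.γ → ℕ} {W B : C.γ → ℕ → ℕ}

theorem Comp.position (hn : Comp C n) (hnb : PolyBdd C.S n) (hB : Comp C.nat fun c => B c.1 c.2) :
    Comp C.nat fun c => FairAuction.rankIn (B c.1) (Finset.range (n c.1)) c.2 :=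
  (Comp.rankIn (P := fun _ _ => True) hn hnb hB (Dec.congr (P := fun _ => 0 = 0)
    (Dec.eq (.const 0) (.const 0)) fun _ => by simp)).congr fun c => by simp

theorem Comp.mulSlotWeight (hn : Comp C n) (hnb : PolyBdd C.S n) (hm : Comp C m)
    (hmb : PolyBdd C.S m) (hW : Comp C.nat fun c => W c.1 c.2)
    (hB : Comp C.nat fun c => B c.1 c.2) :
    Comp C.nat fun c => B c.1 c.2 * FairAuction.bundleSum (W c.1)
      (FairAuction.slot K (n c.1) (m c.1) (W c.1)) (m c.1)
      (FairAuction.rankIn (B c.1) (Finset.range (n c.1)) c.2) := by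
  have hZ := Comp.bundleSum (f := fun c => FairAuction.slot K (n c) (m c) (W c)) hm hmb hW
    (Comp.slot hn hnb hm hmb hW)
  exact hB.mul (Comp.app (C := C.nat) (Comp.underNat (f := fun c => FairAuction.bundleSum (W c)
    (FairAuction.slot K (n c) (m c) (W c)) (m c)) hZ) (hn.position hnb hB))

theorem Comp.natWelfare (hn : Comp C n) (hnb : PolyBdd C.S n) (hm : Comp C m)
    (hmb : PolyBdd C.S m) (hW : Comp C.nat fun c => W c.1 c.2)
    (hB : Comp C.nat fun c => B c.1 c.2) :
    Comp C fun c => natWelfare K (n c) (m c) (W c) (B c) :=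
  Comp.sum (f := fun c i => B c i * FairAuction.bundleSum (W c)
      (FairAuction.slot K (n c) (m c) (W c)) (m c)
      (FairAuction.rankIn (B c) (Finset.range (n c)) i)) hn hnb
    (Comp.mulSlotWeight hn hnb hm hmb hW hB)

theorem Comp.natOthers (hn : Comp C n) (hnb : PolyBdd C.S n) (hm : Comp C m)
    (hmb : PolyBdd C.S m) (hW : Comp C.nat fun c => W c.1 c.2)
    (hB : Comp C.nat fun c => B c.1 c.2) :
    Comp C.nat fun c => natOthers K (n c.1) (m c.1) (W c.1) (B c.1) c.2 :=
  Comp.sum (C := C.nat) (f := fun c j => if j = c.2 then 0 else B c.1 j *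
      FairAuction.bundleSum (W c.1) (FairAuction.slot K (n c.1) (m c.1) (W c.1)) (m c.1)
      (FairAuction.rankIn (B c.1) (Finset.range (n c.1)) j)) hn.weakenNat hnb.weakenNat
    ((Dec.eq .var Comp.var.weakenNat).ite (.const 0) (Comp.underNat
      (f := fun c j => B c j * FairAuction.bundleSum (W c)
        (FairAuction.slot K (n c) (m c) (W c)) (m c)
        (FairAuction.rankIn (B c) (Finset.range (n c)) j))
      (Comp.mulSlotWeight hn hnb hm hmb hW hB)))

theorem Comp.natPay (hn : Comp C n) (hnb : PolyBdd C.S n) (hm : Comp C m)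
    (hmb : PolyBdd C.S m) (hW : Comp C.nat fun c => W c.1 c.2)
    (hB : Comp C.nat fun c => B c.1 c.2) :
    Comp C.nat fun c => natPay K (n c.1) (m c.1) (W c.1) (B c.1) c.2 := by
  have hB' : Comp C.nat.nat fun c => Function.update (B c.1.1) c.1.2 0 c.2 :=
    ((Dec.eq .var Comp.var.weakenNat).ite (.const 0) hB.underNat).congr fun c => by
      rw [Function.update_apply]
  exact (Comp.natWelfare (C := C.nat) (W := fun c => W c.1)
    (B := fun c => Function.update (B c.1) c.2 0) hn.weakenNat hnb.weakenNat hm.weakenNat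
    hmb.weakenNat hW.underNat hB').sub (hn.natOthers hnb hm hmb hW hB)

theorem Comp.natOwner (hn : Comp C n) (hnb : PolyBdd C.S n) (hm : Comp C m)
    (hmb : PolyBdd C.S m) (hW : Comp C.nat fun c => W c.1 c.2)
    (hB : Comp C.nat fun c => B c.1 c.2) :
    Comp C.nat fun c => natOwner K (n c.1) (m c.1) (W c.1) (B c.1) (min c.2 (m c.1)) :=
  Comp.sum (C := C.nat) (f := fun c i => if FairAuction.rankIn (B c.1) (Finset.range (n c.1)) i =
      FairAuction.slot K (n c.1) (m c.1) (W c.1) (min c.2 (m c.1)) then i else 0)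
    hn.weakenNat hnb.weakenNat ((Dec.eq (Comp.underNat
      (f := fun c => FairAuction.rankIn (B c) (Finset.range (n c))) (hn.position hnb hB))
      (Comp.slot hn hnb hm hmb hW).weakenNat).ite .var (.const 0))

end Rule

end RAM

/-! ### Decoding rational instances and producing the output. -/

namespace FairAuction

open RAM

namespace RatInstance

theorem polyBdd_length : PolyBdd (Ctx.input encode).S fun I => I.encode.length :=
  PolyBdd.self.mono fun I => length_le_inputSize I.encode

theorem polyBdd_n : PolyBdd (Ctx.input encode).S n :=
  polyBdd_length.mono fun I => by rw [length_encode]; omega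

theorem polyBdd_m : PolyBdd (Ctx.input encode).S m :=
  polyBdd_length.mono fun I => by rw [length_encode]; omega

theorem comp_getD {C : Ctx} (v : Weak C (Ctx.input encode)) {i : C.γ → ℕ} (hi : Comp C i) :
    Comp C fun c => (v.π c).encode.getD (i c) 0 :=
  Comp.subst hi ((Comp.input encode).weaken v.mapNat)

theorem comp_n : Comp (Ctx.input encode) n :=
  (comp_getD (Weak.refl _) (.const 0)).congr encode_getD_zero

theorem comp_m : Comp (Ctx.input encode) m :=
  (comp_getD (Weak.refl _) (.const 1)).congr encode_getD_one

/-- Used with `r = 0` for numerators and `r = 1` for denominators. The test is needed because the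
data of the bids follow; the bids come last, so beyond them the input already reads as zero. -/
theorem comp_goods (r : ℕ) : Comp (Ctx.input encode).nat fun c =>
    if c.2 < c.1.m then c.1.encode.getD (2 * c.2 + r + 2) 0 else 0 :=
  (Dec.lt .var comp_m.weakenNat).ite (comp_getD (Weak.nat _)
    ((((Comp.const 2).mul .var).add (.const r)).add (.const 2))) (.const 0)

theorem comp_agents (r : ℕ) : Comp (Ctx.input encode).nat fun c =>
    c.1.encode.getD (2 * c.2 + r + (2 + 2 * c.1.m)) 0 :=
  comp_getD (Weak.nat _) ((((Comp.const 2).mul .var).add (.const r)).add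
    ((Comp.const 2).add ((Comp.const 2).mul comp_m.weakenNat)))

theorem comp_numAt_w : Comp (Ctx.input encode).nat fun c => numAt c.1.w c.2 :=
  (comp_goods 0).congr fun c => by
    split_ifs with h
    · rw [encode_getD_goods _ (by omega), if_pos (by omega)]
      congr 1
      omega
    · simp [numAt, extend, h]

theorem comp_denAt_w : Comp (Ctx.input encode).nat fun c => denAt c.1.w c.2 :=
  (comp_goods 1).congr fun c => by
    split_ifs with h
    · rw [encode_getD_goods _ (by omega), if_neg (by omega)]
      congr 1
      omega
    · simp [denAt, extend, h]

theorem comp_numAt_b : Comp (Ctx.input encode).nat fun c => numAt c.1.b c.2 :=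
  (comp_agents 0).congr fun c => by
    rw [encode_getD_agents, if_pos (by omega)]
    congr 1
    omega

theorem comp_denAt_b : Comp (Ctx.input encode).nat fun c => denAt c.1.b c.2 :=
  (comp_agents 1).congr fun c => by
    rw [encode_getD_agents, if_neg (by omega)]
    congr 1
    omega

theorem comp_commonDen_w : Comp (Ctx.input encode) fun I => commonDen I.w :=
  (Comp.prod (C := Ctx.input encode) (f := fun I => denAt I.w) comp_m polyBdd_m comp_denAt_w :)

theorem comp_commonDen_b : Comp (Ctx.input encode) fun I => commonDen I.b :=
  (Comp.prod (C := Ctx.input encode) (f := fun I => denAt I.b) comp_n polyBdd_n comp_denAt_b :)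

theorem comp_scaled_w : Comp (Ctx.input encode).nat fun c => scaled c.1.w c.2 :=
  (comp_numAt_w.mul comp_commonDen_w.weakenNat).div comp_denAt_w

theorem comp_scaled_b : Comp (Ctx.input encode).nat fun c => scaled c.1.b c.2 :=
  (comp_numAt_b.mul comp_commonDen_b.weakenNat).div comp_denAt_b

/-- The numerators of the payments. -/
noncomputable def payNum (K : ℕ) (I : RatInstance) : ℕ → ℕ :=
  natPay K I.n I.m (scaled I.w) (scaled I.b)

/-- The common denominator of the payments. -/
def payDen (I : RatInstance) : ℕ := commonDen I.w * commonDen I.b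

/-- The owners of the goods. -/
noncomputable def owner (K : ℕ) (I : RatInstance) : ℕ → ℕ :=
  natOwner K I.n I.m (scaled I.w) (scaled I.b)

theorem comp_payNum (K : ℕ) : Comp (Ctx.input encode).nat fun c => payNum K c.1 c.2 :=
  (Comp.natPay (C := Ctx.input encode) (K := K) (W := fun I => scaled I.w)
    (B := fun I => scaled I.b) comp_n polyBdd_n comp_m polyBdd_m comp_scaled_w comp_scaled_b :)

theorem comp_payDen : Comp (Ctx.input encode) payDen :=
  comp_commonDen_w.mul comp_commonDen_b

theorem comp_owner (K : ℕ) :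
    Comp (Ctx.input encode).nat fun c => owner K c.1 (min c.2 c.1.m) :=
  (Comp.natOwner (C := Ctx.input encode) (K := K) (W := fun I => scaled I.w)
    (B := fun I => scaled I.b) comp_n polyBdd_n comp_m polyBdd_m comp_scaled_w comp_scaled_b :)

theorem payDen_ne_zero (I : RatInstance) : payDen I ≠ 0 :=
  mul_ne_zero (commonDen_ne_zero _) (commonDen_ne_zero _)

theorem pay_eq (K : ℕ) (I : RatInstance) (i : Fin I.n) :
    (fairMechanism K).pay I.realW I.realB i = (payNum K I i : ℝ≥0) / (payDen I : ℝ≥0) :=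
  pay_of_scaled (commonDen_ne_zero I.w) (commonDen_ne_zero I.b) (extend_eq_scaled I.w)
    (extend_eq_scaled I.b) i

theorem alloc_eq (K : ℕ) (I : RatInstance) (g : Fin I.m) :
    ((fairMechanism K).alloc I.realW I.realB g : ℕ) = owner K I g :=
  alloc_of_scaled (commonDen_ne_zero I.w) (commonDen_ne_zero I.b) (extend_eq_scaled I.w)
    (extend_eq_scaled I.b) g

/-- The output of the mechanism. -/
noncomputable def output (K : ℕ) (I : RatInstance) : List ℕ :=
  List.ofFn (fun g : Fin I.m => owner K I g) ++
    (List.ofFn fun i : Fin I.n => (payNum K I i, payDen I)).flatMap fun x => [x.1, x.2]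

theorem length_output (K : ℕ) (I : RatInstance) : (output K I).length = I.m + 2 * I.n := by
  rw [output, List.length_append, length_flatMap_ofFn, List.length_ofFn]

theorem output_getD (K : ℕ) (I : RatInstance) (j : ℕ) : (output K I).getD j 0 =
    if j < I.m then owner K I (min j I.m) else if (j - I.m) / 2 < I.n then
      if (j - I.m) % 2 = 0 then payNum K I ((j - I.m) / 2) else payDen I else 0 := by
  rw [output]
  split_ifs with h1 h2 h3
  · rw [List.getD_append _ _ _ _ (by simpa using h1), getD_ofFn, min_eq_left h1.le]
    simp [extend, h1]
  all_goals
    rw [List.getD_append_right _ _ _ _ (by simpa using h1), List.length_ofFn, getD_flatMap_ofFn]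
    simp [extend, *]

theorem comp_output (K : ℕ) :
    Comp (Ctx.input encode).nat fun c => (output K c.1).getD c.2 0 := by
  have hi : Comp (Ctx.input encode).nat fun c => c.2 - c.1.m := Comp.var.sub comp_m.weakenNat
  have hpay : Comp (Ctx.input encode).nat fun c => payNum K c.1 ((c.2 - c.1.m) / 2) :=
    Comp.app (C := (Ctx.input encode).nat) (f := fun c => payNum K c.1)
      (Comp.underNat (C := Ctx.input encode) (f := payNum K) (comp_payNum K)) (hi.div (.const 2))
  exact ((Dec.lt .var comp_m.weakenNat).ite (comp_owner K)
    ((Dec.lt (hi.div (.const 2)) comp_n.weakenNat).ite ((Dec.eq (hi.mod (.const 2))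
      (.const 0)).ite hpay comp_payDen.weakenNat) (.const 0))).congr fun c =>
    (output_getD K c.1 c.2).symm

theorem polyTimeComputable_output (K : ℕ) : PolyTimeComputable encode (output K) := by
  have hb : PolyBdd (Ctx.input encode).S fun I => (output K I).length :=
    (polyBdd_m.add ((PolyBdd.const 2).mul polyBdd_n)).mono fun I => (length_output K I).le
  obtain ⟨B, hB, h⟩ := Comp.exists_size_bound (f := fun I j => (output K I).getD j 0)
    (comp_output K) hb
  exact polyTimeComputable_of_comp ((comp_m.add ((Comp.const 2).mul comp_n)).congr fun I =>
    (length_output K I).symm) hb (comp_output K)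
    ((hb.mul ((PolyBdd.const 1).add hB)).mono fun I => inputSize_le_of_forall _ _ (h I))

end RatInstance

theorem fairMechanism_isPolyTime (K : ℕ) : (fairMechanism K).IsPolyTime := by
  refine ⟨fun I i => RatInstance.payNum K I i, fun I _ => I.payDen, fun I i =>
    ⟨I.payDen_ne_zero, I.pay_eq K i⟩, ?_⟩
  simp only [RatInstance.alloc_eq]
  exact RatInstance.polyTimeComputable_output K

end FairAuction

/-! ### The main theorem. -/

theorem theorem2 (ε : ℝ) (hε : 0 < ε) (hε' : ε < 1) :
    ∃ M : FairAuction.Mechanism, M.IsDSIC ∧ M.IsPolyTime ∧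
      ∀ {n m : ℕ} [NeZero n] (w : Fin m → ℝ≥0) (v : Fin n → ℝ≥0),
        FairAuction.IsApproxMMS (1 / 2 - ε) w (M.alloc w v) ∧
          FairAuction.optFAMMS w v ≤ FairAuction.socialWelfare w v (M.alloc w v) := by
  -- `K ≥ 3` makes the threshold factor `K - 2` positive; `K ≥ 3 / (2 * ε)` brings the loss `3 / (2
  -- * K)` below `ε`.
  obtain ⟨K, hK⟩ := exists_nat_ge (max 3 (3 / (2 * ε)))
  have hK3 : 3 ≤ K := by exact_mod_cast (le_max_left _ _).trans hK
  have hK0 : (0 : ℝ) < K := by exact_mod_cast (by omega : 0 < K)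
  have hKε : 3 / (2 * (K : ℝ)) ≤ ε := by
    have h := (le_max_right _ _).trans hK
    rw [div_le_iff₀ (by positivity)] at h ⊢
    linarith
  exact ⟨FairAuction.fairMechanism K, FairAuction.fairMechanism_isDSIC hK3,
    FairAuction.fairMechanism_isPolyTime K, fun w v =>
      ⟨FairAuction.fairMechanism_isApproxMMS hK3 hKε w v,
        FairAuction.optFAMMS_le_socialWelfare hK3 w v⟩⟩
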